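/- Let $H:\mathbb{R}^4\to\mathbb{R}$ be real-analytic, $\omega_0=\sum_{i=1,2} dy_i\wedge dx_i$, and let $X_H=J_0\nabla H$, $J_0(x,y)=(y,-x)$, be its Hamiltonian vector field. Let $p_c\in H^{-1}(0)$ be a saddle-center equilibrium with Moser's coordinates $(q_1,q_2,p_1,p_2)$: a real-analytic symplectic chart, defined on a small polydisk about $0$ (sent to $p_c$), in which $$H=-\alpha I_1+\beta I_2+R(I_1,I_2),\quad I_1=q_1p_1,\ I_2=\tfrac{q_2^2+p_2^2}{2},\quad R=O(I_1^2+I_2^2),\quad \alpha,\beta>0,$$ the polydisk being so small that $\alpha-\partial_{I_1}R>0$ and $\beta+\partial_{I_2}R>0$ on it. Let $E>0$, and let $S_E\subset H^{-1}(E)$ be a smoothly embedded closed $3$-ball of regular points of $H$ whose boundary $\partial S_E$ is the part $\{q_1+p_1=0\}$ of $H^{-1}(E)$ in the chart, and which in the chart is $H^{-1}(E)\cap\{q_1+p_1\ge 0\}$. Put $\dot S_E=S_E\setminus\partial S_E$. On $\partial S_E$ lie the Lyapunoff orbit $P_{2,E}=\{q_1=p_1=0\}$ and the hemispheres $U_{1,E}=\{q_1<0\}$,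 $U_{2,E}=\{q_1>0\}$. Assume that $S_E$ admits a $2$-$3$ foliation adapted to the flow of $X_H$, that is, a foliation of $S_E\setminus(P_{2,E}\cup P_{3,E})$, where $P_{3,E}\subset\dot S_E$ is an unknotted periodic orbit of Conley--Zehnder index $3$, whose leaves are all transverse to $X_H$ and are: $U_{1,E}$ and $U_{2,E}$; a cylinder $V_E\subset\dot S_E$ whose closure has boundary $P_{3,E}\cup P_{2,E}$; and planes $D_\tau$, $\tau\in(0,1)$, which foliate $\dot S_E\setminus(P_{3,E}\cup V_E)$, have closures with boundary $P_{3,E}$, and converge to $V_E\cup P_{2,E}\cup U_{1,E}$ as $\tau\to0^+$ and to $V_E\cup P_{2,E}\cup U_{2,E}$ as $\tau\to1^-$. (The closures of $V_E$ and $D_\tau$ are compact embedded surfaces, smooth inside and $C^1$ up to the boundary.) Let $0<\tau_0<\tau_1<1$, and let $C^u_{\tau_0}$ and $C^s_{\tau_1}$ be the intersections with $D_{\tau_0}$ and $D_{\tau_1}$ of the branches in $\dot S_E$ of the local unstable manifold $\{q_1=0,\ 0<p_1<\rho\}$ and the local stable manifold $\{p_1=0,\ 0<q_1<\rho\}$ of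 $P_{2,E}$ in $H^{-1}(E)$, for some $\rho>0$. Let $\tau_0$ be close to $0$ and $\tau_1$ close to $1$, in the sense that $C^u_{\tau_0}$ and $C^s_{\tau_1}$ are embedded circles, bounding closed disks $B^u_{\tau_0}\subset D_{\tau_0}$ and $B^s_{\tau_1}\subset D_{\tau_1}$, that the points of $B^u_{\tau_0}\setminus C^u_{\tau_0}$ are exactly the points where the trajectories entering $S_E$ through $U_{1,E}$ first hit $D_{\tau_0}$, and that the points of $B^s_{\tau_1}\setminus C^s_{\tau_1}$ are exactly the points where the trajectories leaving $S_E$ through $U_{2,E}$ last hit $D_{\tau_1}$. Let the global and the local transition map $$\Psi^g:D_{\tau_0}\to D_{\tau_1},\qquad \Psi^l:D_{\tau_1}\setminus B^s_{\tau_1}\to D_{\tau_0}\setminus B^u_{\tau_0}$$ of the flow in $\dot S_E$ be defined: each sends a point to the first point of its target on the positive trajectory, and is a homeomorphism onto its target. Then there is $N\ge 1$ such that $(\Psi^g\circ\Psi^l)^{N-1}\circ\Psi^g$ is well defined on $C^u_{\tau_0}$ (that is, $(\Psi^g\circ\Psi^l)^{j}\circ\Psi^g(C^u_{\tau_0})\subset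 D_{\tau_1}\setminus B^s_{\tau_1}$ for $0\le j<N-1$) and $$(\Psi^g\circ\Psi^l)^{N-1}\circ\Psi^g(C^u_{\tau_0})\cap C^s_{\tau_1}\neq\emptyset.$$ Moreover $\dot S_E$ contains a trajectory homoclinic to $P_{2,E}$, that is, one defined for all times, contained in $\dot S_E$ and converging to $P_{2,E}$ as $t\to\pm\infty$. -/

import Mathlib

open Set Filter Topology Asymptotics
open scoped ContDiff

noncomputable section

/-! ## Hamiltonian vector fields on `ℝ⁴` -/

/-- `ℝ⁴`, with coordinates `(x₁, x₂, y₁, y₂)` or `(q₁, q₂, p₁, p₂)`, in this order. -/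
abbrev R4 : Type := EuclideanSpace ℝ (Fin 4)

/-- The parameter plane of surfaces. -/
abbrev R2 : Type := EuclideanSpace ℝ (Fin 2)

/-- The standard symplectic form `dy₁ ∧ dx₁ + dy₂ ∧ dx₂`. -/
def omega0 (u v : R4) : ℝ := u 2 * v 0 - u 0 * v 2 + (u 3 * v 1 - u 1 * v 3)

/-- The standard complex structure `J₀ (x, y) = (y, -x)`. -/
def J0 (u : R4) : R4 := !₂[u 2, u 3, -u 0, -u 1]

/-- A second orthogonal complex structure, which anticommutes with `J₀`. -/
def J1 (u : R4) : R4 := !₂[u 1, -u 0, -u 3, u 2]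

/-- The Hamiltonian vector field `X_H = J₀ ∇H`. -/
def hamVF (H : R4 → ℝ) (x : R4) : R4 := J0 (gradient H x)

/-- `γ` is a trajectory of `X_H` defined for all times. -/
def IsTrajectory (H : R4 → ℝ) (γ : ℝ → R4) : Prop :=
  ∀ t, HasDerivAt γ (hamVF H (γ t)) t

/-- `γ` is a periodic trajectory of `X_H` with least period `T`. -/
structure IsPeriodicTrajectory (H : R4 → ℝ) (γ : ℝ → R4) (T : ℝ) : Prop where
  period_pos : 0 < T
  traj : IsTrajectory H γ
  periodic : ∀ t, γ (t + T) = γ t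
  injOn : InjOn γ (Ico 0 T)

/-! ## The Conley-Zehnder index -/

/-- The rotation numbers over `[0, T]` of the solutions `w` of the linearized flow along `γ` that
are tangent to the energy level and not parallel to `X_H`. The angle `θ` of `w` is measured modulo
`X_H`, in the frame `J₁ ∇H`, `J₀ J₁ ∇H` of a complement of `X_H` in the tangent space of the energy
level; this frame is global, and positively oriented for `ω₀`. -/
def rotationNumbers (H : R4 → ℝ) (γ : ℝ → R4) (T : ℝ) : Set ℝ :=
  {Δ | ∃ (w : ℝ → R4) (θ : ℝ → ℝ),
    (∀ t, HasDerivAt w (fderiv ℝ (hamVF H) (γ t) (w t)) t) ∧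
    inner ℝ (gradient H (γ 0)) (w 0) = 0 ∧
    w 0 ∉ Submodule.span ℝ {hamVF H (γ 0)} ∧
    Continuous θ ∧
    (∀ t, ∃ ρ : ℝ, 0 < ρ ∧
      inner ℝ (J1 (gradient H (γ t))) (w t) = ρ * Real.cos (θ t) ∧
      inner ℝ (J0 (J1 (gradient H (γ t)))) (w t) = ρ * Real.sin (θ t)) ∧
    Δ = (θ T - θ 0) / (2 * Real.pi)}

/-- The (generalized, lower semicontinuous) Conley-Zehnder index of a `T`-periodic trajectory is
`n`. With `I` the interval of rotation numbers, the index is `2k + 1` if `I - ε ⊆ (k, k + 1)`, and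
`2k` if `k ∈ I - ε`, for all small `ε > 0`. -/
def HasCZIndex (H : R4 → ℝ) (γ : ℝ → R4) (T : ℝ) (n : ℤ) : Prop :=
  ∃ k : ℤ,
    (n = 2 * k + 1 ∧ ∀ Δ ∈ rotationNumbers H γ T, (k : ℝ) < Δ ∧ Δ ≤ k + 1) ∨
    (n = 2 * k ∧ (∃ Δ ∈ rotationNumbers H γ T, Δ ≤ k) ∧ ∃ Δ ∈ rotationNumbers H γ T, (k : ℝ) < Δ)

/-! ## Moser's coordinates at a saddle-center -/

/-- The polydisk `{|q₁| < r, |p₁| < r, q₂² + p₂² < r²}`. -/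
def polydisk (r : ℝ) : Set R4 := {z | |z 0| < r ∧ |z 2| < r ∧ z 1 ^ 2 + z 3 ^ 2 < r ^ 2}

/-- The action `I₁ = q₁ p₁`. -/
def act1 (z : R4) : ℝ := z 0 * z 2

/-- The action `I₂ = (q₂² + p₂²) / 2`. -/
def act2 (z : R4) : ℝ := (z 1 ^ 2 + z 3 ^ 2) / 2

/-- Moser's coordinates for `H` near the saddle-center `φ 0`: a real-analytic symplectic chart `φ`,
defined on a polydisk, in which `H` is `-α I₁ + β I₂ + R(I₁, I₂)` with `R = O(I₁² + I₂²)`. In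
particular `H (φ 0) = 0`, and `φ 0` is an equilibrium with eigenvalues `±α, ±iβ`. The last two
fields say that the polydisk is small enough for the frequencies `α - ∂R/∂I₁` and `β + ∂R/∂I₂`,
which are `α` and `β` at the saddle-center, to be positive on it. -/
structure MoserChart (H : R4 → ℝ) where
  φ : R4 → R4
  r : ℝ
  α : ℝ
  β : ℝ
  R : ℝ × ℝ → ℝ
  r_pos : 0 < r
  α_pos : 0 < α
  β_pos : 0 < β
  analytic : AnalyticOnNhd ℝ φ (polydisk r)
  injOn : InjOn φ (polydisk r)
  symplectic : ∀ z ∈ polydisk r, ∀ u v : R4,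
    omega0 (fderiv ℝ φ z u) (fderiv ℝ φ z v) = omega0 u v
  R_analytic : AnalyticOnNhd ℝ R {I | |I.1| < r ^ 2 ∧ |I.2| < r ^ 2 / 2}
  R_isBigO : R =O[𝓝 (0, 0)] fun I => I.1 ^ 2 + I.2 ^ 2
  normal_form : ∀ z ∈ polydisk r,
    H (φ z) = -α * act1 z + β * act2 z + R (act1 z, act2 z)
  freq1_pos : ∀ a b : ℝ, |a| < r ^ 2 → |b| < r ^ 2 / 2 → 0 < α - deriv (fun s => R (s, b)) a
  freq2_pos : ∀ a b : ℝ, |a| < r ^ 2 → |b| < r ^ 2 / 2 → 0 < β + deriv (fun s => R (a, s)) b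

namespace MoserChart

variable {H : R4 → ℝ} (M : MoserChart H) (E : ℝ)

/-- The part of `H⁻¹(E)` inside the chart whose Moser coordinates satisfy `Q`. -/
def part (Q : R4 → Prop) : Set R4 := M.φ '' {z | z ∈ polydisk M.r ∧ H (M.φ z) = E ∧ Q z}

/-- The sphere `{q₁ + p₁ = 0}`. -/
def sphere : Set R4 := M.part E fun z => z 0 + z 2 = 0

/-- The Lyapunoff orbit `P₂ = {q₁ = p₁ = 0}`. -/
def P2 : Set R4 := M.part E fun z => z 0 = 0 ∧ z 2 = 0

/-- The open hemisphere `U₁ = {q₁ + p₁ = 0, q₁ < 0}`. -/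
def U1 : Set R4 := M.part E fun z => z 0 + z 2 = 0 ∧ z 0 < 0

/-- The open hemisphere `U₂ = {q₁ + p₁ = 0, q₁ > 0}`. -/
def U2 : Set R4 := M.part E fun z => z 0 + z 2 = 0 ∧ 0 < z 0

/-- The branch in `{q₁ + p₁ > 0}` of the local unstable manifold of `P₂`, up to size `ρ`. On
`{q₁ = 0}` the condition `H = E` reads `q₂² + p₂² = 2 I₂(0, E)`. -/
def Wu (ρ : ℝ) : Set R4 := M.part E fun z => z 0 = 0 ∧ 0 < z 2 ∧ z 2 < ρ

/-- The branch in `{q₁ + p₁ > 0}` of the local stable manifold of `P₂`, up to size `ρ`. -/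
def Ws (ρ : ℝ) : Set R4 := M.part E fun z => z 2 = 0 ∧ 0 < z 0 ∧ z 0 < ρ

/-- `S` is a closed 3-ball, smoothly embedded in the regular part of `H⁻¹(E)`, whose boundary is the
sphere `{q₁ + p₁ = 0}`, and which inside the chart is `{q₁ + p₁ ≥ 0}`. -/
structure IsEnergyBall (S : Set R4) : Prop where
  energy : ∀ x ∈ S, H x = E
  regular : ∀ x ∈ S, gradient H x ≠ 0
  ball : ∃ b : EuclideanSpace ℝ (Fin 3) → R4, ContDiff ℝ ∞ b ∧
    InjOn b (Metric.closedBall 0 1) ∧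
    (∀ x ∈ Metric.closedBall (0 : EuclideanSpace ℝ (Fin 3)) 1, Function.Injective (fderiv ℝ b x)) ∧
    b '' Metric.closedBall 0 1 = S ∧ b '' Metric.sphere 0 1 = M.sphere E
  chart : S ∩ M.φ '' polydisk M.r = M.part E fun z => 0 ≤ z 0 + z 2

end MoserChart

/-! ## 2-3 foliations -/

/-- `F` is an embedded surface transverse to `X_H`, of the type of the interior of `K`, whose closure
is an embedded copy of `K`, with boundary `B` (smooth inside, `C¹` up to the boundary). -/
def IsTransverseLeaf (H : R4 → ℝ) (K : Set R2) (F B : Set R4) : Prop :=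
  ∃ c : R2 → R4, ContDiffOn ℝ 1 c K ∧ ContDiffOn ℝ ∞ c (interior K) ∧ InjOn c K ∧
    (∀ z ∈ interior K, Function.Injective (fderiv ℝ c z) ∧
      hamVF H (c z) ∉ range (fderiv ℝ c z)) ∧
    c '' interior K = F ∧ c '' frontier K = B

/-- The closed disk. -/
def closedDisk : Set R2 := Metric.closedBall 0 1

/-- The closed annulus (the compact cylinder). -/
def closedAnnulus : Set R2 := {z | 1 ≤ ‖z‖ ∧ ‖z‖ ≤ 2}

/-- The closed curve `P` in `W` is unknotted: it bounds a smooth embedded closed disk in `W`. -/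
def IsUnknotted (W P : Set R4) : Prop :=
  ∃ c : R2 → R4, ContDiff ℝ ∞ c ∧ InjOn c closedDisk ∧
    (∀ z ∈ closedDisk, Function.Injective (fderiv ℝ c z)) ∧
    c '' closedDisk ⊆ W ∧ c '' frontier closedDisk = P

/-- The sets in `𝓛` are the leaves of a two-dimensional foliation of the 3-manifold `N` (with
boundary): they are connected and partition `N`, and every point of `N` has a neighborhood in `N`
that is a product of an open disk with an interval `J`, every slice of which lies in a leaf. Here `J`
is open, or half-open at a point of a leaf in the boundary. -/
structure IsFoliation (N : Set R4) (𝓛 : Set (Set R4)) : Prop where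
  connected : ∀ L ∈ 𝓛, IsConnected L
  disjoint : 𝓛.PairwiseDisjoint id
  union : ⋃₀ 𝓛 = N
  chart : ∀ x ∈ N, ∃ (W : Set R4) (J : Set ℝ) (f : ↥(Metric.ball (0 : R2) 1 ×ˢ J) → R4),
    IsOpen W ∧ x ∈ W ∧ (J = Ioo (-1) 1 ∨ J = Ico 0 1) ∧ IsEmbedding f ∧ range f = N ∩ W ∧
    ∀ t ∈ J, ∃ L ∈ 𝓛, ∀ z : ↥(Metric.ball (0 : R2) 1 ×ˢ J), z.1.2 = t → f z ∈ L

/-- A 2-3 foliation of the energy ball `S`, adapted to the Hamiltonian flow: its bindings are the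
Lyapunoff orbit `P₂` and `P3`, its rigid planes `U₁` and `U₂`, its rigid cylinder is `V`, and its
family of planes is `D τ`, `τ ∈ (0, 1)`. -/
structure IsTwoThreeFoliation {H : R4 → ℝ} (M : MoserChart H) (E : ℝ) (S P3 V : Set R4)
    (D : ℝ → Set R4) : Prop where
  foliation : IsFoliation (S \ (M.P2 E ∪ P3))
    ({M.U1 E, M.U2 E, V} ∪ D '' Ioo 0 1)
  binding_subset : P3 ⊆ S \ M.sphere E
  binding : ∃ (γ : ℝ → R4) (T : ℝ), IsPeriodicTrajectory H γ T ∧ range γ = P3 ∧ HasCZIndex H γ T 3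
  unknotted : IsUnknotted (S \ M.sphere E) P3
  rigid_plane1 : IsTransverseLeaf H closedDisk (M.U1 E) (M.P2 E)
  rigid_plane2 : IsTransverseLeaf H closedDisk (M.U2 E) (M.P2 E)
  cylinder_subset : V ⊆ S \ M.sphere E
  cylinder : IsTransverseLeaf H closedAnnulus V (P3 ∪ M.P2 E)
  plane : ∀ τ ∈ Ioo (0 : ℝ) 1, IsTransverseLeaf H closedDisk (D τ) P3
  plane_disjoint : (Ioo (0 : ℝ) 1).PairwiseDisjoint D
  plane_union : ⋃ τ ∈ Ioo (0 : ℝ) 1, D τ = (S \ M.sphere E) \ (P3 ∪ V)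
  limit0 : Tendsto (fun τ => Metric.hausdorffEDist (D τ) (V ∪ M.P2 E ∪ M.U1 E)) (𝓝[>] 0) (𝓝 0)
  limit1 : Tendsto (fun τ => Metric.hausdorffEDist (D τ) (V ∪ M.P2 E ∪ M.U2 E)) (𝓝[<] 1) (𝓝 0)

/-! ## Transition maps -/

/-- Some forward trajectory segment of `X_H` leads from `x` to `y`, and strictly between its endpoints
it stays in `W` and does not meet `A`. If `y ∈ A`, then `y` is the first point of `A` on the positive
trajectory of `x`. -/
def FlowsTo (H : R4 → ℝ) (W A : Set R4) (x y : R4) : Prop :=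
  ∃ (T : ℝ) (γ : ℝ → R4), 0 < T ∧ (∀ t ∈ Icc 0 T, HasDerivAt γ (hamVF H (γ t)) t) ∧
    γ 0 = x ∧ γ T = y ∧ ∀ t ∈ Ioo 0 T, γ t ∈ W ∧ γ t ∉ A

/-- `Ψ` is the transition map `A → B` of the flow in `W`: it sends `x ∈ A` to the first point of `B`
on the positive trajectory of `x`, and is a homeomorphism of `A` onto `B`. -/
def IsTransitionMap (H : R4 → ℝ) (W : Set R4) (Ψ : R4 → R4) (A B : Set R4) : Prop :=
  (∃ e : A ≃ₜ B, ∀ x : A, (e x : R4) = Ψ x) ∧ ∀ x ∈ A, FlowsTo H W B x (Ψ x)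

/-- `C` is an embedded circle. -/
def IsEmbeddedCircle (C : Set R4) : Prop :=
  ∃ c : Circle → R4, Continuous c ∧ Function.Injective c ∧ range c = C

/-- The closed disk bounded by a circle `C` in a plane `F`: the circle, with the points of `F` off the
circle whose component in `F \ C` is relatively compact in `F`. -/
def boundedDisk (F C : Set R4) : Set R4 :=
  C ∪ {x | x ∈ F \ C ∧ closure (connectedComponentIn (F \ C) x) ⊆ F}

/-- The circle `C = C^u` in the plane `F = D_{τ₀}` is embedded, and the points in the interior of the
disk that it bounds correspond to the trajectories entering the ball through `U`. -/
structure IsEntranceCircle (H : R4 → ℝ) (W U F C : Set R4) : Prop where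
  circle : IsEmbeddedCircle C
  from_entrance : ∀ x ∈ boundedDisk F C \ C, ∃ y ∈ U, FlowsTo H W F y x
  to_disk : ∀ y ∈ U, ∃ x ∈ boundedDisk F C \ C, FlowsTo H W F y x

/-- The circle `C = C^s` in the plane `F = D_{τ₁}` is embedded, and the points in the interior of the
disk that it bounds correspond to the trajectories leaving the ball through `U`. -/
structure IsExitCircle (H : R4 → ℝ) (W U F C : Set R4) : Prop where
  circle : IsEmbeddedCircle C
  to_exit : ∀ x ∈ boundedDisk F C \ C, ∃ y ∈ U, FlowsTo H W F x y
  from_disk : ∀ y ∈ U, ∃ x ∈ boundedDisk F C \ C, FlowsTo H W F x y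

/-- `γ` is a trajectory in `W` that is homoclinic to the periodic orbit `P`. -/
def IsHomoclinicIn (H : R4 → ℝ) (W P : Set R4) (γ : ℝ → R4) : Prop :=
  IsTrajectory H γ ∧ (∀ t, γ t ∈ W) ∧
    Tendsto (fun t => Metric.infDist (γ t) P) atTop (𝓝 0) ∧
    Tendsto (fun t => Metric.infDist (γ t) P) atBot (𝓝 0)

end

/-! The proof is an area argument. Transition maps of a Hamiltonian flow between surfaces transverse
to it in one energy level preserve the `ω₀`-area (`IsSection.areaMeasure_image_transition`), and
every plane `D τ` has finite area, because it is `C¹` up to its boundary.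

The involution `(q₁, p₁) ↦ (-q₁, -p₁)` of Moser's chart is symplectic, preserves `I₁` and `I₂`,
hence `H`, and exchanges the two hemispheres, which therefore have the same area `a > 0`
(`MoserChart.areaMeasure_U1_eq_U2`). The flow carries `U₁` onto the interior of `Bu` and the
interior of `Bs` onto `U₂`, so these interiors have area `a` too.

Suppose that no image of `Cu` ever meets `Cs`. Then `Ψg(Bu)` and `Bs` are compact disks in one plane
with disjoint connected boundaries, hence disjoint or strictly nested (`disjoint_or_nested`), and
nesting is impossible for equal areas (`IsSection.disjoint_of_areaMeasure_eq`). So `Ψl` is defined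
on `Ψg(Bu)`, and the argument repeats for all iterates. The resulting disks are pairwise disjoint,
since `Ψl` avoids `Bu` and all maps are injective. Infinitely many disjoint sets of area `a > 0` do
not fit into a plane of finite area (`exists_iterate_inter_nonempty`).

A point of the intersection is joined backward to the local unstable manifold and forward to the
local stable one; in Moser's coordinates both asymptotic pieces are explicit, and their
concatenation is the homoclinic trajectory.

Two points need care. The flow of `H` may be incomplete, so `H` is cut off outside a neighborhood of
the compact ball. Transition times are not assumed continuous, so area preservation is proved on
countably many measurable pieces on which they are. -/

/-! ### Global flows of bounded Lipschitz vector fields and their derivatives. -/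

section GlobalFlow

open scoped NNReal

variable {E : Type*} [NormedAddCommGroup E] [NormedSpace ℝ E]

/-- `φ` is the flow, defined for all times, of the vector field `f`. -/
structure IsGlobalFlow (f : E → E) (φ : ℝ → E → E) : Prop where
  zero : ∀ x, φ 0 x = x
  deriv : ∀ t x, HasDerivAt (fun s => φ s x) (f (φ t x)) t

/-- A bounded Lipschitz vector field has a flow that is defined for all times. -/
theorem exists_isGlobalFlow [CompleteSpace E] {f : E → E} {K L : ℝ≥0} (hf : LipschitzWith K f)
    (hL : ∀ x, ‖f x‖ ≤ L) : ∃ φ, IsGlobalFlow f φ := by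
  have key : ∀ (n : ℕ) (x : E), ∃ γ : ℝ → E, γ 0 = x ∧
      ∀ t ∈ Ioo (-(n + 1) : ℝ) (n + 1), HasDerivAt γ (f (γ t)) t := by
    intro n x
    -- At speed at most `L`, a curve moves at most `L * (n + 1)` in time `n + 1`; a ball of this
    -- radius makes the Picard-Lindelöf interval as long as desired.
    have hP : IsPicardLindelof (fun _ => f) (tmin := -(n + 1)) (tmax := n + 1)
        ⟨0, by constructor <;> linarith [(Nat.cast_nonneg n : (0 : ℝ) ≤ n)]⟩ x (L * (n + 1)) 0 L K :=
      IsPicardLindelof.of_time_independent (fun y _ => hL y) hf.lipschitzOnWith (by simp)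
    obtain ⟨γ, h0, hγ⟩ := hP.exists_eq_forall_mem_Icc_hasDerivWithinAt₀
    exact ⟨γ, h0, fun t ht => (hγ t (Ioo_subset_Icc_self ht)).hasDerivAt (Icc_mem_nhds ht.1 ht.2)⟩
  choose γ h0 hγ using key
  have hagree : ∀ (m n : ℕ) (x : E), m ≤ n → EqOn (γ m x) (γ n x) (Ioo (-(m + 1)) (m + 1)) := by
    intro m n x hmn
    have hmn' : (m : ℝ) ≤ n := by exact_mod_cast hmn
    refine ODE_solution_unique_of_mem_Ioo (v := fun _ => f) (s := fun _ => univ) (K := K)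
      (t₀ := 0) (fun t _ => hf.lipschitzOnWith) ?_ (fun t ht => ⟨hγ m x t ht, mem_univ _⟩)
      (fun t ht => ⟨hγ n x t ⟨by linarith [ht.1], by linarith [ht.2]⟩, mem_univ _⟩) ?_
    · constructor <;> linarith [(Nat.cast_nonneg m : (0 : ℝ) ≤ m)]
    · rw [h0, h0]
  -- The curves of different index agree by uniqueness. The one of index `⌈|t|⌉₊` is defined at `t`,
  -- and near `t` all of these agree with one fixed curve, of index `n > |t|`.
  refine ⟨fun t x => γ ⌈|t|⌉₊ x t, fun x => by simp [h0], fun t x => ?_⟩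
  obtain ⟨n, hn⟩ := exists_nat_gt |t|
  have hev : ∀ᶠ s in 𝓝 t, γ ⌈|s|⌉₊ x s = γ n x s := by
    filter_upwards [continuous_abs.continuousAt.eventually_lt_const hn] with s hs
    refine hagree _ n x (Nat.ceil_le.2 hs.le) ?_
    have h1 := Nat.le_ceil |s|
    have h2 := abs_le.1 h1
    constructor <;> linarith
  have h := hγ n x t (by have := abs_lt.1 hn; constructor <;> linarith)
  have h' := h.congr_of_eventuallyEq hev
  rwa [← hev.self_of_nhds] at h'

namespace IsGlobalFlow

variable {f : E → E} {φ : ℝ → E → E} {K : ℝ≥0}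

theorem continuous_time (h : IsGlobalFlow f φ) (x : E) : Continuous fun t => φ t x :=
  continuous_iff_continuousAt.2 fun t => (h.deriv t x).continuousAt

theorem neg (h : IsGlobalFlow f φ) : IsGlobalFlow (fun x => -f x) (fun t => φ (-t)) where
  zero x := by simp [h.zero]
  deriv t x := by
    have := (h.deriv (-t) x).scomp t (hasDerivAt_neg t)
    simpa [Function.comp_def] using this

/-- A trajectory on `[0, T]` is given by the flow. -/
theorem eq_of_hasDerivAt (h : IsGlobalFlow f φ) (hf : LipschitzWith K f) {T : ℝ} {γ : ℝ → E}
    (hγ : ∀ t ∈ Icc 0 T, HasDerivAt γ (f (γ t)) t) {t : ℝ} (ht : t ∈ Icc 0 T) :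
    γ t = φ t (γ 0) :=
  ODE_solution_unique (v := fun _ => f) (fun _ => hf)
    (fun s hs => (hγ s hs).continuousAt.continuousWithinAt)
    (fun s hs => (hγ s (Ico_subset_Icc_self hs)).hasDerivWithinAt)
    (h.continuous_time _).continuousOn (fun s _ => (h.deriv s _).hasDerivWithinAt)
    (h.zero _).symm ht

theorem add (h : IsGlobalFlow f φ) (hf : LipschitzWith K f) (s t : ℝ) (x : E) :
    φ (s + t) x = φ s (φ t x) := by
  have := ODE_solution_unique_univ (v := fun _ => f) (s := fun _ => univ) (K := K) (t₀ := 0)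
    (f := fun s => φ (s + t) x) (g := fun s => φ s (φ t x)) (fun _ => hf.lipschitzOnWith)
    (fun s => ⟨(h.deriv (s + t) x).comp_add_const s t, mem_univ _⟩)
    (fun s => ⟨h.deriv s _, mem_univ _⟩) (by simp [h.zero])
  exact congrFun this s

theorem neg_apply_self (h : IsGlobalFlow f φ) (hf : LipschitzWith K f) (t : ℝ) (x : E) :
    φ (-t) (φ t x) = x := by
  rw [← h.add hf, neg_add_cancel, h.zero]

theorem apply_neg_self (h : IsGlobalFlow f φ) (hf : LipschitzWith K f) (t : ℝ) (x : E) :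
    φ t (φ (-t) x) = x := by
  rw [← h.add hf, add_neg_cancel, h.zero]

theorem dist_le_of_nonneg (h : IsGlobalFlow f φ) (hf : LipschitzWith K f) {t : ℝ} (ht : 0 ≤ t)
    (x y : E) : dist (φ t x) (φ t y) ≤ dist x y * Real.exp (K * t) := by
  have := dist_le_of_trajectories_ODE (v := fun _ => f) (fun _ => hf) (a := 0) (b := t)
    (δ := dist x y) (h.continuous_time x).continuousOn (fun s _ => (h.deriv s _).hasDerivWithinAt)
    (h.continuous_time y).continuousOn (fun s _ => (h.deriv s _).hasDerivWithinAt)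
    (by simp [h.zero]) t ⟨ht, le_rfl⟩
  simpa using this

theorem dist_le (h : IsGlobalFlow f φ) (hf : LipschitzWith K f) (t : ℝ) (x y : E) :
    dist (φ t x) (φ t y) ≤ dist x y * Real.exp (K * |t|) := by
  rcases le_total 0 t with ht | ht
  · simpa [abs_of_nonneg ht] using h.dist_le_of_nonneg hf ht x y
  · have := h.neg.dist_le_of_nonneg (K := K) hf.neg (neg_nonneg.2 ht) x y
    simpa [abs_of_nonpos ht] using this

theorem lipschitzWith (h : IsGlobalFlow f φ) (hf : LipschitzWith K f) (t : ℝ) :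
    LipschitzWith (Real.exp (K * |t|)).toNNReal (φ t) :=
  LipschitzWith.of_dist_le_mul fun x y => by
    rw [Real.coe_toNNReal _ (Real.exp_pos _).le, mul_comm]
    exact h.dist_le hf t x y

/-- The flow `(t, x) ↦ φ t x` is strictly differentiable at time zero. -/
theorem hasStrictFDerivAt_zero (h : IsGlobalFlow f φ) (hf : LipschitzWith K f) {L : ℝ≥0}
    (hL : ∀ x, ‖f x‖ ≤ L) (x : E) :
    HasStrictFDerivAt (fun p : ℝ × E => φ p.1 p.2)
      ((ContinuousLinearMap.fst ℝ ℝ E).smulRight (f x) + ContinuousLinearMap.snd ℝ ℝ E) (0, x) := by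
  have htime : ∀ (y : E) (t : ℝ), ‖φ t y - y‖ ≤ L * |t| := by
    intro y t
    have := Convex.norm_image_sub_le_of_norm_hasDerivWithin_le (s := univ) (f := fun s => φ s y)
      (C := L) (x := 0) (y := t) (fun s _ => (h.deriv s y).hasDerivWithinAt) (fun s _ => hL _)
      convex_univ (mem_univ _) (mem_univ _)
    simpa [h.zero] using this
  refine HasStrictFDerivAt.of_isLittleO ?_
  rw [isLittleO_iff]
  intro c hc
  -- the two partial increments
  have hspace : ∀ (y y' : E) (t : ℝ), |t| ≤ 1 →
      ‖(φ t y - φ t y') - (y - y')‖ ≤ K * Real.exp K * |t| * ‖y - y'‖ := by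
    intro y y' t ht
    have := Convex.norm_image_sub_le_of_norm_hasDerivWithin_le (s := Icc (-|t|) |t|)
      (f := fun s => φ s y - φ s y') (C := K * (Real.exp K * ‖y - y'‖)) (x := 0) (y := t)
      (fun s _ => ((h.deriv s y).sub (h.deriv s y')).hasDerivWithinAt) ?_
      (convex_Icc _ _) ⟨by simp, by simp⟩ ⟨neg_abs_le t, le_abs_self t⟩
    · simp only [h.zero, sub_zero, Real.norm_eq_abs] at this
      linarith
    · intro s hs
      have h1 : |s| ≤ 1 := (abs_le.2 hs).trans ht
      rw [← dist_eq_norm]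
      refine (hf.dist_le_mul _ _).trans ?_
      gcongr
      refine (h.dist_le hf s y y').trans ?_
      rw [dist_eq_norm, mul_comm]
      gcongr
      nlinarith [K.2]
  have hK : 0 ≤ K * Real.exp K := by positivity
  -- The two bounds give slope at most `c / 2` to the increment in space and to that in time. For
  -- the latter, `φ t y'` is within `L * δ + δ` of `x`.
  obtain ⟨δ, hδ, hδ1, hδ2, hδ3⟩ : ∃ δ : ℝ, 0 < δ ∧ δ ≤ 1 ∧ K * Real.exp K * δ ≤ c / 2 ∧
      K * (L * δ + δ) ≤ c / 2 := by
    refine ⟨min 1 (min (c / 2 / (K * Real.exp K + 1)) (c / 2 / (K * (L + 1) + 1))), ?_, min_le_left _ _,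
      ?_, ?_⟩
    · positivity
    · have : min 1 (min (c / 2 / (K * Real.exp K + 1)) (c / 2 / (K * (L + 1) + 1)))
        ≤ c / 2 / (K * Real.exp K + 1) := (min_le_right _ _).trans (min_le_left _ _)
      refine (mul_le_mul_of_nonneg_left this hK).trans ?_
      rw [mul_div_assoc', div_le_iff₀ (by positivity)]
      nlinarith
    · have : min 1 (min (c / 2 / (K * Real.exp K + 1)) (c / 2 / (K * (L + 1) + 1)))
        ≤ c / 2 / (K * (L + 1) + 1) := (min_le_right _ _).trans (min_le_right _ _)
      have h2 : (0 : ℝ) ≤ K * (L + 1) := by positivity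
      rw [show ∀ m : ℝ, (K : ℝ) * (L * m + m) = K * (L + 1) * m by intro m; ring]
      refine (mul_le_mul_of_nonneg_left this h2).trans ?_
      rw [mul_div_assoc', div_le_iff₀ (by positivity)]
      nlinarith
  have hball : Metric.ball ((0 : ℝ), x) δ ×ˢ Metric.ball ((0 : ℝ), x) δ ∈ 𝓝 (((0 : ℝ), x), ((0 : ℝ), x)) :=
    prod_mem_nhds (Metric.ball_mem_nhds _ hδ) (Metric.ball_mem_nhds _ hδ)
  filter_upwards [hball]
  rintro ⟨⟨s, y⟩, ⟨s', y'⟩⟩ ⟨h1, h2⟩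
  simp only [Metric.mem_ball, Prod.dist_eq, max_lt_iff, dist_zero_right, Real.norm_eq_abs] at h1 h2
  have e : φ s y - φ s' y' - ((ContinuousLinearMap.fst ℝ ℝ E).smulRight (f x) +
      ContinuousLinearMap.snd ℝ ℝ E) ((s, y) - (s', y')) =
      ((φ s y - φ s y') - (y - y')) + (φ s y' - φ s' y' - (s - s') • f x) := by
    simp only [add_apply, ContinuousLinearMap.smulRight_apply,
      ContinuousLinearMap.coe_fst', ContinuousLinearMap.coe_snd', Prod.fst_sub, Prod.snd_sub]
    abel
  have b1 := hspace y y' s (h1.1.le.trans hδ1)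
  have b2 : ‖φ s y' - φ s' y' - (s - s') • f x‖ ≤ c / 2 * |s - s'| := by
    have := Convex.norm_image_sub_le_of_norm_hasDerivWithin_le (s := Ioo (-δ) δ)
      (f := fun t => φ t y' - t • f x) (f' := fun t => f (φ t y') - (1 : ℝ) • f x)
      (C := c / 2) (x := s') (y := s)
      (fun t _ => ((h.deriv t y').sub ((hasDerivAt_id t).smul_const (f x))).hasDerivWithinAt) ?_
      (convex_Ioo _ _) (abs_lt.1 h2.1) (abs_lt.1 h1.1)
    · rw [Real.norm_eq_abs] at this
      refine le_trans (le_of_eq ?_) this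
      congr 1
      rw [sub_smul]; abel
    · intro t ht
      rw [one_smul, ← dist_eq_norm]
      refine (hf.dist_le_mul _ _).trans (le_trans ?_ hδ3)
      gcongr
      refine (dist_triangle _ y' _).trans ?_
      refine add_le_add ?_ h2.2.le
      rw [dist_eq_norm]
      refine (htime y' t).trans ?_
      gcongr
      exact (abs_lt.2 ht).le
  calc _ = _ := by rw [e]
    _ ≤ K * Real.exp K * |s| * ‖y - y'‖ + c / 2 * |s - s'| := (norm_add_le _ _).trans (add_le_add b1 b2)
    _ ≤ c / 2 * ‖((s, y) - (s', y') : ℝ × E)‖ + c / 2 * ‖((s, y) - (s', y') : ℝ × E)‖ := by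
      gcongr
      · refine le_trans ?_ hδ2
        gcongr
        exact h1.1.le
      · exact norm_snd_le ((s, y) - (s', y') : ℝ × E)
      · exact norm_fst_le ((s, y) - (s', y') : ℝ × E)
    _ = _ := by ring

/-- The group law `φ s y = φ (s - t) (φ t y)` moves the question to time zero, where strict
differentiability gives continuity. -/
theorem continuous (h : IsGlobalFlow f φ) (hf : LipschitzWith K f) {L : ℝ≥0}
    (hL : ∀ x, ‖f x‖ ≤ L) : Continuous fun p : ℝ × E => φ p.1 p.2 := by
  refine continuous_iff_continuousAt.2 fun ⟨t, x⟩ => ?_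
  have h1 : ContinuousAt (fun p : ℝ × E => φ p.1 p.2) (t + -t, φ t x) := by
    rw [add_neg_cancel]
    exact (h.hasStrictFDerivAt_zero hf hL (φ t x)).hasFDerivAt.continuousAt
  have h2 : Continuous fun p : ℝ × E => (p.1 + -t, φ t p.2) :=
    (continuous_fst.add continuous_const).prodMk ((h.lipschitzWith hf t).continuous.comp continuous_snd)
  have h3 := ContinuousAt.comp (f := fun p : ℝ × E => (p.1 + -t, φ t p.2)) (x := (t, x)) h1 h2.continuousAt
  refine h3.congr (Eventually.of_forall fun p => ?_)
  simp only [Function.comp]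
  rw [← h.add hf]
  simp

/-- Multiplying `1 - Kt ≤ exp (-Kt)` by `exp (Kt)` cancels the denominator `K` of the Gronwall
bound, so the estimate is also valid for `K = 0`. -/
theorem gronwallBound_zero_mul_le {K ε t : ℝ} (hK : 0 ≤ K) (hε : 0 ≤ ε) (ht : t ∈ Icc (0 : ℝ) 1) :
    gronwallBound 0 K ε t ≤ ε * Real.exp K := by
  rcases hK.eq_or_lt with rfl | hK
  · rw [gronwallBound_K0]
    simp
    nlinarith [ht.2]
  · rw [gronwallBound_of_K_ne_0 hK.ne']
    have h1 : Real.exp (K * t) - 1 ≤ K * Real.exp K := by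
      have := Real.add_one_le_exp (-(K * t))
      have h2 : Real.exp (-(K * t)) * Real.exp (K * t) = 1 := by rw [← Real.exp_add]; simp
      have h3 : Real.exp (K * t) ≤ Real.exp K := Real.exp_le_exp.2 (by nlinarith [ht.2])
      have h4 := Real.exp_pos (K * t)
      have h5 : Real.exp (K * t) - 1 ≤ K * t * Real.exp (K * t) := by nlinarith
      have h6 : K * t * Real.exp (K * t) ≤ K * 1 * Real.exp K := by
        gcongr
        exact ht.2
      linarith
    simp only [zero_mul, zero_add]
    rw [div_mul_eq_mul_div, div_le_iff₀ hK]
    nlinarith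

/-- For small positive times the flow is differentiable in the initial point, and its derivative
preserves every bilinear form that is infinitesimally preserved by the vector field. -/
theorem exists_hasFDerivAt_of_small [CompleteSpace E] (h : IsGlobalFlow f φ) {f' : E → E →L[ℝ] E}
    (hf' : ∀ x, HasFDerivAt f (f' x) x) (hf : LipschitzWith K f) {M : ℝ≥0}
    (hM : LipschitzWith M f') (B : E →L[ℝ] E →L[ℝ] ℝ) (hB : ∀ x u v, B (f' x u) v + B u (f' x v) = 0)
    {ε : ℝ≥0} (hε1 : ε ≤ 1) (hε : 2 * K * ε ≤ 1) (x : E) :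
    ∃ A : E →L[ℝ] E, HasFDerivAt (φ ε) A x ∧ ∀ u v, B (A u) (A v) = B u v := by
  have hK : ∀ y, ‖f' y‖ ≤ K := fun y => (hf' y).le_of_lipschitz hf
  -- This is the variational equation along the trajectory of `x`. On the unit ball about the
  -- identity `‖A‖ ≤ 2`, so the right side is at most `2 * K`, and `2 * K * ε ≤ 1` keeps the
  -- solution in that ball up to time `ε`.
  have hP : IsPicardLindelof (fun t (A : E →L[ℝ] E) => (f' (φ t x)).comp A) (tmin := 0) (tmax := ε)
      ⟨0, by simp⟩ (ContinuousLinearMap.id ℝ E) 1 0 (2 * K) K := by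
    refine ⟨fun t _ => LipschitzWith.lipschitzOnWith (LipschitzWith.of_dist_le_mul fun A A' => ?_),
      fun A _ => ?_, fun t _ A hA => ?_, ?_⟩
    · rw [dist_eq_norm, dist_eq_norm, ← ContinuousLinearMap.comp_sub]
      exact (ContinuousLinearMap.opNorm_comp_le _ _).trans
        (mul_le_mul_of_nonneg_right (hK _) (norm_nonneg _))
    · exact ((hM.continuous.comp (h.continuous_time x)).clm_comp continuous_const).continuousOn
    · have h1 : ‖A‖ ≤ 2 := by
        have h2 : ‖A - ContinuousLinearMap.id ℝ E‖ ≤ 1 := by simpa [dist_eq_norm] using hA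
        have h3 : ‖ContinuousLinearMap.id ℝ E‖ ≤ 1 := ContinuousLinearMap.norm_id_le
        have h4 := norm_add_le (A - ContinuousLinearMap.id ℝ E) (ContinuousLinearMap.id ℝ E)
        rw [sub_add_cancel] at h4
        linarith
      refine (ContinuousLinearMap.opNorm_comp_le _ _).trans ?_
      push_cast
      rw [mul_comm (2 : ℝ)]
      exact mul_le_mul (hK _) h1 (norm_nonneg _) K.2
    · simp only [NNReal.coe_zero, sub_zero, NNReal.coe_one]
      rw [max_eq_left ε.coe_nonneg]
      exact_mod_cast hε
  obtain ⟨W, hW0, hW⟩ := hP.exists_eq_forall_mem_Icc_hasDerivWithinAt₀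
  simp only at hW0
  have hWc : ContinuousOn W (Icc 0 ε) := fun t ht => (hW t ht).continuousWithinAt
  have hWr : ∀ t ∈ Ico (0 : ℝ) ε, HasDerivWithinAt W ((f' (φ t x)).comp (W t)) (Ici t) t :=
    fun t ht => (hW t (Ico_subset_Icc_self ht)).mono_of_mem_nhdsWithin
      (Icc_mem_nhdsGE_of_mem ht)
  have hWu : ∀ u, ∀ t ∈ Ico (0 : ℝ) ε, HasDerivWithinAt (fun t => W t u) (f' (φ t x) (W t u)) (Ici t) t :=
    fun u t ht => by simpa using (hWr t ht).clm_apply (hasDerivWithinAt_const t (Ici t) u)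
  have hWuc : ∀ u, ContinuousOn (fun t => W t u) (Icc 0 ε) := fun u =>
    hWc.clm_apply continuousOn_const
  refine ⟨W ε, ?_, fun u v => ?_⟩
  · -- quadratic remainder of the vector field
    have hquad : ∀ y z, ‖f z - f y - f' y (z - y)‖ ≤ M * ‖z - y‖ ^ 2 := by
      intro y z
      have := (convex_segment y z).norm_image_sub_le_of_norm_hasFDerivWithin_le'
        (f := f) (f' := f') (φ := f' y) (C := M * ‖z - y‖)
        (fun w _ => (hf' w).hasFDerivWithinAt) ?_ (left_mem_segment ℝ y z) (right_mem_segment ℝ y z)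
      · rwa [mul_assoc, ← sq] at this
      · intro w hw
        rw [← dist_eq_norm]
        refine (hM.dist_le_mul _ _).trans ?_
        gcongr
        rw [dist_eq_norm]
        exact norm_sub_le_of_mem_segment hw
    -- The error of the linear approximation solves the variational equation up to the quadratic
    -- remainder of `f`, so Gronwall bounds it by a multiple of `‖y - x‖ ^ 2`.
    have hmain : ∀ y, ‖φ ε y - φ ε x - W ε (y - x)‖ ≤
        M * Real.exp (2 * K) * Real.exp K * ‖y - x‖ ^ 2 := by
      intro y
      have hder : ∀ t ∈ Ico (0 : ℝ) ε, HasDerivWithinAt (fun t => φ t y - φ t x - W t (y - x))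
          (f (φ t y) - f (φ t x) - f' (φ t x) (W t (y - x))) (Ici t) t := fun t ht =>
        ((h.deriv t y).hasDerivWithinAt.sub (h.deriv t x).hasDerivWithinAt).sub (hWu _ t ht)
      have := norm_le_gronwallBound_of_norm_deriv_right_le (δ := 0) (K := K)
        (ε := M * Real.exp (2 * K) * ‖y - x‖ ^ 2)
        (((h.continuous_time y).sub (h.continuous_time x)).continuousOn.sub (hWuc (y - x))) hder
        (by simp [h.zero, hW0]) ?_ ε ⟨ε.2, le_rfl⟩
      · refine this.trans ?_
        rw [sub_zero]
        refine (gronwallBound_zero_mul_le K.coe_nonneg (by positivity) ⟨ε.coe_nonneg, hε1⟩).trans (le_of_eq (by ring))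
      · intro t ht
        have e : f (φ t y) - f (φ t x) - f' (φ t x) (W t (y - x)) =
            f' (φ t x) (φ t y - φ t x - W t (y - x)) +
            (f (φ t y) - f (φ t x) - f' (φ t x) (φ t y - φ t x)) := by
          rw [map_sub (f' (φ t x)) (φ t y - φ t x)]; abel
        rw [e]
        refine (norm_add_le _ _).trans (add_le_add ?_ ?_)
        · exact (ContinuousLinearMap.le_opNorm _ _).trans
            (mul_le_mul_of_nonneg_right (hK _) (norm_nonneg _))
        · refine (hquad _ _).trans ?_
          rw [mul_assoc]
          gcongr
          have h1 := h.dist_le_of_nonneg hf ht.1 y x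
          rw [dist_eq_norm, dist_eq_norm] at h1
          have h2 : Real.exp (K * t) ≤ Real.exp K :=
            Real.exp_le_exp.2 (mul_le_of_le_one_right K.2 (ht.2.le.trans hε1))
          calc _ ≤ (‖y - x‖ * Real.exp K) ^ 2 := by
                gcongr
                exact h1.trans (by gcongr)
            _ = _ := by rw [mul_pow, ← Real.exp_nat_mul]; push_cast; ring
    refine HasFDerivAt.of_isLittleO ?_
    refine IsBigO.trans_isLittleO (g := fun y => ‖y - x‖ ^ 2) ?_ ?_
    · exact IsBigO.of_bound (M * Real.exp (2 * K) * Real.exp K)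
        (Eventually.of_forall fun y => by simpa using hmain y)
    · have h1 : Tendsto (fun y : E => y - x) (𝓝 x) (𝓝 0) := by
        have : Continuous fun y : E => y - x := by fun_prop
        simpa using this.tendsto x
      exact (isLittleO_norm_pow_id one_lt_two).comp_tendsto h1
  · have hc : ContinuousOn (fun t => B (W t u) (W t v)) (Icc 0 ε) :=
      (B.continuous.comp_continuousOn (hWuc u)).clm_apply (hWuc v)
    -- By the product rule the derivative is the left side of `hB` at `W t u`, `W t v`, so the form
    -- is constant along the variational equation.
    have hd : ∀ t ∈ Ico (0 : ℝ) ε, HasDerivWithinAt (fun t => B (W t u) (W t v)) 0 (Ici t) t := by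
      intro t ht
      have := (B.hasFDerivAt.comp_hasDerivWithinAt t (hWu u t ht)).clm_apply (hWu v t ht)
      simp only [Function.comp_apply] at this
      rwa [hB] at this
    have := constant_of_has_deriv_right_zero hc hd ε ⟨ε.2, le_rfl⟩
    simpa [hW0] using this

/-- The flow is differentiable in the initial point, and its derivative preserves every bilinear
form that is infinitesimally preserved by the vector field. -/
theorem exists_hasFDerivAt [CompleteSpace E] (h : IsGlobalFlow f φ) {f' : E → E →L[ℝ] E}
    (hf' : ∀ x, HasFDerivAt f (f' x) x) (hf : LipschitzWith K f) {M : ℝ≥0}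
    (hM : LipschitzWith M f') (B : E →L[ℝ] E →L[ℝ] ℝ) (hB : ∀ x u v, B (f' x u) v + B u (f' x v) = 0)
    (t : ℝ) (x : E) :
    ∃ A : E →L[ℝ] E, HasFDerivAt (φ t) A x ∧ ∀ u v, B (A u) (A v) = B u v := by
  wlog ht : 0 ≤ t generalizing f φ f' t
  · have := this h.neg (f' := fun x => -f' x) (fun x => (hf' x).neg) hf.neg hM.neg
      (fun x u v => by
        have := hB x u v
        simp only [neg_apply, map_neg]
        linarith) (-t) (by linarith)
    simpa using this
  -- Time `t` is divided into `n` steps of length `ε = t / n`, each short enough for the local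
  -- result: `ε ≤ 1` and `2 * K * ε ≤ 1`.
  obtain ⟨n, hn⟩ := exists_nat_gt (max t (2 * K * t))
  have hn0 : (0 : ℝ) < n := (ht.trans (le_max_left _ _)).trans_lt hn
  set ε : ℝ≥0 := ⟨t / n, by positivity⟩ with hεdef
  have hεt : (ε : ℝ) = t / n := rfl
  have hε1 : ε ≤ 1 := by
    rw [← NNReal.coe_le_coe, hεt, NNReal.coe_one, div_le_one hn0]
    exact (le_max_left _ _).trans hn.le
  have hε2 : 2 * K * ε ≤ 1 := by
    rw [← NNReal.coe_le_coe]
    push_cast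
    rw [hεt, mul_div_assoc', div_le_one hn0]
    exact (le_max_right _ _).trans hn.le
  have key : ∀ m : ℕ, ∃ A : E →L[ℝ] E, HasFDerivAt (φ (m * ε)) A x ∧ ∀ u v, B (A u) (A v) = B u v := by
    intro m
    induction m with
    | zero =>
      refine ⟨ContinuousLinearMap.id ℝ E, ?_, fun u v => rfl⟩
      have : φ (((0 : ℕ) : ℝ) * ε) = id := by ext y; simp [h.zero]
      rw [this]
      exact hasFDerivAt_id x
    | succ m ih =>
      obtain ⟨A, hA, hAB⟩ := ih
      obtain ⟨A', hA', hAB'⟩ := h.exists_hasFDerivAt_of_small hf' hf hM B hB hε1 hε2 (φ (m * ε) x)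
      refine ⟨A'.comp A, ?_, fun u v => by simp [hAB, hAB']⟩
      have : φ (((m + 1 : ℕ) : ℝ) * ε) = φ ε ∘ φ (m * ε) := by
        ext y
        rw [Function.comp, ← h.add hf]
        push_cast
        ring_nf
      rw [this]
      exact hA'.comp x hA
  have := key n
  rwa [hεt, mul_div_cancel₀ _ hn0.ne'] at this

/-- The flow is jointly differentiable as soon as it is differentiable in the initial point. -/
theorem hasFDerivAt_uncurry (h : IsGlobalFlow f φ) (hf : LipschitzWith K f) {L : ℝ≥0}
    (hL : ∀ x, ‖f x‖ ≤ L) {t : ℝ} {x : E} {A : E →L[ℝ] E} (hA : HasFDerivAt (φ t) A x) :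
    HasFDerivAt (fun p : ℝ × E => φ p.1 p.2)
      ((ContinuousLinearMap.fst ℝ ℝ E).smulRight (f (φ t x)) +
        A.comp (ContinuousLinearMap.snd ℝ ℝ E)) (t, x) := by
  have h1 : HasFDerivAt (fun p : ℝ × E => φ p.1 p.2)
      ((ContinuousLinearMap.fst ℝ ℝ E).smulRight (f (φ t x)) + ContinuousLinearMap.snd ℝ ℝ E)
      (t - t, φ t x) := by
    rw [sub_self]
    exact (h.hasStrictFDerivAt_zero hf hL (φ t x)).hasFDerivAt
  have h2 : HasFDerivAt (fun p : ℝ × E => (p.1 - t, φ t p.2))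
      ((ContinuousLinearMap.fst ℝ ℝ E).prod (A.comp (ContinuousLinearMap.snd ℝ ℝ E))) (t, x) :=
    (hasFDerivAt_fst.sub_const t).prodMk (hA.comp (t, x) hasFDerivAt_snd)
  have h3 := HasFDerivAt.comp (f := fun p : ℝ × E => (p.1 - t, φ t p.2)) (t, x) h1 h2
  have e : (fun p : ℝ × E => φ p.1 p.2) =
      (fun p : ℝ × E => φ p.1 p.2) ∘ fun p : ℝ × E => (p.1 - t, φ t p.2) := by
    ext p
    simp [← h.add hf]
  rw [e]
  refine h3.congr_fderiv ?_
  ext p <;> simp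

end IsGlobalFlow

end GlobalFlow

/-! ### The standard symplectic form -/

section Symplectic

open scoped NNReal

/-- The standard symplectic form as a continuous bilinear map. -/
noncomputable def omegaL : R4 →L[ℝ] R4 →L[ℝ] ℝ :=
  let p := fun i : Fin 4 => (EuclideanSpace.proj i : R4 →L[ℝ] ℝ)
  (p 2).smulRight (p 0) - (p 0).smulRight (p 2) + ((p 3).smulRight (p 1) - (p 1).smulRight (p 3))

theorem omegaL_apply (u v : R4) : omegaL u v = omega0 u v := by
  simp [omegaL, omega0]

/-- The complex structure `J0` as a continuous linear map. -/
noncomputable def J0L : R4 →L[ℝ] R4 :=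
  LinearMap.toContinuousLinearMap
    { toFun := J0
      map_add' := fun u v => by ext i; fin_cases i <;> simp [J0] <;> ring
      map_smul' := fun a u => by ext i; fin_cases i <;> simp [J0] }

theorem omega0_J0_left (u v : R4) : omega0 (J0 u) v = -inner ℝ u v := by
  simp [omega0, J0, PiLp.inner_apply, Fin.sum_univ_four]
  ring

theorem omega0_neg_swap (u v : R4) : omega0 u v = -omega0 v u := by
  simp [omega0]; ring

theorem omega0_hamVF (H : R4 → ℝ) (x v : R4) : omega0 (hamVF H x) v = -fderiv ℝ H x v := by
  rw [hamVF, omega0_J0_left, gradient, InnerProductSpace.toDual_symm_apply]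

theorem omega0_eq_zero {u : R4} (h : ∀ v, omega0 u v = 0) : u = 0 := by
  ext i
  have h0 := h (EuclideanSpace.single 0 1)
  have h1 := h (EuclideanSpace.single 1 1)
  have h2 := h (EuclideanSpace.single 2 1)
  have h3 := h (EuclideanSpace.single 3 1)
  simp [omega0] at h0 h1 h2 h3
  fin_cases i <;> simp [*]

/-- A linear map preserving the symplectic form is injective. -/
theorem injective_of_omega0 {A : R4 →L[ℝ] R4} (hA : ∀ u v, omega0 (A u) (A v) = omega0 u v) :
    Function.Injective A := by
  rw [injective_iff_map_eq_zero]
  intro u hu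
  refine omega0_eq_zero fun v => ?_
  rw [← hA, hu]
  simp [omega0]

theorem hamVF_congr {G H : R4 → ℝ} {x : R4} (h : G =ᶠ[𝓝 x] H) : hamVF G x = hamVF H x := by
  rw [hamVF, hamVF, gradient, gradient, h.fderiv_eq]

/-- A smooth function is, near a compact set, equal to a compactly supported one. -/
theorem exists_hasCompactSupport_eventuallyEq {H : R4 → ℝ} (hH : ContDiff ℝ ∞ H) {S : Set R4}
    (hS : IsCompact S) :
    ∃ G : R4 → ℝ, ContDiff ℝ ∞ G ∧ HasCompactSupport G ∧ ∀ x ∈ S, G =ᶠ[𝓝 x] H := by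
  obtain ⟨r, hr⟩ := hS.isBounded.subset_ball (0 : R4)
  let χ : ContDiffBump (0 : R4) :=
    -- The maximum with `1` keeps the inner radius positive, as a bump function requires.
    ⟨max r 1, max r 1 + 1, by positivity, by linarith⟩
  refine ⟨fun x => χ x * H x, χ.contDiff.mul hH, χ.hasCompactSupport.mul_right, fun x hx => ?_⟩
  have hx' : x ∈ Metric.ball (0 : R4) (max r 1) :=
    Metric.ball_subset_ball (le_max_left _ _) (hr hx)
  filter_upwards [Metric.isOpen_ball.mem_nhds hx'] with y hy
  have : χ y = 1 := χ.one_of_mem_closedBall (Metric.ball_subset_closedBall hy)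
  simp [this]

theorem contDiff_hamVF {G : R4 → ℝ} (hG : ContDiff ℝ ∞ G) : ContDiff ℝ ∞ (hamVF G) := by
  have h1 : ContDiff ℝ ∞ (fderiv ℝ G) := hG.fderiv_right (by simp)
  have h2 : ContDiff ℝ ∞ fun x => J0L ((InnerProductSpace.toDual ℝ R4).symm (fderiv ℝ G x)) :=
    J0L.contDiff.comp ((InnerProductSpace.toDual ℝ R4).symm.contDiff.comp h1)
  exact h2

theorem hasCompactSupport_hamVF {G : R4 → ℝ} (hG : HasCompactSupport G) :
    HasCompactSupport (hamVF G) :=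
  (hG.fderiv ℝ).comp_left (g := fun l => J0L ((InnerProductSpace.toDual ℝ R4).symm l)) (by simp)

/-- The linearization of a Hamiltonian vector field is infinitesimally symplectic. -/
theorem omegaL_fderiv_hamVF {G : R4 → ℝ} (hG : ContDiff ℝ ∞ G) (x u v : R4) :
    omegaL (fderiv ℝ (hamVF G) x u) v + omegaL u (fderiv ℝ (hamVF G) x v) = 0 := by
  have hX : DifferentiableAt ℝ (hamVF G) x := (contDiff_hamVF hG).differentiable (by simp) x
  have hdG : DifferentiableAt ℝ (fderiv ℝ G) x :=
    (hG.fderiv_right (m := ∞) (by simp)).differentiable (by simp) x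
  -- Differentiating `ω₀(X_G, b) = -dG(b)` turns the linearization of `X_G` into the Hessian of `G`;
  -- the claim is then the symmetry of the Hessian.
  have key : ∀ a b, omegaL (fderiv ℝ (hamVF G) x a) b = -fderiv ℝ (fderiv ℝ G) x a b := by
    intro a b
    have h1 : HasFDerivAt (fun y => omegaL.flip b (hamVF G y))
        ((omegaL.flip b).comp (fderiv ℝ (hamVF G) x)) x :=
      (omegaL.flip b).hasFDerivAt.comp x hX.hasFDerivAt
    have h2 : HasFDerivAt (fun y => -(fderiv ℝ G y b)) (-((fderiv ℝ (fderiv ℝ G) x).flip b)) x := by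
      have := hdG.hasFDerivAt.clm_apply (hasFDerivAt_const b x)
      simpa using! this.neg
    have h3 : (fun y => omegaL.flip b (hamVF G y)) = fun y => -(fderiv ℝ G y b) := by
      ext y
      rw [ContinuousLinearMap.flip_apply, omegaL_apply, omega0_hamVF]
    rw [h3] at h1
    have := congrArg (fun l => l a) (h1.unique h2)
    simpa using this
  have hsymm : fderiv ℝ (fderiv ℝ G) x u v = fderiv ℝ (fderiv ℝ G) x v u :=
    hG.contDiffAt.isSymmSndFDerivAt
      (by rw [minSmoothness_of_isRCLikeNormedField]; exact WithTop.coe_le_coe.2 (le_top : (2 : ℕ∞) ≤ ⊤)) u v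
  rw [omegaL_apply u, omega0_neg_swap, ← omegaL_apply, key, key, hsymm]
  ring

/-- The flow of a compactly supported Hamiltonian, with its regularity and its invariants. -/
structure IsHamiltonianFlow (G : R4 → ℝ) (φ : ℝ → R4 → R4) : Prop where
  contDiff : ContDiff ℝ ∞ G
  flow : IsGlobalFlow (hamVF G) φ
  lipschitz : ∃ K : ℝ≥0, LipschitzWith K (hamVF G)
  bounded : ∃ L : ℝ≥0, ∀ x, ‖hamVF G x‖ ≤ L
  symplectic : ∀ t x, ∃ A : R4 →L[ℝ] R4, HasFDerivAt (φ t) A x ∧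
    ∀ u v, omega0 (A u) (A v) = omega0 u v

/-- Compact support makes the vector field bounded, and makes both the field and its derivative
Lipschitz, which is all that existence and differentiability of the flow need. -/
theorem exists_isHamiltonianFlow {G : R4 → ℝ} (hG : ContDiff ℝ ∞ G) (hc : HasCompactSupport G) :
    ∃ φ, IsHamiltonianFlow G φ := by
  have hX := contDiff_hamVF hG
  have hXc := hasCompactSupport_hamVF hc
  obtain ⟨K, hK⟩ := hX.lipschitzWith_of_hasCompactSupport hXc (by simp)
  obtain ⟨C, hC⟩ := hXc.exists_bound_of_continuous hX.continuous
  have hL : ∀ x, ‖hamVF G x‖ ≤ C.toNNReal := fun x => (hC x).trans (Real.le_coe_toNNReal C)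
  obtain ⟨φ, hφ⟩ := exists_isGlobalFlow hK hL
  obtain ⟨M, hM⟩ := (hX.fderiv_right (m := ∞) (by simp)).lipschitzWith_of_hasCompactSupport
    (hXc.fderiv ℝ) (by simp)
  refine ⟨φ, hG, hφ, ⟨K, hK⟩, ⟨_, hL⟩, fun t x => ?_⟩
  simp only [← omegaL_apply]
  exact hφ.exists_hasFDerivAt (fun x => (hX.differentiable (by simp) x).hasFDerivAt) hK hM omegaL
    (omegaL_fderiv_hamVF hG) t x

namespace IsHamiltonianFlow

variable {G : R4 → ℝ} {φ : ℝ → R4 → R4}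

theorem add (h : IsHamiltonianFlow G φ) (s t : ℝ) (x : R4) : φ (s + t) x = φ s (φ t x) :=
  let ⟨_, hK⟩ := h.lipschitz
  h.flow.add hK s t x

theorem neg_apply_self (h : IsHamiltonianFlow G φ) (t : ℝ) (x : R4) : φ (-t) (φ t x) = x :=
  let ⟨_, hK⟩ := h.lipschitz
  h.flow.neg_apply_self hK t x

theorem apply_neg_self (h : IsHamiltonianFlow G φ) (t : ℝ) (x : R4) : φ t (φ (-t) x) = x :=
  let ⟨_, hK⟩ := h.lipschitz
  h.flow.apply_neg_self hK t x

theorem continuous (h : IsHamiltonianFlow G φ) : Continuous fun p : ℝ × R4 => φ p.1 p.2 :=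
  let ⟨_, hK⟩ := h.lipschitz
  let ⟨_, hL⟩ := h.bounded
  h.flow.continuous hK hL

theorem energy (h : IsHamiltonianFlow G φ) (t : ℝ) (x : R4) : G (φ t x) = G x := by
  have hd : ∀ s, HasDerivAt (fun s => G (φ s x)) 0 s := by
    intro s
    have := ((h.contDiff.differentiable (by simp) (φ s x)).hasFDerivAt).comp_hasDerivAt s
      (h.flow.deriv s x)
    rwa [← neg_neg (fderiv ℝ G (φ s x) (hamVF G (φ s x))), ← omega0_hamVF,
      show omega0 (hamVF G (φ s x)) (hamVF G (φ s x)) = 0 by simp [omega0]; ring, neg_zero] at this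
  have := is_const_of_deriv_eq_zero (fun s => (hd s).differentiableAt) (fun s => (hd s).deriv) t 0
  simpa [h.flow.zero] using this

/-- The derivative of the flow preserves the Hamiltonian vector field. -/
theorem map_hamVF (h : IsHamiltonianFlow G φ) {t : ℝ} {x : R4} {A : R4 →L[ℝ] R4}
    (hA : HasFDerivAt (φ t) A x) : A (hamVF G x) = hamVF G (φ t x) := by
  have h0 := h.flow.deriv 0 x
  have h1 : HasDerivAt (fun s => φ t (φ s x)) (A (hamVF G x)) 0 := by
    rw [h.flow.zero] at h0
    have hA' : HasFDerivAt (φ t) A (φ 0 x) := by rwa [h.flow.zero]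
    exact hA'.comp_hasDerivAt 0 h0
  have h2 : HasDerivAt (fun s => φ s (φ t x)) (hamVF G (φ t x)) 0 := by
    simpa [h.flow.zero] using h.flow.deriv 0 (φ t x)
  -- The invariance of the field is the derivative at `s = 0` of the commutation of `φ t` and `φ s`.
  have e : (fun s => φ t (φ s x)) = fun s => φ s (φ t x) := by
    ext1 s; rw [← h.add, ← h.add, add_comm]
  rw [e] at h1
  exact h1.unique h2

theorem fderiv_energy (h : IsHamiltonianFlow G φ) {t : ℝ} {x : R4} {A : R4 →L[ℝ] R4}
    (hA : HasFDerivAt (φ t) A x) (v : R4) : fderiv ℝ G (φ t x) (A v) = fderiv ℝ G x v := by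
  have h1 := ((h.contDiff.differentiable (by simp) (φ t x)).hasFDerivAt).comp x hA
  have e : G ∘ φ t = G := by ext y; exact h.energy t y
  rw [e] at h1
  rw [h1.fderiv]
  rfl

end IsHamiltonianFlow

/-! ### Sections of the flow in an energy level -/

/-- `c` parametrizes, on the open unit disk, a section of the Hamiltonian flow in an energy level. -/
structure IsSection (G : R4 → ℝ) (E : ℝ) (c : R2 → R4) : Prop where
  contDiffOn_closedDisk : ContDiffOn ℝ 1 c closedDisk
  contDiffOn : ContDiffOn ℝ ∞ c (Metric.ball 0 1)
  injOn : InjOn c closedDisk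
  energy : ∀ z ∈ Metric.ball 0 1, G (c z) = E
  injective : ∀ z ∈ Metric.ball 0 1, Function.Injective (fderiv ℝ c z)
  transverse : ∀ z ∈ Metric.ball 0 1, hamVF G (c z) ∉ range (fderiv ℝ c z)

namespace IsSection

variable {G : R4 → ℝ} {φ : ℝ → R4 → R4} {E : ℝ} {c c₁ c₂ : R2 → R4}

theorem hasStrictFDerivAt (h : IsSection G E c) {z : R2} (hz : z ∈ Metric.ball 0 1) :
    HasStrictFDerivAt c (fderiv ℝ c z) z :=
  (h.contDiffOn.contDiffAt (Metric.isOpen_ball.mem_nhds hz)).hasStrictFDerivAt (by simp)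

theorem fderiv_energy (h : IsSection G E c) (hG : ContDiff ℝ ∞ G) {z : R2}
    (hz : z ∈ Metric.ball 0 1) (u : R2) : fderiv ℝ G (c z) (fderiv ℝ c z u) = 0 := by
  have h1 := ((hG.differentiable (by simp) (c z)).hasFDerivAt).comp z
    (h.hasStrictFDerivAt hz).hasFDerivAt
  have h2 : HasFDerivAt (G ∘ c) (0 : R2 →L[ℝ] ℝ) z := by
    refine (hasFDerivAt_const E z).congr_of_eventuallyEq ?_
    filter_upwards [Metric.isOpen_ball.mem_nhds hz] with w hw
    exact h.energy w hw
  exact congrArg (fun l => l u) (h1.unique h2)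

/-- The derivative of `(w, t) ↦ φ (-t) (c w)`. -/
theorem exists_hasFDerivAt_flow (h : IsSection G E c) (hφ : IsHamiltonianFlow G φ) {w : R2}
    (hw : w ∈ Metric.ball 0 1) (t : ℝ) :
    ∃ (A : R4 →L[ℝ] R4) (Θ' : R2 × ℝ →L[ℝ] R4),
      (∀ u v, omega0 (A u) (A v) = omega0 u v) ∧
      HasFDerivAt (φ (-t)) A (c w) ∧
      HasFDerivAt (fun p : R2 × ℝ => φ (-p.2) (c p.1)) Θ' (w, t) ∧
      (∀ u s, Θ' (u, s) = A (fderiv ℝ c w u) - s • hamVF G (φ (-t) (c w))) ∧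
      Function.Injective Θ' ∧
      ∀ v, fderiv ℝ G (φ (-t) (c w)) v = 0 → v ∈ range Θ' := by
  obtain ⟨A, hA, hAω⟩ := hφ.symplectic (-t) (c w)
  obtain ⟨K, hK⟩ := hφ.lipschitz
  obtain ⟨L, hL⟩ := hφ.bounded
  have h1 := hφ.flow.hasFDerivAt_uncurry hK hL hA
  have h2 : HasFDerivAt (fun p : R2 × ℝ => (-p.2, c p.1))
      ((-ContinuousLinearMap.snd ℝ R2 ℝ).prod
        ((fderiv ℝ c w).comp (ContinuousLinearMap.fst ℝ R2 ℝ))) (w, t) :=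
    (hasFDerivAt_snd.neg).prodMk
      ((h.hasStrictFDerivAt hw).hasFDerivAt.comp (w, t) hasFDerivAt_fst)
  have h3 := HasFDerivAt.comp (f := fun p : R2 × ℝ => (-p.2, c p.1)) (w, t) h1 h2
  obtain ⟨Θ', hΘ, hΘ'⟩ : ∃ Θ' : R2 × ℝ →L[ℝ] R4,
      HasFDerivAt (fun p : R2 × ℝ => φ (-p.2) (c p.1)) Θ' (w, t) ∧
      ∀ u s, Θ' (u, s) = A (fderiv ℝ c w u) - s • hamVF G (φ (-t) (c w)) :=
    ⟨_, h3, fun u s => by simp [sub_eq_add_neg, add_comm]⟩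
  have hinj : Function.Injective Θ' := by
    rw [injective_iff_map_eq_zero]
    rintro ⟨u, s⟩ hus
    have e : A (fderiv ℝ c w u) = A (s • hamVF G (c w)) := by
      rw [map_smul, hφ.map_hamVF hA]
      rwa [hΘ', sub_eq_zero] at hus
    have e' := injective_of_omega0 hAω e
    have hs : s = 0 := by
      by_contra hs
      refine h.transverse w hw ⟨s⁻¹ • u, ?_⟩
      rw [map_smul, e', smul_smul, inv_mul_cancel₀ hs, one_smul]
    subst hs
    rw [zero_smul] at e'
    have hu : u = 0 := (injective_iff_map_eq_zero _).1 (h.injective w hw) u e'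
    simp [hu]
  refine ⟨A, Θ', hAω, hA, hΘ, hΘ', hinj, ?_⟩
  -- The image of `Θ'` is tangent to the energy level. It has dimension `3` by injectivity, and so
  -- has the kernel of `dG ≠ 0` in `ℝ⁴`; hence the two coincide.
  have hle : LinearMap.range (Θ' : R2 × ℝ →ₗ[ℝ] R4) ≤
      LinearMap.ker (fderiv ℝ G (φ (-t) (c w)) : R4 →ₗ[ℝ] ℝ) := by
    rintro _ ⟨⟨u, s⟩, rfl⟩
    have h0 : fderiv ℝ G (φ (-t) (c w)) (hamVF G (φ (-t) (c w))) = 0 := by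
      rw [← neg_neg (fderiv ℝ G _ _), ← omega0_hamVF]
      simp [omega0]; ring
    change fderiv ℝ G (φ (-t) (c w)) (Θ' (u, s)) = 0
    rw [hΘ', map_sub, map_smul, h0, hφ.fderiv_energy hA, h.fderiv_energy hφ.contDiff hw]
    simp
  have hne : (fderiv ℝ G (φ (-t) (c w)) : R4 →ₗ[ℝ] ℝ) ≠ 0 := by
    intro h0
    have hX : hamVF G (φ (-t) (c w)) = 0 := omega0_eq_zero fun v => by
      rw [omega0_hamVF]
      have := congrArg (fun l => l v) h0
      simpa using this
    rw [← hφ.map_hamVF hA] at hX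
    have := (injective_iff_map_eq_zero _).1 (injective_of_omega0 hAω) _ hX
    exact h.transverse w hw ⟨0, by rw [this, map_zero]⟩
  have hfr : Module.finrank ℝ (LinearMap.range (Θ' : R2 × ℝ →ₗ[ℝ] R4)) =
      Module.finrank ℝ (LinearMap.ker (fderiv ℝ G (φ (-t) (c w)) : R4 →ₗ[ℝ] ℝ)) := by
    have h1 := Module.Dual.finrank_ker_add_one_of_ne_zero hne
    rw [LinearMap.finrank_range_of_inj hinj]
    simp only [Module.finrank_prod, finrank_euclideanSpace, Fintype.card_fin, Module.finrank_self] at h1 ⊢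
    omega
  have heq := Submodule.eq_of_le_of_finrank_eq hle hfr
  intro v hv
  have : v ∈ LinearMap.range (Θ' : R2 × ℝ →ₗ[ℝ] R4) := by
    rw [heq]; exact hv
  exact this

/-- Near a point, `(w, t) ↦ φ (-t) (c w)` has a Lipschitz inverse. -/
theorem isBigO_sub (h : IsSection G E c) (hφ : IsHamiltonianFlow G φ) {w : R2}
    (hw : w ∈ Metric.ball 0 1) (t : ℝ) :
    (fun q : (R2 × ℝ) × (R2 × ℝ) => q.1 - q.2) =O[𝓝 ((w, t), (w, t))]
      fun q => φ (-q.1.2) (c q.1.1) - φ (-q.2.2) (c q.2.1) := by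
  obtain ⟨K, hK⟩ := hφ.lipschitz
  obtain ⟨L, hL⟩ := hφ.bounded
  -- Strict differentiability of the flow is known at time zero only, so the time parameter is first
  -- recentered at `t`.
  have h1 : HasStrictFDerivAt (fun p : ℝ × R4 => φ p.1 p.2)
      ((ContinuousLinearMap.fst ℝ ℝ R4).smulRight (hamVF G (c w)) + ContinuousLinearMap.snd ℝ ℝ R4)
      (-(t - t), c w) := by
    rw [sub_self, neg_zero]
    exact hφ.flow.hasStrictFDerivAt_zero hK hL (c w)
  have h2 : HasStrictFDerivAt (fun p : R2 × ℝ => (-(p.2 - t), c p.1))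
      ((-ContinuousLinearMap.snd ℝ R2 ℝ).prod
        ((fderiv ℝ c w).comp (ContinuousLinearMap.fst ℝ R2 ℝ))) (w, t) :=
    ((hasStrictFDerivAt_snd.sub_const t).neg).prodMk
      ((h.hasStrictFDerivAt hw).comp (w, t) hasStrictFDerivAt_fst)
  have h3 := HasStrictFDerivAt.comp (f := fun p : R2 × ℝ => (-(p.2 - t), c p.1)) (w, t) h1 h2
  have hinj : Function.Injective (((ContinuousLinearMap.fst ℝ ℝ R4).smulRight (hamVF G (c w)) +
      ContinuousLinearMap.snd ℝ ℝ R4).comp ((-ContinuousLinearMap.snd ℝ R2 ℝ).prod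
        ((fderiv ℝ c w).comp (ContinuousLinearMap.fst ℝ R2 ℝ)))) := by
    rw [injective_iff_map_eq_zero]
    rintro ⟨u, s⟩ hus
    simp at hus
    rw [neg_add_eq_zero] at hus
    have hs : s = 0 := by
      by_contra hs
      refine h.transverse w hw ⟨s⁻¹ • u, ?_⟩
      rw [map_smul, ← hus, smul_smul, inv_mul_cancel₀ hs, one_smul]
    subst hs
    rw [zero_smul] at hus
    have hu : u = 0 := (injective_iff_map_eq_zero _).1 (h.injective w hw) u hus.symm
    simp [hu]
  have hind : Topology.IsInducing (((ContinuousLinearMap.fst ℝ ℝ R4).smulRight (hamVF G (c w)) +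
      ContinuousLinearMap.snd ℝ ℝ R4).comp ((-ContinuousLinearMap.snd ℝ R2 ℝ).prod
        ((fderiv ℝ c w).comp (ContinuousLinearMap.fst ℝ R2 ℝ)))) :=
    (LinearMap.isClosedEmbedding_of_injective (LinearMap.ker_eq_bot.2 hinj)).isInducing
  refine (h3.isTheta_sub hind).isBigO_symm.trans ?_
  -- The recentering is undone by `φ t`, whose Lipschitz constant is `exp (K * |t|)`.
  refine IsBigO.of_bound (Real.exp (K * |t|)) (Eventually.of_forall fun q => ?_)
  have := hφ.flow.dist_le hK t (φ (-q.1.2) (c q.1.1)) (φ (-q.2.2) (c q.2.1))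
  rw [← hφ.add, ← hφ.add, dist_eq_norm, dist_eq_norm, mul_comm] at this
  simpa [sub_eq_add_neg, add_comm] using this

/-- A transition map between two sections is differentiable, and symplectic, wherever it is
continuous, together with the transition time. -/
theorem exists_hasFDerivWithinAt_transition (h₁ : IsSection G E c₁) (h₂ : IsSection G E c₂)
    (hφ : IsHamiltonianFlow G φ) {P : Set R2} {g : R2 → R2} {T : R2 → ℝ} {z : R2} (hz : z ∈ P)
    (hz₁ : z ∈ Metric.ball 0 1) (hz₂ : g z ∈ Metric.ball 0 1)
    (hg : ∀ x ∈ P, φ (-T x) (c₂ (g x)) = c₁ x)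
    (hgc : ContinuousWithinAt g P z) (hTc : ContinuousWithinAt T P z) :
    ∃ g' : R2 →L[ℝ] R2, HasFDerivWithinAt g g' P z ∧ ∀ u v,
      omega0 (fderiv ℝ c₂ (g z) (g' u)) (fderiv ℝ c₂ (g z) (g' v)) =
        omega0 (fderiv ℝ c₁ z u) (fderiv ℝ c₁ z v) := by
  obtain ⟨A, Θ', hAω, hA, hΘ, hΘ', hinj, hrange⟩ := h₂.exists_hasFDerivAt_flow hφ hz₂ (T z)
  rw [hg z hz] at hΘ' hrange
  obtain ⟨L, hL⟩ := LinearMap.exists_leftInverse_of_injective (Θ' : R2 × ℝ →ₗ[ℝ] R4)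
    (LinearMap.ker_eq_bot.2 hinj)
  have hL' : Function.LeftInverse (LinearMap.toContinuousLinearMap L) Θ' := fun p =>
    congrArg (fun l => l p) hL
  -- With `Θ (w, s) = φ (-s) (c₂ w)`, the identity `Θ (g x, T x) = c₁ x` on `P` determines `(g, T)`
  -- implicitly. A left inverse of `Θ'` and continuity of `(g, T)` suffice to differentiate it.
  have hd := HasFDerivWithinAt.of_comp_of_leftInverse (g := fun x => (g x, T x))
    (f := fun p : R2 × ℝ => φ (-p.2) (c₂ p.1)) (s := P) (t := univ) (a := z)
    (f' := Θ') (h := c₁) (h' := fderiv ℝ c₁ z)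
    (by rw [nhdsWithin_univ]; exact hgc.prodMk hTc) hΘ.hasFDerivWithinAt
    (h₁.hasStrictFDerivAt hz₁).hasFDerivAt.hasFDerivWithinAt
    (eventually_nhdsWithin_of_forall hg) hL' hz
  set D := (LinearMap.toContinuousLinearMap L).comp (fderiv ℝ c₁ z) with hD
  have key : ∀ u, Θ' (D u) = fderiv ℝ c₁ z u := by
    intro u
    obtain ⟨p, hp⟩ := hrange (fderiv ℝ c₁ z u) (h₁.fderiv_energy hφ.contDiff hz₁ u)
    rw [hD, ContinuousLinearMap.comp_apply, ← hp, hL' p]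
  refine ⟨(ContinuousLinearMap.fst ℝ R2 ℝ).comp D, hd.fst, fun u v => ?_⟩
  -- `X_G` is `ω₀`-orthogonal to the tangent space of the energy level. So the terms produced by
  -- varying the transition time do not contribute to the area form.
  have hX : ∀ w, omega0 (hamVF G (c₁ z)) (A (fderiv ℝ c₂ (g z) w)) = 0 := by
    intro w
    have h1 := hφ.fderiv_energy hA (fderiv ℝ c₂ (g z) w)
    rw [hg z hz, h₂.fderiv_energy hφ.contDiff hz₂] at h1
    rw [omega0_hamVF, h1, neg_zero]
  have e : ∀ u, fderiv ℝ c₁ z u =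
      A (fderiv ℝ c₂ (g z) (D u).1) - (D u).2 • hamVF G (c₁ z) := fun u => by rw [← key u, ← hΘ']
  rw [e u, e v, ← hAω (fderiv ℝ c₂ (g z) ((ContinuousLinearMap.fst ℝ R2 ℝ).comp D u)),
    ← omegaL_apply, ← omegaL_apply]
  have hX' : ∀ w, omegaL (A (fderiv ℝ c₂ (g z) w)) (hamVF G (c₁ z)) = 0 := fun w => by
    rw [omegaL_apply, omega0_neg_swap, hX, neg_zero]
  have hX'' : ∀ w, omegaL (hamVF G (c₁ z)) (A (fderiv ℝ c₂ (g z) w)) = 0 := fun w => by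
    rw [omegaL_apply, hX]
  have hXX : omegaL (hamVF G (c₁ z)) (hamVF G (c₁ z)) = 0 := by
    rw [omegaL_apply]; simp [omega0]; ring
  simp only [map_sub, map_smul, sub_apply, smul_apply, hX', hX'', hXX,
    ContinuousLinearMap.comp_apply, ContinuousLinearMap.coe_fst', smul_zero, sub_zero]

end IsSection

end Symplectic

/-! ### Symplectic area as a measure, and its invariance under transition maps. -/

section AreaMeasure

open MeasureTheory

/-- The density of the symplectic area of the surface parametrized by `c`. -/
noncomputable def areaDensity (c : R2 → R4) (z : R2) : ENNReal :=
  ENNReal.ofReal |omega0 (fderiv ℝ c z (EuclideanSpace.single 0 1))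
    (fderiv ℝ c z (EuclideanSpace.single 1 1))|

/-- The symplectic area of the surface parametrized by `c` on the open unit disk, as a measure. -/
noncomputable def areaMeasure (c : R2 → R4) : Measure R4 :=
  ((volume.restrict (Metric.ball 0 1)).withDensity (areaDensity c)).map c

theorem measurable_areaDensity (c : R2 → R4) : Measurable (areaDensity c) := by
  have h : ∀ v : R2, Measurable fun z => fderiv ℝ c z v := fun v => measurable_fderiv_apply_const ℝ c v
  have h' : ∀ (v : R2) (i : Fin 4), Measurable fun z => fderiv ℝ c z v i := fun v i =>
    (EuclideanSpace.proj (𝕜 := ℝ) i).continuous.measurable.comp (h v)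
  unfold areaDensity omega0
  refine ENNReal.measurable_ofReal.comp ?_
  have m := fun (i j : Fin 4) => (h' (EuclideanSpace.single 0 1) i).mul (h' (EuclideanSpace.single 1 1) j)
  exact measurable_norm.comp (((m 2 0).sub (m 0 2)).add ((m 3 1).sub (m 1 3)))

/-- A two-form on a plane is multiplied by the determinant under a linear map; this is the Jacobian
factor in the change of variables. -/
theorem omega0_comp_eq_det_mul (C : R2 →L[ℝ] R4) (h : R2 →L[ℝ] R2) :
    omega0 (C (h (EuclideanSpace.single 0 1))) (C (h (EuclideanSpace.single 1 1))) =
      h.det * omega0 (C (EuclideanSpace.single 0 1)) (C (EuclideanSpace.single 1 1)) := by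
  have hv : ∀ v : R2, v = v 0 • EuclideanSpace.single 0 1 + v 1 • EuclideanSpace.single 1 1 := by
    intro v; ext i; fin_cases i <;> simp
  have hdet : h.det = h (EuclideanSpace.single 0 1) 0 * h (EuclideanSpace.single 1 1) 1 -
      h (EuclideanSpace.single 1 1) 0 * h (EuclideanSpace.single 0 1) 1 := by
    rw [ContinuousLinearMap.det, ← LinearMap.det_toMatrix (EuclideanSpace.basisFun (Fin 2) ℝ).toBasis,
      Matrix.det_fin_two]
    simp [LinearMap.toMatrix_apply]
  rw [hdet, hv (h (EuclideanSpace.single 0 1)), hv (h (EuclideanSpace.single 1 1))]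
  simp only [map_add, map_smul]
  simp [omega0]
  ring

variable {G : R4 → ℝ} {φ : ℝ → R4 → R4} {E : ℝ} {c c₁ c₂ : R2 → R4}

namespace IsSection

theorem injOn_ball (h : IsSection G E c) : InjOn c (Metric.ball 0 1) :=
  h.injOn.mono Metric.ball_subset_closedBall

theorem continuousOn_ball (h : IsSection G E c) : ContinuousOn c (Metric.ball 0 1) :=
  h.contDiffOn.continuousOn

/-- This is the Lusin-Souslin theorem for the continuous injective parametrization. -/
theorem measurableSet_image (h : IsSection G E c) {s : Set R2} (hs : MeasurableSet s)
    (hsb : s ⊆ Metric.ball 0 1) : MeasurableSet (c '' s) :=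
  hs.image_of_continuousOn_injOn (h.continuousOn_ball.mono hsb) (h.injOn_ball.mono hsb)

theorem measurableSet_preimage (h : IsSection G E c) {A : Set R4} (hA : MeasurableSet A) :
    MeasurableSet (Metric.ball 0 1 ∩ c ⁻¹' A) := by
  have := (continuousOn_iff_continuous_domRestrict.1 h.continuousOn_ball).measurable hA
  have h2 := (measurableSet_ball (x := (0 : R2)) (ε := 1)).subtype_image this
  convert h2 using 1
  ext z
  simp only [mem_inter_iff, mem_preimage, mem_image, Subtype.exists, exists_and_right, exists_eq_right,
    domRestrict_apply]
  exact ⟨fun h => ⟨h.1, h.2⟩, fun ⟨h1, h2⟩ => ⟨h1, h2⟩⟩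

theorem image_preimage (A : Set R4) (hA : A ⊆ c '' Metric.ball 0 1) :
    c '' (Metric.ball 0 1 ∩ c ⁻¹' A) = A := by
  rw [image_inter_preimage, inter_eq_right.2 hA]

theorem areaMeasure_image (h : IsSection G E c) {s : Set R2} (hs : MeasurableSet s)
    (hsb : s ⊆ Metric.ball 0 1) : areaMeasure c (c '' s) = ∫⁻ z in s, areaDensity c z := by
  have hm : AEMeasurable c ((volume.restrict (Metric.ball 0 1)).withDensity (areaDensity c)) :=
    (h.continuousOn_ball.aemeasurable measurableSet_ball).mono_ac
      (withDensity_absolutelyContinuous _ _)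
  rw [areaMeasure, Measure.map_apply_of_aemeasurable hm (h.measurableSet_image hs hsb),
    withDensity_apply', Measure.restrict_restrict' measurableSet_ball]
  congr 2
  ext z
  constructor
  · rintro ⟨⟨w, hw, e⟩, hz⟩
    rwa [← h.injOn_ball (hsb hw) hz e]
  · exact fun hz => ⟨mem_image_of_mem c hz, hsb hz⟩

/-- A map between sections whose derivative is symplectic preserves the symplectic area. -/
theorem areaMeasure_image_of_symplectic (h₁ : IsSection G E c₁) (h₂ : IsSection G E c₂) {s : Set R2}
    (hs : MeasurableSet s) (hsb : s ⊆ Metric.ball 0 1) {g : R2 → R2} (hg : InjOn g s)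
    (hgb : MapsTo g s (Metric.ball 0 1))
    (hd : ∀ z ∈ s, ∃ g' : R2 →L[ℝ] R2, HasFDerivWithinAt g g' s z ∧ ∀ u v,
      omega0 (fderiv ℝ c₂ (g z) (g' u)) (fderiv ℝ c₂ (g z) (g' v)) =
        omega0 (fderiv ℝ c₁ z u) (fderiv ℝ c₁ z v)) :
    areaMeasure c₁ (c₁ '' s) = areaMeasure c₂ (c₂ '' (g '' s)) := by
  have hd' : ∀ z, ∃ g' : R2 →L[ℝ] R2, z ∈ s → HasFDerivWithinAt g g' s z ∧ ∀ u v,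
      omega0 (fderiv ℝ c₂ (g z) (g' u)) (fderiv ℝ c₂ (g z) (g' v)) =
        omega0 (fderiv ℝ c₁ z u) (fderiv ℝ c₁ z v) := fun z => by
    by_cases hz : z ∈ s
    · obtain ⟨g', h⟩ := hd z hz
      exact ⟨g', fun _ => h⟩
    · exact ⟨0, fun h => absurd h hz⟩
  choose g' hg' using hd'
  have hms : MeasurableSet (g '' s) :=
    hs.image_of_continuousOn_injOn (fun z hz => (hg' z hz).1.continuousWithinAt) hg
  rw [h₁.areaMeasure_image hs hsb, h₂.areaMeasure_image hms hgb.image_subset,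
    lintegral_image_eq_lintegral_abs_det_fderiv_mul volume hs (fun z hz => (hg' z hz).1) hg]
  refine setLIntegral_congr_fun hs fun z hz => ?_
  simp only [areaDensity]
  rw [← (hg' z hz).2, omega0_comp_eq_det_mul, abs_mul, ENNReal.ofReal_mul (abs_nonneg _)]

/-- A version of `areaMeasure_image_of_symplectic` for maps that are symplectic on countably many
pieces. -/
theorem areaMeasure_image_of_symplectic_iUnion (h₁ : IsSection G E c₁) (h₂ : IsSection G E c₂)
    {s : ℕ → Set R2} (hs : ∀ n, MeasurableSet (s n)) (hsb : ∀ n, s n ⊆ Metric.ball 0 1)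
    {g : R2 → R2} (hg : InjOn g (⋃ n, s n)) (hgb : ∀ n, MapsTo g (s n) (Metric.ball 0 1))
    (hd : ∀ n, ∀ z ∈ s n, ∃ g' : R2 →L[ℝ] R2, HasFDerivWithinAt g g' (s n) z ∧ ∀ u v,
      omega0 (fderiv ℝ c₂ (g z) (g' u)) (fderiv ℝ c₂ (g z) (g' v)) =
        omega0 (fderiv ℝ c₁ z u) (fderiv ℝ c₁ z v)) :
    areaMeasure c₁ (c₁ '' ⋃ n, s n) = areaMeasure c₂ (c₂ '' (g '' ⋃ n, s n)) := by
  have hsub : ∀ n, disjointed s n ⊆ s n := fun n => disjointed_subset s n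
  have hsub' : ∀ n, disjointed s n ⊆ ⋃ n, s n := fun n => (hsub n).trans (subset_iUnion s n)
  have hm : ∀ n, MeasurableSet (disjointed s n) := MeasurableSet.disjointed hs
  have hdisj := disjoint_disjointed s
  have hgb' : MapsTo g (⋃ n, s n) (Metric.ball 0 1) := by
    intro z hz
    obtain ⟨n, hn⟩ := mem_iUnion.1 hz
    exact hgb n hn
  have hd' : ∀ n, ∀ z ∈ disjointed s n, ∃ g' : R2 →L[ℝ] R2,
      HasFDerivWithinAt g g' (disjointed s n) z ∧ ∀ u v,
      omega0 (fderiv ℝ c₂ (g z) (g' u)) (fderiv ℝ c₂ (g z) (g' v)) =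
        omega0 (fderiv ℝ c₁ z u) (fderiv ℝ c₁ z v) := fun n z hz =>
    let ⟨g', h, h'⟩ := hd n z (hsub n hz)
    ⟨g', h.mono (hsub n), h'⟩
  have hgm : ∀ n, MeasurableSet (g '' disjointed s n) := fun n =>
    (hm n).image_of_continuousOn_injOn
      (fun z hz => let ⟨_, h, _⟩ := hd' n z hz; h.continuousWithinAt) (hg.mono (hsub' n))
  rw [← iUnion_disjointed, image_iUnion, image_iUnion, image_iUnion, measure_iUnion, measure_iUnion]
  · congr 1
    ext1 n
    exact h₁.areaMeasure_image_of_symplectic h₂ (hm n) ((hsub n).trans (hsb n)) (hg.mono (hsub' n))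
      ((hgb n).mono_left (hsub n)) (hd' n)
  · intro i j hij
    have h1 : Disjoint (g '' disjointed s i) (g '' disjointed s j) :=
      (hdisj hij).image hg (hsub' i) (hsub' j)
    exact h1.image h₂.injOn_ball
      ((hgb i).mono_left (hsub i)).image_subset ((hgb j).mono_left (hsub j)).image_subset
  · exact fun n => h₂.measurableSet_image (hgm n) ((hgb n).mono_left (hsub n)).image_subset
  · intro i j hij
    exact (hdisj hij).image h₁.injOn_ball ((hsub i).trans (hsb i)) ((hsub j).trans (hsb j))
  · exact fun n => h₁.measurableSet_image (hm n) ((hsub n).trans (hsb n))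

end IsSection

/-- First hitting times of a `σ`-compact set by a continuous flow are measurable. -/
theorem measurableSet_transition (hφ : IsHamiltonianFlow G φ) {A A₂ : Set R4} (hA : MeasurableSet A)
    (hA₂ : IsSigmaCompact A₂) {T : R4 → ℝ}
    (hT : ∀ x ∈ A, 0 < T x ∧ φ (T x) x ∈ A₂ ∧ ∀ t ∈ Ioo 0 (T x), φ t x ∉ A₂)
    {I : Set ℝ} {B : Set R4} (hI : MeasurableSet I) (hB : MeasurableSet B) :
    MeasurableSet {x | x ∈ A ∧ T x ∈ I ∧ φ (T x) x ∈ B} := by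
  obtain ⟨k, hk, hkA⟩ := hA₂
  have hTm : Measurable fun x : A => T x := by
    refine measurable_of_Iic fun a => ?_
    -- Since `T` is a first hitting time, `T x ≤ a` means that `A₂` is hit at some time in `(0, a]`.
    -- Exhausting `(0, a]` by the intervals `[1/(n+1), a]` and `A₂` by compact sets writes this as a
    -- countable union of compact sets.
    have e : (fun x : A => T x) ⁻¹' Iic a = (Subtype.val : A → R4) ⁻¹' ⋃ n : ℕ, ⋃ m : ℕ,
        (fun p : ℝ × R4 => φ (-p.1) p.2) '' (Icc (1 / ((n : ℝ) + 1)) a ×ˢ k m) := by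
      ext ⟨x, hx⟩
      obtain ⟨h0, h1, h2⟩ := hT x hx
      simp only [mem_preimage, mem_Iic, mem_iUnion, mem_image, mem_prod, Prod.exists]
      constructor
      · intro hTa
        obtain ⟨n, hn⟩ := exists_nat_one_div_lt h0
        rw [← hkA] at h1
        obtain ⟨m, hm⟩ := mem_iUnion.1 h1
        exact ⟨n, m, T x, φ (T x) x, ⟨⟨hn.le, hTa⟩, hm⟩, hφ.neg_apply_self _ _⟩
      · rintro ⟨n, m, t, y, ⟨⟨ht1, ht2⟩, hy⟩, rfl⟩
        have ht0 : 0 < t := lt_of_lt_of_le (by positivity) ht1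
        by_contra hlt
        push Not at hlt
        refine h2 t ⟨ht0, ht2.trans_lt hlt⟩ ?_
        rw [hφ.apply_neg_self, ← hkA]
        exact mem_iUnion.2 ⟨m, hy⟩
    rw [e]
    refine measurable_subtype_coe (MeasurableSet.iUnion fun n => MeasurableSet.iUnion fun m => ?_)
    refine ((isCompact_Icc.prod (hk m)).image ?_).measurableSet
    exact hφ.continuous.comp (continuous_fst.neg.prodMk continuous_snd)
  have hΨm : Measurable fun x : A => φ (T x) x :=
    hφ.continuous.measurable.comp (hTm.prodMk measurable_subtype_coe)
  have := hA.subtype_image ((hTm hI).inter (hΨm hB))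
  convert this using 1
  ext x
  simp only [mem_ofPred_eq, mem_image, mem_inter_iff, mem_preimage, Subtype.exists, exists_and_right,
    exists_eq_right]
  exact ⟨fun h => ⟨⟨h.1, h.2.1⟩, h.2.2⟩, fun ⟨⟨h1, h2⟩, h3⟩ => ⟨h1, h2, h3⟩⟩

/-- The transition maps of the flow between sections in an energy level preserve the symplectic
area. -/
theorem IsSection.areaMeasure_image_transition (h₁ : IsSection G E c₁) (h₂ : IsSection G E c₂)
    (hφ : IsHamiltonianFlow G φ) {A A₂ : Set R4} (hA : MeasurableSet A)
    (hA₁ : A ⊆ c₁ '' Metric.ball 0 1) (hA₂ : A₂ ⊆ c₂ '' Metric.ball 0 1) (hσ : IsSigmaCompact A₂)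
    {Ψ : R4 → R4} (hinj : InjOn Ψ A)
    (hΨ : ∀ x ∈ A, Ψ x ∈ A₂ ∧ ∃ T, 0 < T ∧ φ T x = Ψ x ∧ ∀ t ∈ Ioo 0 T, φ t x ∉ A₂) :
    areaMeasure c₁ A = areaMeasure c₂ (Ψ '' A) := by
  have hΨ' : ∀ x, ∃ T, x ∈ A → 0 < T ∧ φ T x = Ψ x ∧ ∀ t ∈ Ioo 0 T, φ t x ∉ A₂ := fun x => by
    by_cases hx : x ∈ A
    · obtain ⟨T, h⟩ := (hΨ x hx).2
      exact ⟨T, fun _ => h⟩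
    · exact ⟨0, fun h => absurd h hx⟩
  choose T hT using hΨ'
  have hT' : ∀ x ∈ A, 0 < T x ∧ φ (T x) x ∈ A₂ ∧ ∀ t ∈ Ioo 0 (T x), φ t x ∉ A₂ := fun x hx =>
    ⟨(hT x hx).1, (hT x hx).2.1 ▸ (hΨ x hx).1, (hT x hx).2.2⟩
  set g : R2 → R2 := fun z => Function.invFunOn c₂ (Metric.ball 0 1) (Ψ (c₁ z)) with hgdef
  have hex : ∀ z, c₁ z ∈ A → ∃ w ∈ Metric.ball (0 : R2) 1, c₂ w = Ψ (c₁ z) := fun z hz =>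
    hA₂ (hΨ _ hz).1
  have hg1 : ∀ z, c₁ z ∈ A → g z ∈ Metric.ball (0 : R2) 1 := fun z hz =>
    Function.invFunOn_mem (hex z hz)
  have hg2 : ∀ z, c₁ z ∈ A → c₂ (g z) = Ψ (c₁ z) := fun z hz => Function.invFunOn_eq (hex z hz)
  have hΘ : ∀ z, c₁ z ∈ A → φ (-T (c₁ z)) (c₂ (g z)) = c₁ z := fun z hz => by
    rw [hg2 z hz, ← (hT _ hz).2.1, hφ.neg_apply_self]
  -- neighborhoods on which transition points and times depend continuously on the initial point
  have hloc : ∀ p : R2 × ℝ, ∃ ε > 0, ∃ C : ℝ, p.1 ∈ Metric.ball 0 1 →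
      ∀ q ∈ Metric.ball p ε, ∀ q' ∈ Metric.ball p ε,
        dist q q' ≤ C * dist (φ (-q.2) (c₂ q.1)) (φ (-q'.2) (c₂ q'.1)) := by
    intro p
    by_cases hp : p.1 ∈ Metric.ball (0 : R2) 1
    · obtain ⟨C, hC⟩ := (h₂.isBigO_sub hφ hp p.2).bound
      obtain ⟨ε, hε, hball⟩ := Metric.eventually_nhds_iff.1 hC
      refine ⟨ε, hε, C, fun _ q hq q' hq' => ?_⟩
      have := @hball (q, q') (by
        rw [Prod.dist_eq]
        exact max_lt hq hq')
      simpa [dist_eq_norm] using this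
    · exact ⟨1, one_pos, 0, fun h => absurd h hp⟩
  choose ε hε C hC using hloc
  -- By the Lindelöf property, countably many of the balls on which `(w, s) ↦ φ (-s) (c₂ w)` has a
  -- Lipschitz inverse cover the whole parameter space of arrival points and times.
  obtain ⟨t, htsub, htc, hcover⟩ := TopologicalSpace.countable_cover_nhdsWithin
    (s := (Metric.ball (0 : R2) 1) ×ˢ (univ : Set ℝ)) (f := fun p => Metric.ball p (ε p))
    fun p _ => mem_nhdsWithin_of_mem_nhds (Metric.ball_mem_nhds p (hε p))
  have htne : t.Nonempty := by
    obtain ⟨p, hp, -⟩ := mem_iUnion₂.1 (hcover (mk_mem_prod (Metric.mem_ball_self one_pos) (mem_univ (0 : ℝ))))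
    exact ⟨p, hp⟩
  obtain ⟨p, rfl⟩ := htc.exists_eq_range htne
  -- The piece `P n` consists of the starting points whose arrival point and time lie in the `n`-th
  -- ball.
  set P : ℕ → Set R2 := fun n => Metric.ball 0 1 ∩ c₁ ⁻¹' {x | x ∈ A ∧
    T x ∈ Metric.ball (p n).2 (ε (p n)) ∧
    φ (T x) x ∈ c₂ '' (Metric.ball 0 1 ∩ Metric.ball (p n).1 (ε (p n)))} with hPdef
  have hPm : ∀ n, MeasurableSet (P n) := fun n => h₁.measurableSet_preimage
    (measurableSet_transition hφ hA hσ hT' measurableSet_ball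
      (h₂.measurableSet_image (measurableSet_ball.inter measurableSet_ball) inter_subset_left))
  have hPA : ∀ n, ∀ z ∈ P n, z ∈ Metric.ball 0 1 ∧ c₁ z ∈ A ∧
      (g z, T (c₁ z)) ∈ Metric.ball (p n) (ε (p n)) := by
    rintro n z ⟨hz, hzA, hzT, w, ⟨hw1, hw2⟩, e⟩
    refine ⟨hz, hzA, ?_⟩
    rw [(hT _ hzA).2.1, ← hg2 z hzA] at e
    rw [h₂.injOn_ball hw1 (hg1 z hzA) e] at hw2
    rw [Metric.mem_ball, Prod.dist_eq]
    exact max_lt hw2 hzT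
  have hPU : Metric.ball 0 1 ∩ c₁ ⁻¹' A = ⋃ n, P n := by
    ext z
    rw [mem_iUnion]
    constructor
    · rintro ⟨hz, hzA⟩
      have := hcover (mk_mem_prod (hg1 z hzA) (mem_univ (T (c₁ z))))
      simp only [mem_range, iUnion_exists, iUnion_iUnion_eq', mem_iUnion] at this
      obtain ⟨n, hn⟩ := this
      rw [Metric.mem_ball, Prod.dist_eq, max_lt_iff] at hn
      refine ⟨n, hz, hzA, hn.2, g z, ⟨hg1 z hzA, hn.1⟩, ?_⟩
      rw [hg2 z hzA, (hT _ hzA).2.1]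
    · rintro ⟨n, hn⟩
      exact ⟨(hPA n z hn).1, (hPA n z hn).2.1⟩
  have hΨA : Ψ '' A = c₂ '' (g '' ⋃ n, P n) := by
    rw [← hPU, image_image]
    conv_lhs => rw [← image_preimage A hA₁, image_image]
    exact image_congr fun z hz => (hg2 z hz.2).symm
  rw [hΨA, ← image_preimage A hA₁, hPU]
  refine h₁.areaMeasure_image_of_symplectic_iUnion h₂ hPm (fun n => inter_subset_left) ?_
    (fun n z hz => hg1 z (hPA n z hz).2.1) fun n z hz => ?_
  · rw [← hPU]
    rintro z ⟨hz, hzA⟩ z' ⟨hz', hzA'⟩ e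
    refine h₁.injOn_ball hz hz' (hinj hzA hzA' ?_)
    rw [← hg2 z hzA, ← hg2 z' hzA', e]
  · have hpn : (p n).1 ∈ Metric.ball (0 : R2) 1 := (htsub (mem_range_self n)).1
    -- On one piece the Lipschitz inverse bounds the variation of `(g, T)` by that of `c₁`, which
    -- gives the continuity that differentiability of the transition requires.
    have hcont : ContinuousWithinAt (fun x => (g x, T (c₁ x))) (P n) z := by
      rw [ContinuousWithinAt, tendsto_iff_dist_tendsto_zero]
      have h0 : Tendsto (fun x => C (p n) * dist (c₁ x) (c₁ z)) (𝓝[P n] z) (𝓝 0) := by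
        have : ContinuousWithinAt c₁ (P n) z :=
          (h₁.continuousOn_ball z hz.1).mono inter_subset_left
        simpa using (tendsto_iff_dist_tendsto_zero.1 this).const_mul (C (p n))
      refine squeeze_zero' (Eventually.of_forall fun _ => dist_nonneg)
        (eventually_nhdsWithin_of_forall fun x hx => ?_) h0
      have := hC (p n) hpn _ (hPA n x hx).2.2 _ (hPA n z hz).2.2
      simpa only [hΘ x (hPA n x hx).2.1, hΘ z (hPA n z hz).2.1] using this
    exact h₁.exists_hasFDerivWithinAt_transition h₂ hφ hz hz.1 (hg1 z (hPA n z hz).2.1)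
      (fun x hx => hΘ x (hPA n x hx).2.1) hcont.fst hcont.snd

end AreaMeasure

/-! ### Positivity and finiteness of the symplectic area of a section. -/

section AreaBounds

open MeasureTheory

variable {G : R4 → ℝ} {φ : ℝ → R4 → R4} {E : ℝ} {c : R2 → R4}

namespace IsSection

/-- If the form vanished on the tangent plane, a tangent vector `a ≠ 0` would be `ω₀`-orthogonal to
that plane and to `X_G`, which together span `ker dG`. Then `ω₀(a, ·)` is a multiple of `dG`, so `a`
is a multiple of `X_G`, against transversality. -/
theorem areaDensity_ne_zero (h : IsSection G E c) (hφ : IsHamiltonianFlow G φ) {z : R2}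
    (hz : z ∈ Metric.ball 0 1) : areaDensity c z ≠ 0 := by
  intro h0
  have hab : omega0 (fderiv ℝ c z (EuclideanSpace.single 0 1))
      (fderiv ℝ c z (EuclideanSpace.single 1 1)) = 0 := by
    rw [areaDensity, ENNReal.ofReal_eq_zero] at h0
    exact abs_nonpos_iff.1 h0
  obtain ⟨A, Θ', -, hA, -, hΘ', -, hrange⟩ := h.exists_hasFDerivAt_flow hφ hz 0
  have hid : φ (-0) = id := by ext1 x; simp [hφ.flow.zero]
  rw [hid] at hA hΘ' hrange
  have hA' : A = ContinuousLinearMap.id ℝ R4 := hA.unique (hasFDerivAt_id _)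
  subst hA'
  simp only [id, ContinuousLinearMap.id_apply] at hΘ' hrange
  set a := fderiv ℝ c z (EuclideanSpace.single 0 1) with ha
  set X := hamVF G (c z) with hX
  have hv : ∀ v : R2, v = v 0 • EuclideanSpace.single 0 1 + v 1 • EuclideanSpace.single 1 1 := by
    intro v; ext i; fin_cases i <;> simp
  have haX : omega0 a X = 0 := by
    rw [omega0_neg_swap, hX, omega0_hamVF, neg_neg, ha, h.fderiv_energy hφ.contDiff hz]
  have hker : ∀ v, fderiv ℝ G (c z) v = 0 → omega0 a v = 0 := by
    intro v hv0
    obtain ⟨⟨u, s⟩, rfl⟩ := hrange v hv0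
    rw [hΘ', hv u, ← omegaL_apply]
    have haa : omega0 a a = 0 := by simp [omega0]; ring
    simp only [map_add, map_smul, map_sub, omegaL_apply, hab, haX, smul_eq_mul, ← ha, haa]
    ring
  have hX0 : X ≠ 0 := fun h0 => h.transverse z hz ⟨0, by rw [map_zero]; exact h0.symm⟩
  obtain ⟨n, hn⟩ : ∃ n, fderiv ℝ G (c z) n ≠ 0 := by
    by_contra! hall
    exact hX0 (omega0_eq_zero fun v => by rw [hX, omega0_hamVF, hall, neg_zero])
  -- This is the Lagrange multiplier: a functional vanishing on `ker dG` is determined by its value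
  -- on one vector `n` outside the kernel.
  set l := -(omega0 a n / fderiv ℝ G (c z) n) with hl
  have hal : a = l • X := by
    rw [← sub_eq_zero]
    refine omega0_eq_zero fun v => ?_
    have h1 := hker (v - (fderiv ℝ G (c z) v / fderiv ℝ G (c z) n) • n) (by
      rw [map_sub, map_smul, smul_eq_mul, div_mul_cancel₀ _ hn, sub_self])
    rw [← omegaL_apply, map_sub, map_smul, omegaL_apply, omegaL_apply, sub_eq_zero] at h1
    rw [← omegaL_apply, map_sub, map_smul, sub_apply, smul_apply, omegaL_apply, omegaL_apply, h1,
      hX, omega0_hamVF, hl]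
    simp only [smul_eq_mul]
    ring
  have hl0 : l ≠ 0 := by
    rintro hl0
    rw [hl0, zero_smul] at hal
    have := (injective_iff_map_eq_zero _).1 (h.injective z hz) _ hal
    simpa using congrArg (fun v : R2 => v 0) this
  refine h.transverse z hz ⟨l⁻¹ • EuclideanSpace.single 0 1, ?_⟩
  rw [map_smul, ← ha, hal, smul_smul, inv_mul_cancel₀ hl0, one_smul]

theorem areaMeasure_image_pos (h : IsSection G E c) (hφ : IsHamiltonianFlow G φ) {s : Set R2}
    (hs : IsOpen s) (hsb : s ⊆ Metric.ball 0 1) (hne : s.Nonempty) : 0 < areaMeasure c (c '' s) := by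
  rw [h.areaMeasure_image hs.measurableSet hsb,
    setLIntegral_pos_iff (measurable_areaDensity c)]
  have : Function.support (areaDensity c) ∩ s = s :=
    inter_eq_right.2 fun z hz => h.areaDensity_ne_zero hφ (hsb hz)
  rw [this]
  exact hs.measure_pos volume hne

/-- The parametrization is `C¹` on the closed disk, so by compactness its derivative, and with it
the density, is bounded. -/
theorem areaMeasure_image_ball_lt_top (h : IsSection G E c) :
    areaMeasure c (c '' Metric.ball 0 1) < ⊤ := by
  rw [h.areaMeasure_image measurableSet_ball subset_rfl]
  have hu : UniqueDiffOn ℝ closedDisk := uniqueDiffOn_convex (convex_closedBall _ _)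
    (by rw [closedDisk, interior_closedBall _ one_ne_zero]; exact ⟨0, by simp⟩)
  have hcont : ContinuousOn (fderivWithin ℝ c closedDisk) closedDisk :=
    h.contDiffOn_closedDisk.continuousOn_fderivWithin hu le_rfl
  obtain ⟨C, hC⟩ := (isCompact_closedBall (0 : R2) 1).exists_bound_of_continuousOn hcont
  have hbound : ∀ z ∈ Metric.ball (0 : R2) 1, areaDensity c z ≤ ENNReal.ofReal (‖omegaL‖ * C * C) := by
    intro z hz
    have h1 := hC z (Metric.ball_subset_closedBall hz)
    rw [closedDisk, fderivWithin_of_mem_nhds (Metric.closedBall_mem_nhds_of_mem hz)] at h1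
    have hC0 : 0 ≤ C := (norm_nonneg _).trans h1
    refine ENNReal.ofReal_le_ofReal ?_
    rw [← omegaL_apply, ← Real.norm_eq_abs]
    refine (omegaL.le_opNorm₂ _ _).trans ?_
    have h2 : ∀ i, ‖fderiv ℝ c z (EuclideanSpace.single i 1)‖ ≤ C := fun i => by
      refine ((fderiv ℝ c z).le_opNorm _).trans ?_
      simpa using h1
    gcongr
    · exact h2 0
    · exact h2 1
  refine lt_of_le_of_lt (setLIntegral_mono measurable_const hbound) ?_
  rw [setLIntegral_const]
  exact ENNReal.mul_lt_top ENNReal.ofReal_lt_top measure_ball_lt_top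

end IsSection

end AreaBounds

/-! ### Disks in a plane -/

section Disks

variable {G : R4 → ℝ} {E : ℝ} {c c₁ c₂ : R2 → R4}

/-- Two compact sets with connected, disjoint "boundaries" in a connected noncompact space are
disjoint or strictly nested. -/
theorem disjoint_or_nested {X : Type*} [TopologicalSpace X] [T2Space X] [PreconnectedSpace X]
    [NoncompactSpace X] {b₁ b₂ k₁ k₂ : Set X} (hb₁ : IsCompact b₁) (hb₂ : IsCompact b₂)
    (hk₁ : k₁ ⊆ b₁) (hk₂ : k₂ ⊆ b₂) (ho₁ : IsOpen (b₁ \ k₁)) (ho₂ : IsOpen (b₂ \ k₂))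
    (hc₁ : IsPreconnected k₁) (hc₂ : IsPreconnected k₂) (hne₁ : b₁.Nonempty) (hne₂ : b₂.Nonempty)
    (hk : Disjoint k₁ k₂) :
    Disjoint b₁ b₂ ∨ (b₁ ⊆ b₂ \ k₂ ∧ ((b₂ \ k₂) \ b₁).Nonempty) ∨
      (b₂ ⊆ b₁ \ k₁ ∧ ((b₁ \ k₁) \ b₂).Nonempty) := by
  -- clopen compact sets are empty
  have hclopen : ∀ s : Set X, IsOpen s → IsCompact s → s = ∅ := fun s ho hc => by
    rcases isClopen_iff.1 ⟨hc.isClosed, ho⟩ with h | h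
    · exact h
    · exact absurd (h ▸ hc) (noncompact_univ X)
  -- a connected set that misses `k` lies in `b \ k` or misses `b`
  have hdich : ∀ {b k l : Set X}, IsCompact b → IsOpen (b \ k) → IsPreconnected l → Disjoint l k →
      l ⊆ b \ k ∨ Disjoint l b := by
    intro b k l hb ho hl hlk
    have := hl.subset_or_subset ho hb.isClosed.isOpen_compl
      (disjoint_left.2 fun x hx hx' => hx' hx.1) (fun x hx => ?_)
    · exact this.imp_right fun h => disjoint_left.2 fun x hx => h hx
    · by_cases hxb : x ∈ b
      · exact Or.inl ⟨hxb, disjoint_left.1 hlk hx⟩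
      · exact Or.inr hxb
  have hdiff : ∀ {b k : Set X}, Disjoint k b → b \ k = b := fun h => h.symm.sdiff_eq_left
  -- nested case
  have hnest : ∀ {b b' k k' : Set X}, IsCompact b → IsCompact b' → k ⊆ b → IsOpen (b \ k) →
      IsOpen (b' \ k') → b.Nonempty → k ⊆ b' \ k' → Disjoint k' b →
      b ⊆ b' \ k' ∧ ((b' \ k') \ b).Nonempty := by
    intro b b' k k' hb hb' hk ho ho' hne hkb hkb'
    have hsub : b \ (b' \ k') = ∅ := by
      refine hclopen _ ?_ (hb.diff ho')
      have e : b \ (b' \ k') = (b \ k) ∩ b'ᶜ := by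
        ext x
        constructor
        · rintro ⟨hx, h⟩
          have hxk' : x ∉ k' := fun h' => disjoint_left.1 hkb' h' hx
          have hxb' : x ∉ b' := fun h' => h ⟨h', hxk'⟩
          exact ⟨⟨hx, fun hxk => hxb' (hkb hxk).1⟩, hxb'⟩
        · exact fun ⟨⟨hx, _⟩, h⟩ => ⟨hx, fun h' => h h'.1⟩
      rw [e]
      exact ho.inter hb'.isClosed.isOpen_compl
    have hbb : b ⊆ b' \ k' := sdiff_eq_empty.1 hsub
    refine ⟨hbb, ?_⟩
    by_contra hemp
    rw [not_nonempty_iff_eq_empty, sdiff_eq_empty] at hemp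
    have e : b = b' \ k' := hbb.antisymm hemp
    exact hne.ne_empty (hclopen b (e ▸ ho') hb)
  rcases hdich hb₂ ho₂ hc₁ hk with h1 | h1 <;> rcases hdich hb₁ ho₁ hc₂ hk.symm with h2 | h2
  -- If each boundary lies in the interior of the other set, every point of the union is interior to
  -- one of them, so the union is nonempty, open and compact in a connected noncompact space.
  · exfalso
    have e : b₁ ∪ b₂ = (b₁ \ k₁) ∪ (b₂ \ k₂) := by
      refine Subset.antisymm ?_ (union_subset_union sdiff_subset sdiff_subset)
      rintro x (hx | hx)
      · by_cases hxk : x ∈ k₁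
        · exact Or.inr (h1 hxk)
        · exact Or.inl ⟨hx, hxk⟩
      · by_cases hxk : x ∈ k₂
        · exact Or.inl (h2 hxk)
        · exact Or.inr ⟨hx, hxk⟩
    have := hclopen (b₁ ∪ b₂) (e ▸ ho₁.union ho₂) (hb₁.union hb₂)
    exact (hne₁.mono subset_union_left).ne_empty this
  · exact Or.inr (Or.inl (hnest hb₁ hb₂ hk₁ ho₁ ho₂ hne₁ h1 h2))
  · exact Or.inr (Or.inr (hnest hb₂ hb₁ hk₂ ho₂ ho₁ hne₂ h2 h1))
  -- If each boundary misses the other set, the intersection equals that of the interiors, so it is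
  -- open and compact, hence empty.
  · refine Or.inl (disjoint_iff_inter_eq_empty.2 (hclopen _ ?_ (hb₁.inter hb₂)))
    have e : b₁ ∩ b₂ = (b₁ \ k₁) ∩ (b₂ \ k₂) := by
      ext x
      constructor
      · rintro ⟨hx1, hx2⟩
        exact ⟨⟨hx1, fun h => disjoint_left.1 h1 h hx2⟩, hx2, fun h => disjoint_left.1 h2 h hx1⟩
      · exact fun h => ⟨h.1.1, h.2.1⟩
    rw [e]
    exact ho₁.inter ho₂

/-- `B` is a compact subset of the plane `c '' ball 0 1`, bounded by the connected set `C`. -/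
structure IsPlaneDisk (c : R2 → R4) (B C : Set R4) : Prop where
  subset : B ⊆ c '' Metric.ball 0 1
  isCompact : IsCompact B
  boundary_subset : C ⊆ B
  isPreconnected : IsPreconnected C
  isOpen : ∃ W, IsOpen W ∧ B \ C = c '' Metric.ball 0 1 ∩ W

namespace IsSection

theorem isClosedEmbedding (h : IsSection G E c) :
    IsClosedEmbedding (closedDisk.domRestrict c) := by
  have : CompactSpace closedDisk := isCompact_iff_compactSpace.1 (isCompact_closedBall (0 : R2) 1)
  refine Continuous.isClosedEmbedding
    (continuousOn_iff_continuous_domRestrict.1 h.contDiffOn_closedDisk.continuousOn) ?_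
  exact injOn_iff_injective.1 h.injOn

theorem disjoint_image_sphere (h : IsSection G E c) :
    Disjoint (c '' Metric.ball 0 1) (c '' Metric.sphere 0 1) :=
  (Metric.sphere_disjoint_ball.symm).image h.injOn Metric.ball_subset_closedBall
    Metric.sphere_subset_closedBall

/-- Images of open sets are relatively open. -/
theorem exists_isOpen_image_eq (h : IsSection G E c) {V : Set R2} (hV : IsOpen V)
    (hVb : V ⊆ Metric.ball 0 1) : ∃ W, IsOpen W ∧ c '' V = c '' Metric.ball 0 1 ∩ W := by
  have hcpt : IsCompact (c '' (closedDisk \ V)) :=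
    ((isCompact_closedBall (0 : R2) 1).diff hV).image_of_continuousOn
      (h.contDiffOn_closedDisk.continuousOn.mono sdiff_subset)
  refine ⟨(c '' (closedDisk \ V))ᶜ, hcpt.isClosed.isOpen_compl, ?_⟩
  ext x
  constructor
  · rintro ⟨z, hz, rfl⟩
    refine ⟨mem_image_of_mem c (hVb hz), ?_⟩
    rintro ⟨w, ⟨hw, hwV⟩, e⟩
    exact hwV (h.injOn hw (Metric.ball_subset_closedBall (hVb hz)) e ▸ hz)
  · rintro ⟨⟨z, hz, rfl⟩, hx⟩
    refine mem_image_of_mem c ?_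
    by_contra hzV
    exact hx ⟨z, ⟨Metric.ball_subset_closedBall hz, hzV⟩, rfl⟩

theorem isOpen_preimage (h : IsSection G E c) {A W : Set R4} (hW : IsOpen W)
    (hA : A = c '' Metric.ball 0 1 ∩ W) : IsOpen (Metric.ball 0 1 ∩ c ⁻¹' A) := by
  have : Metric.ball 0 1 ∩ c ⁻¹' A = Metric.ball 0 1 ∩ c ⁻¹' W := by
    rw [hA]
    ext z
    exact ⟨fun hz => ⟨hz.1, hz.2.2⟩, fun hz => ⟨hz.1, mem_image_of_mem c hz.1, hz.2⟩⟩
  rw [this]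
  exact h.continuousOn_ball.isOpen_inter_preimage Metric.isOpen_ball hW

theorem isCompact_preimage (h : IsSection G E c) {B : Set R4} (hB : IsCompact B)
    (hBc : B ⊆ c '' Metric.ball 0 1) : IsCompact (Metric.ball 0 1 ∩ c ⁻¹' B) := by
  have h1 := (h.isClosedEmbedding.isCompact_preimage hB).image continuous_subtype_val
  convert h1 using 1
  ext z
  simp only [mem_inter_iff, mem_preimage, mem_image, Subtype.exists, domRestrict_apply, exists_and_left,
    exists_prop, exists_eq_right_right]
  constructor
  · exact fun hz => ⟨hz.2, Metric.ball_subset_closedBall hz.1⟩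
  · rintro ⟨hz, hzb⟩
    obtain ⟨w, hw, e⟩ := hBc hz
    rw [← h.injOn (Metric.ball_subset_closedBall hw) hzb e]
    exact ⟨hw, e ▸ hz⟩

/-- The parametrization is a closed embedding of the closed disk, so connectedness passes back
through it. -/
theorem isPreconnected_preimage (h : IsSection G E c) {C : Set R4} (hC : IsPreconnected C)
    (hCc : C ⊆ c '' Metric.ball 0 1) : IsPreconnected (Metric.ball 0 1 ∩ c ⁻¹' C) := by
  have hC' : IsPreconnected (closedDisk.domRestrict c '' (Subtype.val ⁻¹' (Metric.ball 0 1 ∩ c ⁻¹' C))) := by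
    convert hC using 1
    ext x
    simp only [mem_image, mem_preimage, Subtype.exists, domRestrict_apply, mem_inter_iff]
    constructor
    · rintro ⟨z, hz, ⟨-, hx⟩, rfl⟩
      exact hx
    · intro hx
      obtain ⟨z, hz, rfl⟩ := hCc hx
      exact ⟨z, Metric.ball_subset_closedBall hz, ⟨hz, hx⟩, rfl⟩
  rw [h.isClosedEmbedding.isInducing.isPreconnected_image] at hC'
  have := hC'.image Subtype.val continuous_subtype_val.continuousOn
  rwa [Subtype.image_preimage_coe, inter_eq_right.2] at this
  exact inter_subset_left.trans Metric.ball_subset_closedBall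

/-- Disks of the same area in a plane, with disjoint boundaries, are disjoint. -/
theorem disjoint_of_areaMeasure_eq {φ : ℝ → R4 → R4} (h : IsSection G E c)
    (hφ : IsHamiltonianFlow G φ) {B₁ B₂ C₁ C₂ : Set R4}
    (h₁ : IsPlaneDisk c B₁ C₁) (h₂ : IsPlaneDisk c B₂ C₂) (hne₁ : B₁.Nonempty) (hne₂ : B₂.Nonempty)
    (harea : areaMeasure c (B₁ \ C₁) = areaMeasure c (B₂ \ C₂)) (hC : Disjoint C₁ C₂) :
    Disjoint B₁ B₂ := by
  have hpre : ∀ {B C : Set R4}, IsPlaneDisk c B C → B.Nonempty →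
      (Metric.ball 0 1 ∩ c ⁻¹' B).Nonempty := by
    rintro B C hB ⟨x, hx⟩
    obtain ⟨z, hz, rfl⟩ := hB.subset hx
    exact ⟨z, hz, hx⟩
  have hdiff : ∀ B C : Set R4, (Metric.ball 0 1 ∩ c ⁻¹' B) \ (Metric.ball 0 1 ∩ c ⁻¹' C) =
      Metric.ball 0 1 ∩ c ⁻¹' (B \ C) := by
    
    intro B C
    ext z
    exact ⟨fun hz => ⟨hz.1.1, hz.1.2, fun h => hz.2 ⟨hz.1.1, h⟩⟩,
      fun hz => ⟨⟨hz.1, hz.2.1⟩, fun h => hz.2.2 h.2⟩⟩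
  have hopen : ∀ {B C : Set R4}, IsPlaneDisk c B C → IsOpen
      ((Metric.ball 0 1 ∩ c ⁻¹' B) \ (Metric.ball 0 1 ∩ c ⁻¹' C)) := by
    intro B C hB
    obtain ⟨W, hW, e⟩ := hB.isOpen
    rw [hdiff]
    exact h.isOpen_preimage hW e
  -- Strict nesting leaves a nonempty open gap `s` between the disks, of positive area, which
  -- contradicts equality of the areas.
  have hne : ∀ {B₁ B₂ C₁ C₂ : Set R4}, IsPlaneDisk c B₁ C₁ → IsPlaneDisk c B₂ C₂ →
      areaMeasure c (B₁ \ C₁) = areaMeasure c (B₂ \ C₂) →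
      (Metric.ball 0 1 ∩ c ⁻¹' B₁) ⊆ (Metric.ball 0 1 ∩ c ⁻¹' B₂) \ (Metric.ball 0 1 ∩ c ⁻¹' C₂) →
      (((Metric.ball 0 1 ∩ c ⁻¹' B₂) \ (Metric.ball 0 1 ∩ c ⁻¹' C₂)) \
        (Metric.ball 0 1 ∩ c ⁻¹' B₁)).Nonempty → False := by
    intro B₁ B₂ C₁ C₂ h₁ h₂ harea hsub hne
    set s := ((Metric.ball 0 1 ∩ c ⁻¹' B₂) \ (Metric.ball 0 1 ∩ c ⁻¹' C₂)) \
        (Metric.ball 0 1 ∩ c ⁻¹' B₁) with hs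
    have hsb : s ⊆ Metric.ball 0 1 := fun z hz => hz.1.1.1
    have hso : IsOpen s := (hopen h₂).sdiff (h.isCompact_preimage h₁.isCompact h₁.subset).isClosed
    have hpos := h.areaMeasure_image_pos hφ hso hsb hne
    have hB₁ : B₁ ⊆ B₂ \ C₂ := by
      intro x hx
      obtain ⟨z, hz, rfl⟩ := h₁.subset hx
      have := hsub ⟨hz, hx⟩
      rw [hdiff] at this
      exact this.2
    have hdis : Disjoint B₁ (c '' s) := by
      rw [disjoint_right]
      rintro _ ⟨z, hz, rfl⟩ hx
      exact hz.2 ⟨hsb hz, hx⟩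
    have hun : B₁ ∪ c '' s ⊆ B₂ \ C₂ := by
      refine union_subset hB₁ ?_
      rintro _ ⟨z, hz, rfl⟩
      have := hz.1
      rw [hdiff] at this
      exact this.2
    -- The whole of `B₁`, boundary included, lies in `B₂ \ C₂`. So this comparison of the interiors
    -- does not depend on whether the boundary curves have area zero.
    have hle : areaMeasure c (B₁ \ C₁) + areaMeasure c (c '' s) ≤ areaMeasure c (B₁ \ C₁) :=
      calc _ ≤ areaMeasure c B₁ + areaMeasure c (c '' s) :=
            add_le_add_left (MeasureTheory.measure_mono sdiff_subset) _
        _ = areaMeasure c (B₁ ∪ c '' s) :=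
            (MeasureTheory.measure_union hdis (h.measurableSet_image hso.measurableSet hsb)).symm
        _ ≤ areaMeasure c (B₂ \ C₂) := MeasureTheory.measure_mono hun
        _ = _ := harea.symm
    have hfin : areaMeasure c (B₁ \ C₁) ≠ ⊤ :=
      ((MeasureTheory.measure_mono (sdiff_subset.trans h₁.subset)).trans_lt
        h.areaMeasure_image_ball_lt_top).ne
    exact hpos.ne' (nonpos_iff_eq_zero.1 ((ENNReal.add_le_add_iff_left hfin).1 (by simpa using hle)))
  have hmain := disjoint_or_nested (h.isCompact_preimage h₁.isCompact h₁.subset)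
    (h.isCompact_preimage h₂.isCompact h₂.subset)
    (inter_subset_inter_right _ (preimage_mono h₁.boundary_subset))
    (inter_subset_inter_right _ (preimage_mono h₂.boundary_subset)) (hopen h₁) (hopen h₂)
    (h.isPreconnected_preimage h₁.isPreconnected (h₁.boundary_subset.trans h₁.subset))
    (h.isPreconnected_preimage h₂.isPreconnected (h₂.boundary_subset.trans h₂.subset))
    (hpre h₁ hne₁) (hpre h₂ hne₂)
    (disjoint_left.2 fun z hz hz' => disjoint_left.1 hC hz.2 hz'.2)
  rcases hmain with hd | ⟨hsub, hn⟩ | ⟨hsub, hn⟩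
  · rw [disjoint_left]
    intro x hx hx'
    obtain ⟨z, hz, rfl⟩ := h₁.subset hx
    exact disjoint_left.1 hd ⟨hz, hx⟩ ⟨hz, hx'⟩
  · exact (hne h₁ h₂ harea hsub hn).elim
  · exact (hne h₂ h₁ harea.symm hsub hn).elim

end IsSection

end Disks

/-! ### Disks bounded by circles in a plane, their images, and the iteration argument. -/

section PlaneDisks

variable {G : R4 → ℝ} {E : ℝ} {c c₁ c₂ : R2 → R4}

/-- In polar coordinates the annulus is the image of an interval times the unit circle, which is
connected because the plane has dimension greater than one. -/
theorem isPreconnected_annulus {r : ℝ} (hr : 0 ≤ r) :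
    IsPreconnected {z : R2 | r < ‖z‖ ∧ ‖z‖ < 1} := by
  have hrank : 1 < Module.rank ℝ R2 := by
    rw [← Module.finrank_eq_rank, finrank_euclideanSpace_fin]
    exact_mod_cast one_lt_two
  have h := ((isPreconnected_Ioo (a := r) (b := 1)).prod
    (isPreconnected_sphere hrank (0 : R2) 1)).image (fun p : ℝ × R2 => p.1 • p.2)
    (continuous_fst.smul continuous_snd).continuousOn
  convert h using 1
  ext z
  simp only [mem_ofPred_eq, mem_image, mem_prod, mem_Ioo, mem_sphere_zero_iff_norm, Prod.exists]
  constructor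
  · rintro ⟨h1, h2⟩
    have hz : ‖z‖ ≠ 0 := (hr.trans_lt h1).ne'
    exact ⟨‖z‖, ‖z‖⁻¹ • z, ⟨⟨h1, h2⟩, by rw [norm_smul, norm_inv, norm_norm, inv_mul_cancel₀ hz]⟩,
      by rw [smul_smul, mul_inv_cancel₀ hz, one_smul]⟩
  · rintro ⟨s, v, ⟨⟨h1, h2⟩, hv⟩, rfl⟩
    rw [norm_smul, hv, mul_one, Real.norm_of_nonneg (hr.trans h1.le)]
    exact ⟨h1, h2⟩

/-- The disk bounded by a compact connected subset of a plane is compact and has open interior. -/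
theorem IsSection.isPlaneDisk_boundedDisk (h : IsSection G E c) {C : Set R4} (hC : IsCompact C)
    (hCc : IsPreconnected C) (hCF : C ⊆ c '' Metric.ball 0 1) :
    IsPlaneDisk c (boundedDisk (c '' Metric.ball 0 1) C) C := by
  set F := c '' Metric.ball 0 1 with hF
  set k := Metric.ball 0 1 ∩ c ⁻¹' C with hk
  have hkc : IsCompact k := h.isCompact_preimage hC hCF
  set O := Metric.ball 0 1 \ k with hO
  have hOo : IsOpen O := Metric.isOpen_ball.sdiff hkc.isClosed
  have hOb : O ⊆ Metric.ball 0 1 := sdiff_subset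
  have hOF : ∀ z ∈ O, c z ∈ F \ C := fun z hz =>
    ⟨mem_image_of_mem c hz.1, fun hzC => hz.2 ⟨hz.1, hzC⟩⟩
  -- components of points that are joined by a connected set
  have hcomp : ∀ U ⊆ O, IsPreconnected U → ∀ z ∈ U,
      c '' U ⊆ connectedComponentIn (F \ C) (c z) := fun U hU hUc z hz =>
    (hUc.image c (h.continuousOn_ball.mono (hU.trans hOb))).subset_connectedComponentIn
      (mem_image_of_mem c hz) (image_subset_iff.2 fun w hw => hOF w (hU hw))
  have hcomp' : ∀ U ⊆ O, IsPreconnected U → ∀ z ∈ U, ∀ w ∈ U,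
      connectedComponentIn (F \ C) (c z) = connectedComponentIn (F \ C) (c w) :=
    fun U hU hUc z hz w hw => connectedComponentIn_eq (hcomp U hU hUc z hz (mem_image_of_mem c hw))
  have hloc : ∀ z ∈ O, ∀ᶠ w in 𝓝 z, w ∈ O ∧
      connectedComponentIn (F \ C) (c z) = connectedComponentIn (F \ C) (c w) := by
    intro z hz
    obtain ⟨ε, hε, hball⟩ := Metric.isOpen_iff.1 hOo z hz
    filter_upwards [Metric.ball_mem_nhds z hε] with w hw
    exact ⟨hball hw, hcomp' _ hball (convex_ball z ε).isPreconnected z (Metric.mem_ball_self hε) w hw⟩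
  -- Components are locally constant on the open set `O`, so `V` and its complement in `O` are both
  -- open. Openness of `V` gives the interior of the disk, openness of `O \ V` its compactness.
  set V := {z | z ∈ O ∧ closure (connectedComponentIn (F \ C) (c z)) ⊆ F} with hV
  have hVo : IsOpen V := isOpen_iff_mem_nhds.2 fun z hz => by
    filter_upwards [hloc z hz.1] with w hw
    exact ⟨hw.1, hw.2 ▸ hz.2⟩
  have hVo' : IsOpen (O \ V) := isOpen_iff_mem_nhds.2 fun z hz => by
    filter_upwards [hloc z hz.1] with w hw
    exact ⟨hw.1, fun hwV => hz.2 ⟨hz.1, hw.2 ▸ hwV.2⟩⟩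
  have hBC : boundedDisk F C \ C = c '' V := by
    ext x
    constructor
    · rintro ⟨hx | ⟨⟨⟨z, hz, rfl⟩, hzC⟩, hx⟩, hxC⟩
      · exact absurd hx hxC
      · exact mem_image_of_mem c ⟨⟨hz, fun hzk => hzC hzk.2⟩, hx⟩
    · rintro ⟨z, hz, rfl⟩
      exact ⟨Or.inr ⟨hOF z hz.1, hz.2⟩, (hOF z hz.1).2⟩
  have hB : boundedDisk F C = c '' (k ∪ V) := by
    have hCk : c '' k = C := image_preimage C hCF
    rw [image_union, hCk, ← hBC, union_sdiff_cancel]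
    exact subset_union_left
  -- the disk stays away from the boundary of the plane
  obtain ⟨r, hr0, hr1, hkr⟩ : ∃ r : ℝ, 0 ≤ r ∧ r < 1 ∧ k ⊆ Metric.closedBall 0 r := by
    rcases k.eq_empty_or_nonempty with hke | hkn
    · exact ⟨0, le_rfl, one_pos, by simp [hke]⟩
    · obtain ⟨z, hz, hmax⟩ := hkc.exists_isMaxOn hkn continuous_norm.continuousOn
      exact ⟨‖z‖, norm_nonneg z, mem_ball_zero_iff.1 hz.1, fun w hw => mem_closedBall_zero_iff.2 (hmax hw)⟩
  have hVr : V ⊆ Metric.closedBall 0 r := by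
    intro z hz
    rw [mem_closedBall_zero_iff]
    by_contra! hzr
    -- This outer annulus is connected and misses the curve, so it lies in a single component. The
    -- radial limit `v` on the unit circle puts a point of the boundary of the plane into the
    -- closure of that component, which is therefore not contained in `F`.
    set U := {z : R2 | r < ‖z‖ ∧ ‖z‖ < 1} with hU
    have hUO : U ⊆ O := fun w hw => ⟨mem_ball_zero_iff.2 hw.2, fun hwk =>
      absurd (mem_closedBall_zero_iff.1 (hkr hwk)) hw.1.not_ge⟩
    have hzU : z ∈ U := ⟨hzr, mem_ball_zero_iff.1 (hOb hz.1)⟩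
    have h1 := hcomp U hUO (isPreconnected_annulus hr0) z hzU
    have hz0 : ‖z‖ ≠ 0 := (hr0.trans_lt hzr).ne'
    set v := ‖z‖⁻¹ • z with hv
    have hv1 : ‖v‖ = 1 := by rw [hv, norm_smul, norm_inv, norm_norm, inv_mul_cancel₀ hz0]
    have hvU : v ∈ closure U := by
      have ht : Tendsto (fun s : ℝ => s • v) (𝓝[<] 1) (𝓝 v) := by
        have : Continuous fun s : ℝ => s • v := continuous_id.smul continuous_const
        simpa using (this.tendsto 1).mono_left nhdsWithin_le_nhds
      refine mem_closure_of_tendsto ht ?_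
      filter_upwards [Ioo_mem_nhdsLT hr1] with s hs
      have : ‖s • v‖ = s := by rw [norm_smul, hv1, mul_one, Real.norm_of_nonneg (hr0.trans hs.1.le)]
      exact ⟨this.symm ▸ hs.1, this.symm ▸ hs.2⟩
    have hvc : c v ∈ closure (c '' U) := by
      have hvd : v ∈ closedDisk := mem_closedBall_zero_iff.2 hv1.le
      have : ContinuousWithinAt c U v := (h.contDiffOn_closedDisk.continuousOn v hvd).mono
        ((hUO.trans hOb).trans Metric.ball_subset_closedBall)
      exact this.mem_closure_image hvU
    have hvF : c v ∈ F := hz.2 (closure_mono h1 hvc)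
    exact disjoint_left.1 h.disjoint_image_sphere hvF
      (mem_image_of_mem c (mem_sphere_zero_iff_norm.2 hv1))
  have hkV : k ∪ V = Metric.closedBall 0 r \ (O \ V) := by
    ext z
    constructor
    · rintro (hz | hz)
      · exact ⟨hkr hz, fun h' => h'.1.2 hz⟩
      · exact ⟨hVr hz, fun h' => h'.2 hz⟩
    · rintro ⟨hz, hz'⟩
      by_cases hzk : z ∈ k
      · exact Or.inl hzk
      · by_contra hn
        exact hz' ⟨⟨Metric.closedBall_subset_ball hr1 hz, hzk⟩, fun h' => hn (Or.inr h')⟩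
  have hkVb : k ∪ V ⊆ Metric.ball 0 1 := union_subset inter_subset_left fun z hz => hOb hz.1
  refine ⟨?_, ?_, subset_union_left, hCc, ?_⟩
  · rw [hB]
    exact image_mono hkVb
  · rw [hB]
    refine IsCompact.image_of_continuousOn ?_ (h.continuousOn_ball.mono hkVb)
    rw [hkV]
    exact (isCompact_closedBall _ _).diff hVo'
  · rw [hBC]
    exact h.exists_isOpen_image_eq hVo fun z hz => hOb hz.1

/-- `Ψ` restricts to a homeomorphism of `A` onto `B`. -/
def IsHomeoOn (Ψ : R4 → R4) (A B : Set R4) : Prop := ∃ e : A ≃ₜ B, ∀ x : A, (e x : R4) = Ψ x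

namespace IsHomeoOn

variable {Ψ : R4 → R4} {A B : Set R4}

theorem injOn (h : IsHomeoOn Ψ A B) : InjOn Ψ A := by
  obtain ⟨e, he⟩ := h
  intro x hx y hy hxy
  have : e ⟨x, hx⟩ = e ⟨y, hy⟩ := Subtype.ext (by rw [he, he]; exact hxy)
  exact congrArg Subtype.val (e.injective this)

theorem mapsTo (h : IsHomeoOn Ψ A B) : MapsTo Ψ A B := by
  obtain ⟨e, he⟩ := h
  intro x hx
  rw [← he ⟨x, hx⟩]
  exact (e ⟨x, hx⟩).2

theorem continuousOn (h : IsHomeoOn Ψ A B) : ContinuousOn Ψ A := by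
  obtain ⟨e, he⟩ := h
  rw [continuousOn_iff_continuous_domRestrict]
  exact (continuous_subtype_val.comp e.continuous).congr he

theorem exists_isOpen_image (h : IsHomeoOn Ψ A B) {W : Set R4} (hW : IsOpen W) :
    ∃ W', IsOpen W' ∧ Ψ '' (A ∩ W) = B ∩ W' := by
  obtain ⟨e, he⟩ := h
  obtain ⟨W', hW', h'⟩ := isOpen_induced_iff.1 (e.isOpenMap _ (hW.preimage continuous_subtype_val))
  refine ⟨W', hW', ?_⟩
  ext y
  constructor
  · rintro ⟨x, ⟨hx, hxW⟩, rfl⟩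
    rw [← he ⟨x, hx⟩]
    have : e ⟨x, hx⟩ ∈ Subtype.val ⁻¹' W' := h' ▸ mem_image_of_mem e hxW
    exact ⟨(e ⟨x, hx⟩).2, this⟩
  · rintro ⟨hy, hyW⟩
    have : (⟨y, hy⟩ : B) ∈ Subtype.val ⁻¹' W' := hyW
    rw [h'] at this
    obtain ⟨x, hxW, hx⟩ := this
    exact ⟨x, ⟨x.2, hxW⟩, by rw [← he, hx]⟩

end IsHomeoOn

/-- Homeomorphisms between open subsets of planes send disks to disks. -/
theorem IsPlaneDisk.image {B C A A' : Set R4} (h : IsPlaneDisk c₁ B C)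
    (hA : A ⊆ c₁ '' Metric.ball 0 1) (hBA : B ⊆ A) {W : Set R4} (hW : IsOpen W)
    (hA' : A' = c₂ '' Metric.ball 0 1 ∩ W) {Ψ : R4 → R4} (hΨ : IsHomeoOn Ψ A A') :
    IsPlaneDisk c₂ (Ψ '' B) (Ψ '' C) where
  subset := by
    rintro _ ⟨x, hx, rfl⟩
    have := hΨ.mapsTo (hBA hx)
    rw [hA'] at this
    exact this.1
  isCompact := h.isCompact.image_of_continuousOn (hΨ.continuousOn.mono hBA)
  boundary_subset := image_mono h.boundary_subset
  isPreconnected := h.isPreconnected.image Ψ (hΨ.continuousOn.mono (h.boundary_subset.trans hBA))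
  isOpen := by
    obtain ⟨U, hU, e⟩ := h.isOpen
    have e' : B \ C = A ∩ U := by
      refine Subset.antisymm (fun x hx => ⟨hBA hx.1, ?_⟩) fun x hx => ?_
      · rw [e] at hx
        exact hx.2
      · rw [e]
        exact ⟨hA hx.1, hx.2⟩
    obtain ⟨U', hU', e''⟩ := hΨ.exists_isOpen_image hU
    refine ⟨W ∩ U', hW.inter hU', ?_⟩
    rw [← (hΨ.injOn.mono hBA).image_sdiff_subset h.boundary_subset, e', e'', hA', inter_assoc]

open MeasureTheory in
/-- Iterates of area-preserving transition maps between two planes of finite area: the image of the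
circle `Cu` eventually meets `Cs`. -/
theorem exists_iterate_inter_nonempty {φ : ℝ → R4 → R4} (hφ : IsHamiltonianFlow G φ)
    (h₁ : IsSection G E c₁) (h₂ : IsSection G E c₂) {Bu Cu Bs Cs : Set R4}
    (hu : IsPlaneDisk c₁ Bu Cu) (hs : IsPlaneDisk c₂ Bs Cs)
    {Ψg Ψl : R4 → R4} (hg : IsHomeoOn Ψg (c₁ '' Metric.ball 0 1) (c₂ '' Metric.ball 0 1))
    (hl : IsHomeoOn Ψl (c₂ '' Metric.ball 0 1 \ Bs) (c₁ '' Metric.ball 0 1 \ Bu))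
    (hga : ∀ A, MeasurableSet A → A ⊆ c₁ '' Metric.ball 0 1 →
      areaMeasure c₁ A = areaMeasure c₂ (Ψg '' A))
    (hla : ∀ A, MeasurableSet A → A ⊆ c₂ '' Metric.ball 0 1 \ Bs →
      areaMeasure c₂ A = areaMeasure c₁ (Ψl '' A))
    (harea : areaMeasure c₁ (Bu \ Cu) = areaMeasure c₂ (Bs \ Cs))
    (hpos : areaMeasure c₁ (Bu \ Cu) ≠ 0) :
    ∃ N : ℕ, 1 ≤ N ∧
      (∀ x ∈ Cu, ∀ j : ℕ, j < N - 1 → (Ψg ∘ Ψl)^[j] (Ψg x) ∈ c₂ '' Metric.ball 0 1 \ Bs) ∧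
      (((Ψg ∘ Ψl)^[N - 1] ∘ Ψg) '' Cu ∩ Cs).Nonempty := by
  by_contra hcon
  push Not at hcon
  set F₁ := c₁ '' Metric.ball 0 1
  set F₂ := c₂ '' Metric.ball 0 1
  set f := Ψg ∘ Ψl with hf
  -- `B n` and `C n` are the successive images of the disk and of its boundary in the second plane.
  set B : ℕ → Set R4 := fun n => (f^[n] ∘ Ψg) '' Bu with hBdef
  set C : ℕ → Set R4 := fun n => (f^[n] ∘ Ψg) '' Cu with hCdef
  have hsucc : ∀ (n : ℕ) (X : Set R4), (f^[n + 1] ∘ Ψg) '' X = Ψg '' (Ψl '' ((f^[n] ∘ Ψg) '' X)) := by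
    intro n X
    rw [Function.iterate_succ', image_image, image_image]
    simp only [Function.comp_apply, hf]
  have hne : ∀ {b c : R2 → R4} {B C : Set R4}, IsPlaneDisk b B C → areaMeasure c (B \ C) ≠ 0 →
      B.Nonempty := by
    intro b c B C _ h0
    by_contra hemp
    rw [not_nonempty_iff_eq_empty] at hemp
    rw [hemp, empty_sdiff, measure_empty] at h0
    exact h0 rfl
  have hmeas : ∀ {B C : Set R4}, IsPlaneDisk c₂ B C → MeasurableSet (B \ C) := by
    intro B C h
    obtain ⟨W, hW, e⟩ := h.isOpen
    rw [e]
    exact (h₂.measurableSet_image measurableSet_ball subset_rfl).inter hW.measurableSet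
  have hmeas₁ : ∀ {B C : Set R4}, IsPlaneDisk c₁ B C → MeasurableSet (B \ C) := by
    intro B C h
    obtain ⟨W, hW, e⟩ := h.isOpen
    rw [e]
    exact (h₁.measurableSet_image measurableSet_ball subset_rfl).inter hW.measurableSet
  have hflinj : InjOn Ψl (F₂ \ Bs) := hl.injOn
  -- The last clause runs over `j < n` only: it makes the iterates up to `B n` meaningful, and the
  -- inductive step adds `B n` itself.
  have key : ∀ n, IsPlaneDisk c₂ (B n) (C n) ∧
      areaMeasure c₂ (B n \ C n) = areaMeasure c₁ (Bu \ Cu) ∧ ∀ j < n, B j ⊆ F₂ \ Bs := by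
    intro n
    induction n with
    | zero =>
      refine ⟨?_, ?_, by simp⟩
      · exact hu.image subset_rfl hu.subset isOpen_univ (inter_univ _).symm hg
      · simp only [hBdef, hCdef, Function.iterate_zero, Function.id_comp]
        rw [← (hg.injOn.mono hu.subset).image_sdiff_subset hu.boundary_subset]
        exact (hga _ (hmeas₁ hu) (sdiff_subset.trans hu.subset)).symm
    | succ n ih =>
      obtain ⟨hd, ha, hj⟩ := ih
      -- The contrary hypothesis is used with `N = n + 1`, so that the iterate `N - 1` is `n`.
      have hCC : Disjoint (C n) Cs := by
        rw [disjoint_iff_inter_eq_empty]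
        refine hcon (n + 1) (by omega) fun x hx j hjn => ?_
        exact hj j (by omega) ⟨x, hu.boundary_subset hx, rfl⟩
      have hBB : Disjoint (B n) Bs := h₂.disjoint_of_areaMeasure_eq hφ hd hs
        (hne hd (c := c₂) (ha ▸ hpos)) (hne hs (c := c₂) (harea ▸ hpos)) (ha.trans harea) hCC
      have hBn : B n ⊆ F₂ \ Bs := fun x hx => ⟨hd.subset hx, fun hx' => disjoint_left.1 hBB hx hx'⟩
      have hd₁ : IsPlaneDisk c₁ (Ψl '' B n) (Ψl '' C n) :=
        hd.image sdiff_subset hBn hu.isCompact.isClosed.isOpen_compl (sdiff_eq _ _) hl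
      have hd₂ : IsPlaneDisk c₂ (Ψg '' (Ψl '' B n)) (Ψg '' (Ψl '' C n)) :=
        hd₁.image subset_rfl hd₁.subset isOpen_univ (inter_univ _).symm hg
      have e1 : B (n + 1) = Ψg '' (Ψl '' B n) := hsucc n Bu
      have e2 : C (n + 1) = Ψg '' (Ψl '' C n) := hsucc n Cu
      refine ⟨by rw [e1, e2]; exact hd₂, ?_, fun j hj' => ?_⟩
      · rw [e1, e2, ← (hg.injOn.mono hd₁.subset).image_sdiff_subset hd₁.boundary_subset,
          ← hga _ (hmeas₁ hd₁) (sdiff_subset.trans hd₁.subset),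
          ← (hl.injOn.mono hBn).image_sdiff_subset hd.boundary_subset,
          ← hla _ (hmeas hd) (sdiff_subset.trans hBn), ha]
      · rcases Nat.lt_succ_iff_lt_or_eq.1 hj' with h' | rfl
        · exact hj j h'
        · exact hBn
  have hB : ∀ n, B n ⊆ F₂ \ Bs := fun n => (key (n + 1)).2.2 n n.lt_succ_self
  -- `B 0` is disjoint from every later disk because `Ψl` takes values outside `Bu`; the other pairs
  -- follow by applying the injective maps `Ψl` and `Ψg`.
  have hdisj : ∀ m n, m < n → Disjoint (B m) (B n) := by
    intro m
    induction m with
    | zero =>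
      intro n hn
      obtain ⟨n, rfl⟩ := Nat.exists_eq_succ_of_ne_zero hn.ne'
      have e1 : B (n + 1) = Ψg '' (Ψl '' B n) := hsucc n Bu
      have e0 : B 0 = Ψg '' Bu := rfl
      rw [Nat.succ_eq_add_one, e1, e0]
      have hsub : Ψl '' B n ⊆ F₁ \ Bu := (hl.mapsTo.mono_left (hB n)).image_subset
      refine Disjoint.image ?_ hg.injOn hu.subset (hsub.trans sdiff_subset)
      exact disjoint_left.2 fun x hx hx' => (hsub hx').2 hx
    | succ m ih =>
      intro n hn
      obtain ⟨n, rfl⟩ := Nat.exists_eq_succ_of_ne_zero (by omega : n ≠ 0)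
      have e1 : B (n + 1) = Ψg '' (Ψl '' B n) := hsucc n Bu
      have e2 : B (m + 1) = Ψg '' (Ψl '' B m) := hsucc m Bu
      rw [Nat.succ_eq_add_one, e1, e2]
      have hsub : ∀ n, Ψl '' B n ⊆ F₁ := fun n =>
        ((hl.mapsTo.mono_left (hB n)).image_subset).trans sdiff_subset
      exact ((ih n (by omega)).image hl.injOn (hB m) (hB n)).image hg.injOn (hsub m) (hsub n)
  have hun : areaMeasure c₂ (⋃ n, B n \ C n) = ⊤ := by
    rw [measure_iUnion]
    · simp only [fun n => (key n).2.1]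
      exact ENNReal.tsum_const_eq_top_of_ne_zero hpos
    · intro m n hmn
      rcases lt_or_gt_of_ne hmn with h' | h'
      · exact (hdisj m n h').mono sdiff_subset sdiff_subset
      · exact ((hdisj n m h').mono sdiff_subset sdiff_subset).symm
    · exact fun n => hmeas (key n).1
  have hle : areaMeasure c₂ (⋃ n, B n \ C n) ≤ areaMeasure c₂ F₂ :=
    measure_mono (iUnion_subset fun n => (sdiff_subset.trans (hB n)).trans sdiff_subset)
  rw [hun] at hle
  exact absurd h₂.areaMeasure_image_ball_lt_top (not_lt.2 hle)

end PlaneDisks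

/-! ### Dynamics and symmetry in Moser's coordinates. -/

section Chart

theorem isOpen_polydisk (r : ℝ) : IsOpen (polydisk r) := by
  have hc : ∀ i : Fin 4, Continuous fun z : R4 => z i := fun i =>
    (EuclideanSpace.proj (𝕜 := ℝ) i).continuous
  exact (isOpen_lt (hc 0).abs continuous_const).inter ((isOpen_lt (hc 2).abs continuous_const).inter
    (isOpen_lt (((hc 1).pow 2).add ((hc 3).pow 2)) continuous_const))

/-- The linear symplectic involution that exchanges the two hemispheres. -/
noncomputable def hemiSwap : R4 →L[ℝ] R4 :=
  LinearMap.toContinuousLinearMap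
    { toFun := fun z => !₂[-z 0, z 1, -z 2, z 3]
      map_add' := fun u v => by ext i; fin_cases i <;> simp <;> ring
      map_smul' := fun a u => by ext i; fin_cases i <;> simp }

theorem hemiSwap_apply (z : R4) : hemiSwap z = !₂[-z 0, z 1, -z 2, z 3] := rfl

theorem hemiSwap_hemiSwap (z : R4) : hemiSwap (hemiSwap z) = z := by
  ext i; fin_cases i <;> simp [hemiSwap_apply]

theorem omega0_hemiSwap (u v : R4) : omega0 (hemiSwap u) (hemiSwap v) = omega0 u v := by
  simp [omega0, hemiSwap_apply]

theorem hemiSwap_mem_polydisk {r : ℝ} {z : R4} (hz : z ∈ polydisk r) : hemiSwap z ∈ polydisk r := by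
  simpa [polydisk, hemiSwap_apply] using hz

/-- The flow of the integrable Hamiltonian with frequencies `-l` and `m`. -/
noncomputable def integrableFlow (l m : ℝ) (z : R4) (t : ℝ) : R4 :=
  !₂[z 0 * Real.exp (-(l * t)), z 1 * Real.cos (m * t) + z 3 * Real.sin (m * t),
    z 2 * Real.exp (l * t), z 3 * Real.cos (m * t) - z 1 * Real.sin (m * t)]

theorem integrableFlow_zero (l m : ℝ) (z : R4) : integrableFlow l m z 0 = z := by
  ext i; fin_cases i <;> simp [integrableFlow]

theorem act1_integrableFlow (l m : ℝ) (z : R4) (t : ℝ) :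
    act1 (integrableFlow l m z t) = act1 z := by
  have h : Real.exp (-(l * t)) * Real.exp (l * t) = 1 := by rw [← Real.exp_add]; simp
  simp only [act1, integrableFlow, PiLp.toLp_apply, Matrix.cons_val]
  linear_combination z 0 * z 2 * h

theorem sq_add_sq_integrableFlow (l m : ℝ) (z : R4) (t : ℝ) :
    integrableFlow l m z t 1 ^ 2 + integrableFlow l m z t 3 ^ 2 = z 1 ^ 2 + z 3 ^ 2 := by
  simp only [integrableFlow, PiLp.toLp_apply, Matrix.cons_val]
  linear_combination (z 1 ^ 2 + z 3 ^ 2) * Real.sin_sq_add_cos_sq (m * t)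

theorem act2_integrableFlow (l m : ℝ) (z : R4) (t : ℝ) :
    act2 (integrableFlow l m z t) = act2 z := by
  rw [act2, act2, sq_add_sq_integrableFlow]

theorem hasDerivAt_integrableFlow (l m : ℝ) (z : R4) (t : ℝ) :
    HasDerivAt (integrableFlow l m z)
      (!₂[-l * integrableFlow l m z t 0, m * integrableFlow l m z t 3,
        l * integrableFlow l m z t 2, -m * integrableFlow l m z t 1]) t := by
  have hl : HasDerivAt (fun t => l * t) l t := by simpa using (hasDerivAt_id t).const_mul l
  have hm : HasDerivAt (fun t => m * t) m t := by simpa using (hasDerivAt_id t).const_mul m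
  have h0 := (hl.neg.exp).const_mul (z 0)
  have h2 := (hl.exp).const_mul (z 2)
  have h1 := ((hm.cos).const_mul (z 1)).add ((hm.sin).const_mul (z 3))
  have h3 := ((hm.cos).const_mul (z 3)).sub ((hm.sin).const_mul (z 1))
  suffices h : HasDerivAt (fun t => (WithLp.equiv 2 (Fin 4 → ℝ)) (integrableFlow l m z t))
      ((WithLp.equiv 2 (Fin 4 → ℝ)) (!₂[-l * integrableFlow l m z t 0, m * integrableFlow l m z t 3,
        l * integrableFlow l m z t 2, -m * integrableFlow l m z t 1])) t from
    ((PiLp.continuousLinearEquiv 2 ℝ (fun _ : Fin 4 => ℝ)).symm :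
      (Fin 4 → ℝ) →L[ℝ] R4).hasFDerivAt.comp_hasDerivAt t h
  rw [hasDerivAt_pi]
  intro i
  fin_cases i
  · refine h0.congr_deriv ?_
    simp [integrableFlow]; ring
  · refine h1.congr_deriv ?_
    simp [integrableFlow]; ring
  · refine h2.congr_deriv ?_
    simp [integrableFlow]; ring
  · refine h3.congr_deriv ?_
    simp [integrableFlow]; ring

namespace MoserChart

variable {H : R4 → ℝ} (M : MoserChart H) {E : ℝ}

theorem act1_mem {z : R4} (hz : z ∈ polydisk M.r) : |act1 z| < M.r ^ 2 := by
  rw [act1, abs_mul, sq]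
  exact mul_lt_mul'' hz.1 hz.2.1 (abs_nonneg _) (abs_nonneg _)

theorem act2_mem {z : R4} (hz : z ∈ polydisk M.r) : |act2 z| < M.r ^ 2 / 2 := by
  have h := hz.2.2
  rw [act2, abs_of_nonneg (by positivity)]
  linarith

/-- The normal form involves the actions only. This keeps the integrable flow, the projection to the
Lyapunoff orbit and the swap of the hemispheres inside one energy level. -/
theorem energy_eq_of_act_eq {z w : R4} (hz : z ∈ polydisk M.r) (hw : w ∈ polydisk M.r)
    (h1 : act1 z = act1 w) (h2 : act2 z = act2 w) : H (M.φ z) = H (M.φ w) := by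
  rw [M.normal_form z hz, M.normal_form w hw, h1, h2]

theorem hasStrictFDerivAt {z : R4} (hz : z ∈ polydisk M.r) :
    HasStrictFDerivAt M.φ (fderiv ℝ M.φ z) z :=
  (M.analytic z hz).hasStrictFDerivAt

theorem fderiv_injective {z : R4} (hz : z ∈ polydisk M.r) : Function.Injective (fderiv ℝ M.φ z) :=
  injective_of_omega0 (M.symplectic z hz)

/-- The inverse of the chart. -/
noncomputable def inv (M : MoserChart H) : R4 → R4 := Function.invFunOn M.φ (polydisk M.r)

theorem inv_apply {z : R4} (hz : z ∈ polydisk M.r) : M.inv (M.φ z) = z :=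
  M.injOn.leftInvOn_invFunOn hz

/-- The derivative of the chart is symplectic, hence bijective, so the chart maps neighborhoods onto
neighborhoods. -/
theorem continuousAt_inv {z : R4} (hz : z ∈ polydisk M.r) : ContinuousAt M.inv (M.φ z) := by
  have hsurj : Function.Surjective (fderiv ℝ M.φ z) :=
    (LinearMap.injective_iff_surjective (f := (fderiv ℝ M.φ z : R4 →ₗ[ℝ] R4))).1
      (M.fderiv_injective hz)
  have hmap := (M.hasStrictFDerivAt hz).map_nhds_eq_of_surj (LinearMap.range_eq_top.2 hsurj)
  rw [ContinuousAt, M.inv_apply hz, ← hmap, tendsto_map'_iff]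
  refine tendsto_id.congr' ?_
  filter_upwards [(isOpen_polydisk M.r).mem_nhds hz] with w hw
  exact (M.inv_apply hw).symm

/-- The Hamiltonian vector field in Moser's coordinates. -/
theorem exists_frequencies (hH : Differentiable ℝ H) {a b : ℝ} (ha : |a| < M.r ^ 2)
    (hb : |b| < M.r ^ 2 / 2) :
    ∃ l m : ℝ, 0 < l ∧ ∀ z ∈ polydisk M.r, act1 z = a → act2 z = b →
      fderiv ℝ M.φ z !₂[-l * z 0, m * z 3, l * z 2, -m * z 1] = hamVF H (M.φ z) := by
  refine ⟨M.α - deriv (fun s => M.R (s, b)) a, M.β + deriv (fun s => M.R (a, s)) b,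
    M.freq1_pos a b ha hb, fun z hz h1 h2 => ?_⟩
  set l := M.α - deriv (fun s => M.R (s, b)) a with hl
  set m := M.β + deriv (fun s => M.R (a, s)) b with hm
  have hR : HasFDerivAt M.R (fderiv ℝ M.R (a, b)) (a, b) :=
    (M.R_analytic (a, b) ⟨ha, hb⟩).differentiableAt.hasFDerivAt
  have hR1 : deriv (fun s => M.R (s, b)) a = fderiv ℝ M.R (a, b) (1, 0) :=
    (hR.comp_hasDerivAt a ((hasDerivAt_id a).prodMk (hasDerivAt_const a b))).deriv
  have hR2 : deriv (fun s => M.R (a, s)) b = fderiv ℝ M.R (a, b) (0, 1) :=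
    (hR.comp_hasDerivAt b ((hasDerivAt_const b a).prodMk (hasDerivAt_id b))).deriv
  have hp : ∀ i : Fin 4, HasFDerivAt (fun w : R4 => w i) (EuclideanSpace.proj (𝕜 := ℝ) i : R4 →L[ℝ] ℝ) z :=
    fun i => (EuclideanSpace.proj (𝕜 := ℝ) i : R4 →L[ℝ] ℝ).hasFDerivAt
  have hd1 := (hp 0).mul (hp 2)
  have hd2 := (((hp 1).pow 2).add ((hp 3).pow 2)).mul_const (1 / 2)
  have hact1 : HasFDerivAt act1 _ z := hd1
  have hact2 : HasFDerivAt act2 _ z := hd2.congr_of_eventuallyEq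
    (Eventually.of_forall fun w => by simp [act2]; ring)
  have hRz : HasFDerivAt M.R (fderiv ℝ M.R (a, b)) (act1 z, act2 z) := by rwa [h1, h2]
  have hK := ((hact1.const_mul (-M.α)).add (hact2.const_mul M.β)).add
    (hRz.comp z (hact1.prodMk hact2))
  have hK' := hK.congr_of_eventuallyEq (f₁ := H ∘ M.φ) (by
    filter_upwards [(isOpen_polydisk M.r).mem_nhds hz] with w hw
    exact M.normal_form w hw)
  have hchain := (hH (M.φ z)).hasFDerivAt.comp z (M.hasStrictFDerivAt hz).hasFDerivAt
  have hsurj : Function.Surjective (fderiv ℝ M.φ z) :=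
    (LinearMap.injective_iff_surjective (f := (fderiv ℝ M.φ z : R4 →ₗ[ℝ] R4))).1
      (M.fderiv_injective hz)
  -- By nondegeneracy it suffices to pair both sides with vectors of the form `Dφ v`, which exhaust
  -- `ℝ⁴`. There the symplecticity of the chart reduces the claim to the differential of the normal
  -- form.
  rw [← sub_eq_zero]
  refine omega0_eq_zero fun w => ?_
  obtain ⟨v, rfl⟩ := hsurj w
  rw [← omegaL_apply, map_sub, sub_apply, omegaL_apply, omegaL_apply, M.symplectic z hz,
    omega0_hamVF]
  have hv := congrArg (fun L => L v) (hchain.unique hK')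
  simp only [ContinuousLinearMap.comp_apply] at hv
  rw [hv]
  have hlin : ∀ x y : ℝ, fderiv ℝ M.R (a, b) (x, y) =
      x * deriv (fun s => M.R (s, b)) a + y * deriv (fun s => M.R (a, s)) b := by
    intro x y
    have : ((x, y) : ℝ × ℝ) = x • (1, 0) + y • (0, 1) := by simp
    rw [this, map_add, map_smul, map_smul, hR1, hR2, smul_eq_mul, smul_eq_mul]
  simp only [add_apply, smul_apply, ContinuousLinearMap.comp_apply, ContinuousLinearMap.prod_apply, hlin,
    omega0, smul_eq_mul]
  simp [hl, hm]
  ring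

/-- In Moser's coordinates, trajectories are explicit as long as they stay in the chart. -/
theorem exists_hasDerivAt_integrableFlow (hH : Differentiable ℝ H) {z : R4} (hz : z ∈ polydisk M.r) :
    ∃ l m : ℝ, 0 < l ∧ ∀ t, integrableFlow l m z t ∈ polydisk M.r →
      HasDerivAt (fun t => M.φ (integrableFlow l m z t)) (hamVF H (M.φ (integrableFlow l m z t))) t := by
  obtain ⟨l, m, hl, h⟩ := M.exists_frequencies hH (M.act1_mem hz) (M.act2_mem hz)
  refine ⟨l, m, hl, fun t ht => ?_⟩
  rw [← h _ ht (act1_integrableFlow l m z t) (act2_integrableFlow l m z t)]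
  exact (M.hasStrictFDerivAt ht).hasFDerivAt.comp_hasDerivAt t (hasDerivAt_integrableFlow l m z t)

/-- Trajectories whose hyperbolic coordinates tend to zero converge to the Lyapunoff orbit. -/
theorem tendsto_infDist_P2 {z : R4} (hz : z ∈ polydisk M.r) (hE : H (M.φ z) = E) (h0 : act1 z = 0)
    {l m : ℝ} {f : Filter ℝ} (hf : ∀ᶠ t in f, |integrableFlow l m z t 0| ≤ |z 0| ∧
      |integrableFlow l m z t 2| ≤ |z 2|)
    (hlim0 : Tendsto (fun t => integrableFlow l m z t 0) f (𝓝 0))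
    (hlim2 : Tendsto (fun t => integrableFlow l m z t 2) f (𝓝 0)) :
    Tendsto (fun t => Metric.infDist (M.φ (integrableFlow l m z t)) (M.P2 E)) f (𝓝 0) := by
  -- A compact part of the polydisk that contains the trajectory eventually and its projection
  -- always; on it the chart is uniformly continuous, so small distances in the chart give small
  -- distances in `ℝ⁴`.
  set K : Set R4 := {w | |w 0| ≤ |z 0| ∧ |w 2| ≤ |z 2| ∧ w 1 ^ 2 + w 3 ^ 2 ≤ z 1 ^ 2 + z 3 ^ 2} with hK
  have hKp : K ⊆ polydisk M.r := fun w hw =>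
    ⟨hw.1.trans_lt hz.1, hw.2.1.trans_lt hz.2.1, hw.2.2.trans_lt hz.2.2⟩
  have hKc : IsCompact K := by
    have hc : ∀ i : Fin 4, Continuous fun z : R4 => z i := fun i =>
      (EuclideanSpace.proj (𝕜 := ℝ) i).continuous
    refine Metric.isCompact_of_isClosed_isBounded ?_ ?_
    · exact (isClosed_le (hc 0).abs continuous_const).inter ((isClosed_le (hc 2).abs
        continuous_const).inter (isClosed_le (((hc 1).pow 2).add ((hc 3).pow 2)) continuous_const))
    · refine (Metric.isBounded_closedBall (x := (0 : R4)) (r := Real.sqrt (z 0 ^ 2 + z 2 ^ 2 +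
        (z 1 ^ 2 + z 3 ^ 2)))).subset fun w hw => ?_
      rw [mem_closedBall_zero_iff, EuclideanSpace.norm_eq]
      refine Real.sqrt_le_sqrt ?_
      have a := sq_le_sq.2 hw.1
      have b := sq_le_sq.2 hw.2.1
      simp only [Fin.sum_univ_four, Real.norm_eq_abs, sq_abs]
      linarith [hw.2.2]
  have hu : UniformContinuousOn M.φ K := hKc.uniformContinuousOn_of_continuous fun w hw =>
    (M.hasStrictFDerivAt (hKp hw)).hasFDerivAt.continuousAt.continuousWithinAt
  -- the projection to the center
  set p : ℝ → R4 := fun t => !₂[0, integrableFlow l m z t 1, 0, integrableFlow l m z t 3] with hp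
  have hpK : ∀ t, p t ∈ K := fun t => by
    refine ⟨by simp [hp], by simp [hp], ?_⟩
    have := sq_add_sq_integrableFlow l m z t
    simp [hp, this]
  have hpP : ∀ t, M.φ (p t) ∈ M.P2 E := fun t => by
    refine mem_image_of_mem _ ⟨hKp (hpK t), ?_, by simp [hp]⟩
    rw [← hE]
    refine M.energy_eq_of_act_eq (hKp (hpK t)) hz (by rw [h0]; simp [act1, hp]) ?_
    rw [← act2_integrableFlow l m z t]
    simp [act2, hp]
  have hdist : Tendsto (fun t => dist (integrableFlow l m z t) (p t)) f (𝓝 0) := by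
    have e : ∀ t, dist (integrableFlow l m z t) (p t) =
        Real.sqrt (integrableFlow l m z t 0 ^ 2 + integrableFlow l m z t 2 ^ 2) := by
      intro t
      rw [EuclideanSpace.dist_eq]
      simp [Fin.sum_univ_four, hp, Real.dist_eq]
    simp only [e]
    simpa using ((hlim0.pow 2).add (hlim2.pow 2)).sqrt
  rw [Metric.tendsto_nhds]
  intro ε hε
  obtain ⟨δ, hδ, hφ⟩ := Metric.uniformContinuousOn_iff.1 hu ε hε
  filter_upwards [hf, (Metric.tendsto_nhds.1 hdist) δ hδ] with t ht hd
  rw [Real.dist_eq, sub_zero, abs_of_nonneg dist_nonneg] at hd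
  rw [Real.dist_eq, sub_zero, abs_of_nonneg Metric.infDist_nonneg]
  refine (Metric.infDist_le_dist_of_mem (hpP t)).trans_lt (hφ _ ?_ _ (hpK t) hd)
  exact ⟨ht.1, ht.2, (sq_add_sq_integrableFlow l m z t).le⟩

variable {S : Set R4}

theorem mem_of_add_pos (hS : M.IsEnergyBall E S) {z : R4} (hz : z ∈ polydisk M.r)
    (hE : H (M.φ z) = E) (hpos : 0 < z 0 + z 2) : M.φ z ∈ S \ M.sphere E := by
  constructor
  · have : M.φ z ∈ S ∩ M.φ '' polydisk M.r := by
      rw [hS.chart]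
      exact mem_image_of_mem _ ⟨hz, hE, hpos.le⟩
    exact this.1
  · rintro ⟨w, ⟨hw, -, hw0⟩, e⟩
    rw [M.injOn hw hz e] at hw0
    exact hpos.ne' hw0

/-- The backward trajectory of a point of the local unstable manifold. -/
theorem exists_backward_trajectory (hH : Differentiable ℝ H) (hS : M.IsEnergyBall E S) {ρ : ℝ} {x : R4}
    (hx : x ∈ M.Wu E ρ) : ∃ γ : ℝ → R4, γ 0 = x ∧
      (∀ t ≤ 0, HasDerivAt γ (hamVF H (γ t)) t ∧ γ t ∈ S \ M.sphere E) ∧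
      Tendsto (fun t => Metric.infDist (γ t) (M.P2 E)) atBot (𝓝 0) := by
  obtain ⟨z, ⟨hz, hE, h0, h2, -⟩, rfl⟩ := hx
  obtain ⟨l, m, hl, hγ⟩ := M.exists_hasDerivAt_integrableFlow hH hz
  -- On `{q₁ = 0}` only `p₁` moves hyperbolically. It decays backward in time and stays positive, so
  -- the trajectory never reaches the sphere `{q₁ + p₁ = 0}`.
  have e0 : ∀ t, integrableFlow l m z t 0 = 0 := fun t => by simp [integrableFlow, h0]
  have e2 : ∀ t, integrableFlow l m z t 2 = z 2 * Real.exp (l * t) := fun t => by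
    simp [integrableFlow]
  have hle : ∀ t ≤ 0, |integrableFlow l m z t 2| ≤ |z 2| := fun t ht => by
    rw [e2, abs_mul, abs_of_pos (Real.exp_pos _)]
    exact mul_le_of_le_one_right (abs_nonneg _)
      (Real.exp_le_one_iff.2 (mul_nonpos_of_nonneg_of_nonpos hl.le ht))
  have hmem : ∀ t ≤ 0, integrableFlow l m z t ∈ polydisk M.r := fun t ht =>
    ⟨by rw [e0, abs_zero]; exact M.r_pos, (hle t ht).trans_lt hz.2.1,
      (sq_add_sq_integrableFlow l m z t).trans_lt hz.2.2⟩
  refine ⟨fun t => M.φ (integrableFlow l m z t), by simp only [integrableFlow_zero],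
    fun t ht => ⟨hγ t (hmem t ht), M.mem_of_add_pos hS (hmem t ht) ?_ ?_⟩, ?_⟩
  · rw [← hE]
    exact M.energy_eq_of_act_eq (hmem t ht) hz (act1_integrableFlow l m z t)
      (act2_integrableFlow l m z t)
  · rw [e0, e2, zero_add]
    positivity
  · refine M.tendsto_infDist_P2 hz hE (by simp [act1, h0]) ?_ ?_ ?_
    · filter_upwards [eventually_le_atBot 0] with t ht
      exact ⟨by rw [e0, abs_zero]; exact abs_nonneg _, hle t ht⟩
    · simp only [e0]
      exact tendsto_const_nhds
    · simp only [e2]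
      have : Tendsto (fun t => Real.exp (l * t)) atBot (𝓝 0) :=
        Real.tendsto_exp_atBot.comp (tendsto_id.const_mul_atBot hl)
      simpa using this.const_mul (z 2)

/-- The forward trajectory of a point of the local stable manifold. -/
theorem exists_forward_trajectory (hH : Differentiable ℝ H) (hS : M.IsEnergyBall E S) {ρ : ℝ} {x : R4}
    (hx : x ∈ M.Ws E ρ) : ∃ γ : ℝ → R4, γ 0 = x ∧
      (∀ t ≥ 0, HasDerivAt γ (hamVF H (γ t)) t ∧ γ t ∈ S \ M.sphere E) ∧
      Tendsto (fun t => Metric.infDist (γ t) (M.P2 E)) atTop (𝓝 0) := by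
  obtain ⟨z, ⟨hz, hE, h2, h0, -⟩, rfl⟩ := hx
  obtain ⟨l, m, hl, hγ⟩ := M.exists_hasDerivAt_integrableFlow hH hz
  have e2 : ∀ t, integrableFlow l m z t 2 = 0 := fun t => by simp [integrableFlow, h2]
  have e0 : ∀ t, integrableFlow l m z t 0 = z 0 * Real.exp (-(l * t)) := fun t => by
    simp [integrableFlow]
  have hle : ∀ t ≥ 0, |integrableFlow l m z t 0| ≤ |z 0| := fun t ht => by
    rw [e0, abs_mul, abs_of_pos (Real.exp_pos _)]
    exact mul_le_of_le_one_right (abs_nonneg _)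
      (Real.exp_le_one_iff.2 (neg_nonpos.2 (mul_nonneg hl.le ht)))
  have hmem : ∀ t ≥ 0, integrableFlow l m z t ∈ polydisk M.r := fun t ht =>
    ⟨(hle t ht).trans_lt hz.1, by rw [e2, abs_zero]; exact M.r_pos,
      (sq_add_sq_integrableFlow l m z t).trans_lt hz.2.2⟩
  refine ⟨fun t => M.φ (integrableFlow l m z t), by simp only [integrableFlow_zero],
    fun t ht => ⟨hγ t (hmem t ht), M.mem_of_add_pos hS (hmem t ht) ?_ ?_⟩, ?_⟩
  · rw [← hE]
    exact M.energy_eq_of_act_eq (hmem t ht) hz (act1_integrableFlow l m z t)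
      (act2_integrableFlow l m z t)
  · rw [e0, e2, add_zero]
    positivity
  · refine M.tendsto_infDist_P2 hz hE (by simp [act1, h2]) ?_ ?_ ?_
    · filter_upwards [eventually_ge_atTop 0] with t ht
      exact ⟨hle t ht, by rw [e2, abs_zero]; exact abs_nonneg _⟩
    · simp only [e0]
      have : Tendsto (fun t => Real.exp (-(l * t))) atTop (𝓝 0) :=
        Real.tendsto_exp_neg_atTop_nhds_zero.comp (tendsto_id.const_mul_atTop hl)
      simpa using this.const_mul (z 0)
    · simp only [e2]
      exact tendsto_const_nhds

/-- The two hemispheres have the same symplectic area. -/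
theorem areaMeasure_U1_eq_U2 {G : R4 → ℝ} {c₁ c₂ : R2 → R4} (h₁ : IsSection G E c₁)
    (h₂ : IsSection G E c₂) (hc₁ : c₁ '' Metric.ball 0 1 = M.U1 E)
    (hc₂ : c₂ '' Metric.ball 0 1 = M.U2 E) : areaMeasure c₁ (M.U1 E) = areaMeasure c₂ (M.U2 E) := by
  have hU1 : ∀ z ∈ Metric.ball (0 : R2) 1, ∃ w ∈ polydisk M.r, M.φ w = c₁ z ∧
      M.φ (hemiSwap w) ∈ M.U2 E := by
    intro z hz
    obtain ⟨w, ⟨hw, hwE, hw0, hw1⟩, e⟩ : c₁ z ∈ M.U1 E := hc₁ ▸ mem_image_of_mem c₁ hz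
    refine ⟨w, hw, e, mem_image_of_mem _ ⟨hemiSwap_mem_polydisk hw, ?_, ?_, ?_⟩⟩
    · rw [← hwE]
      exact M.energy_eq_of_act_eq (hemiSwap_mem_polydisk hw) hw (by simp [act1, hemiSwap_apply])
        (by simp [act2, hemiSwap_apply])
    · simp [hemiSwap_apply]; linarith
    · simp [hemiSwap_apply]; linarith
  have hU2 : ∀ x ∈ M.U2 E, ∃ w ∈ polydisk M.r, M.φ (hemiSwap w) = x ∧ M.φ w ∈ M.U1 E := by
    rintro x ⟨w, ⟨hw, hwE, hw0, hw1⟩, e⟩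
    refine ⟨hemiSwap w, hemiSwap_mem_polydisk hw, by rw [hemiSwap_hemiSwap, e],
      mem_image_of_mem _ ⟨hemiSwap_mem_polydisk hw, ?_, ?_, ?_⟩⟩
    · rw [← hwE]
      exact M.energy_eq_of_act_eq (hemiSwap_mem_polydisk hw) hw (by simp [act1, hemiSwap_apply])
        (by simp [act2, hemiSwap_apply])
    · simp [hemiSwap_apply]; linarith
    · simp [hemiSwap_apply]; linarith
  set ζ : R2 → R4 := fun z => M.inv (c₁ z) with hζ
  have hζp : ∀ z ∈ Metric.ball (0 : R2) 1, ζ z ∈ polydisk M.r ∧ M.φ (ζ z) = c₁ z ∧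
      M.φ (hemiSwap (ζ z)) ∈ M.U2 E := by
    intro z hz
    obtain ⟨w, hw, e, h⟩ := hU1 z hz
    have : ζ z = w := by rw [hζ]; simp only; rw [← e, M.inv_apply hw]
    rw [this]
    exact ⟨hw, e, h⟩
  -- This is the swap of the hemispheres read in the two parametrizations. Its derivative is found
  -- in two stages, through the chart and then through `c₂`, by left inverses of injective
  -- derivatives.
  set g : R2 → R2 := fun z => Function.invFunOn c₂ (Metric.ball 0 1) (M.φ (hemiSwap (ζ z))) with hg
  have hex : ∀ z ∈ Metric.ball (0 : R2) 1, ∃ w ∈ Metric.ball (0 : R2) 1,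
      c₂ w = M.φ (hemiSwap (ζ z)) := fun z hz => by
    have := (hζp z hz).2.2
    rwa [← hc₂] at this
  have hg1 : ∀ z ∈ Metric.ball (0 : R2) 1, g z ∈ Metric.ball (0 : R2) 1 := fun z hz =>
    Function.invFunOn_mem (hex z hz)
  have hg2 : ∀ z ∈ Metric.ball (0 : R2) 1, c₂ (g z) = M.φ (hemiSwap (ζ z)) := fun z hz =>
    Function.invFunOn_eq (hex z hz)
  have himg : c₂ '' (g '' Metric.ball 0 1) = M.U2 E := by
    refine Subset.antisymm ?_ fun x hx => ?_
    · rintro _ ⟨_, ⟨z, hz, rfl⟩, rfl⟩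
      rw [hg2 z hz]
      exact (hζp z hz).2.2
    · obtain ⟨w, hw, e, hwU⟩ := hU2 x hx
      rw [← hc₁] at hwU
      obtain ⟨z, hz, e'⟩ := hwU
      refine ⟨g z, mem_image_of_mem g hz, ?_⟩
      have : ζ z = w := by rw [hζ]; simp only; rw [e', M.inv_apply hw]
      rw [hg2 z hz, this, e]
  have hinj : InjOn g (Metric.ball 0 1) := by
    intro z hz w hw e
    have e1 : M.φ (hemiSwap (ζ z)) = M.φ (hemiSwap (ζ w)) := by rw [← hg2 z hz, ← hg2 w hw, e]
    have e2 := M.injOn (hemiSwap_mem_polydisk (hζp z hz).1) (hemiSwap_mem_polydisk (hζp w hw).1) e1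
    have e3 : ζ z = ζ w := by rw [← hemiSwap_hemiSwap (ζ z), e2, hemiSwap_hemiSwap]
    refine h₁.injOn_ball hz hw ?_
    rw [← (hζp z hz).2.1, ← (hζp w hw).2.1, e3]
  rw [← himg, ← hc₁]
  refine h₁.areaMeasure_image_of_symplectic h₂ measurableSet_ball subset_rfl hinj hg1 fun z hz => ?_
  have hball : Metric.ball (0 : R2) 1 ∈ 𝓝 z := Metric.isOpen_ball.mem_nhds hz
  have hleft : ∀ {X : Type} [NormedAddCommGroup X] [NormedSpace ℝ X] [FiniteDimensional ℝ X]
      (A : X →L[ℝ] R4), Function.Injective A → ∃ L : R4 →L[ℝ] X, Function.LeftInverse L A := by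
    intro X _ _ _ A hA
    obtain ⟨L, hL⟩ := LinearMap.exists_leftInverse_of_injective (A : X →ₗ[ℝ] R4)
      (LinearMap.ker_eq_bot.2 hA)
    exact ⟨LinearMap.toContinuousLinearMap L, fun p => congrArg (fun l => l p) hL⟩
  obtain ⟨hz1, hz2, hz3⟩ := hζp z hz
  -- the derivative of `ζ`
  have hζc : ContinuousAt ζ z := by
    have h := M.continuousAt_inv hz1
    rw [hz2] at h
    exact ContinuousAt.comp h (h₁.hasStrictFDerivAt hz).hasFDerivAt.continuousAt
  obtain ⟨L, hL⟩ := hleft _ (M.fderiv_injective hz1)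
  have hζd := HasFDerivAt.of_comp_of_leftInverse hζc (M.hasStrictFDerivAt hz1).hasFDerivAt
    (h₁.hasStrictFDerivAt hz).hasFDerivAt (by filter_upwards [hball] with w hw using (hζp w hw).2.1) hL
  set ζ' := L.comp (fderiv ℝ c₁ z)
  have hζ' : (fderiv ℝ M.φ (ζ z)).comp ζ' = fderiv ℝ c₁ z := by
    refine ((M.hasStrictFDerivAt hz1).hasFDerivAt.comp z hζd).unique ?_
    refine (h₁.hasStrictFDerivAt hz).hasFDerivAt.congr_of_eventuallyEq ?_
    filter_upwards [hball] with w hw using (hζp w hw).2.1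
  -- the derivative of `g`
  have hz1' := hemiSwap_mem_polydisk hz1
  have hh : HasFDerivAt (fun z => M.φ (hemiSwap (ζ z)))
      ((fderiv ℝ M.φ (hemiSwap (ζ z))).comp (hemiSwap.comp ζ')) z :=
    (M.hasStrictFDerivAt hz1').hasFDerivAt.comp z (hemiSwap.hasFDerivAt.comp z hζd)
  have hgc : ContinuousAt g z := by
    classical
    -- Continuity of `g` follows from that of `c₂ ∘ g`, because `c₂` is an embedding of the closed
    -- disk. The default value `0` matters only off the ball, which is a neighborhood of `z`.
    have h1 : Tendsto (fun w => closedDisk.domRestrict c₂ (if hw : w ∈ Metric.ball (0 : R2) 1 then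
        ⟨g w, Metric.ball_subset_closedBall (hg1 w hw)⟩ else ⟨0, by simp [closedDisk]⟩)) (𝓝 z)
        (𝓝 (closedDisk.domRestrict c₂ ⟨g z, Metric.ball_subset_closedBall (hg1 z hz)⟩)) := by
      simp only [domRestrict_apply, hg2 z hz]
      refine hh.continuousAt.tendsto.congr' ?_
      filter_upwards [hball] with w hw
      rw [dif_pos hw, hg2 w hw]
    have h2 := h₂.isClosedEmbedding.isInducing.tendsto_nhds_iff.2 h1
    have h3 := (continuous_subtype_val.tendsto _).comp h2
    refine Tendsto.congr' ?_ h3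
    filter_upwards [hball] with w hw
    simp only [Function.comp_apply]
    rw [dif_pos hw]
  obtain ⟨L₂, hL₂⟩ := hleft _ (h₂.injective (g z) (hg1 z hz))
  have hgd := HasFDerivAt.of_comp_of_leftInverse hgc (h₂.hasStrictFDerivAt (hg1 z hz)).hasFDerivAt hh
    (by filter_upwards [hball] with w hw using hg2 w hw) hL₂
  refine ⟨_, hgd.hasFDerivWithinAt, fun u v => ?_⟩
  set g' := L₂.comp ((fderiv ℝ M.φ (hemiSwap (ζ z))).comp (hemiSwap.comp ζ'))
  have hg' : (fderiv ℝ c₂ (g z)).comp g' =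
      (fderiv ℝ M.φ (hemiSwap (ζ z))).comp (hemiSwap.comp ζ') := by
    refine ((h₂.hasStrictFDerivAt (hg1 z hz)).hasFDerivAt.comp z hgd).unique ?_
    refine hh.congr_of_eventuallyEq ?_
    filter_upwards [hball] with w hw using hg2 w hw
  have e1 : ∀ u, fderiv ℝ c₂ (g z) (g' u) = fderiv ℝ M.φ (hemiSwap (ζ z)) (hemiSwap (ζ' u)) :=
    fun u => congrArg (fun l => l u) hg'
  have e2 : ∀ u, fderiv ℝ c₁ z u = fderiv ℝ M.φ (ζ z) (ζ' u) := fun u =>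
    (congrArg (fun l => l u) hζ').symm
  rw [e1, e1, e2, e2, M.symplectic _ hz1', omega0_hemiSwap, M.symplectic _ hz1]

end MoserChart

end Chart

/-! ### Transition along trajectories in the energy ball -/

section Transition

open MeasureTheory

variable {G H : R4 → ℝ} {E : ℝ} {c c₁ c₂ : R2 → R4} {φ : ℝ → R4 → R4} {F B S W A : Set R4}

theorem isSigmaCompact_of_isOpen {s : Set R2} (hs : IsOpen s) : IsSigmaCompact s := by
  have := hs.isOpenEmbedding_subtypeVal.locallyCompactSpace
  rw [isSigmaCompact_iff_sigmaCompactSpace]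
  infer_instance

theorem IsSection.isSigmaCompact_inter (h : IsSection G E c) (hW : IsOpen W) :
    IsSigmaCompact (c '' Metric.ball 0 1 ∩ W) := by
  rw [inter_comm, ← image_preimage_inter, inter_comm]
  exact (isSigmaCompact_of_isOpen
    (h.continuousOn_ball.isOpen_inter_preimage Metric.isOpen_ball hW)).image_of_continuousOn
    (h.continuousOn_ball.mono inter_subset_left)

theorem interior_closedDisk : interior closedDisk = Metric.ball 0 1 :=
  interior_closedBall 0 one_ne_zero

/-- A disk-like transverse leaf in the energy level is a section. -/
theorem IsTransverseLeaf.exists_isSection (h : IsTransverseLeaf H closedDisk F B)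
    (hE : ∀ x ∈ F, G x = E) (hGH : ∀ x ∈ F, hamVF G x = hamVF H x) :
    ∃ c, IsSection G E c ∧ c '' Metric.ball 0 1 = F := by
  obtain ⟨c, h1, h2, h3, h4, h5, -⟩ := h
  rw [interior_closedDisk] at h2 h4 h5
  have hF : ∀ z ∈ Metric.ball 0 1, c z ∈ F := fun z hz => h5 ▸ mem_image_of_mem c hz
  refine ⟨c, ⟨h1, h2, h3, fun z hz => hE _ (hF z hz), fun z hz => (h4 z hz).1, fun z hz => ?_⟩, h5⟩
  rw [hGH _ (hF z hz)]
  exact (h4 z hz).2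

/-- The segment stays in `S`, where the vector fields of `G` and `H` agree, so by uniqueness it is a
segment of the flow of `G`. -/
theorem FlowsTo.exists_flow (hφ : IsHamiltonianFlow G φ) (hGH : ∀ x ∈ S, hamVF G x = hamVF H x)
    (hW : W ⊆ S) {x y : R4} (hx : x ∈ S) (hy : y ∈ S) (h : FlowsTo H W A x y) :
    ∃ T, 0 < T ∧ φ T x = y ∧ ∀ t ∈ Ioo 0 T, φ t x ∈ W \ A := by
  obtain ⟨T, γ, hT, hγ, rfl, rfl, hW'⟩ := h
  obtain ⟨K, hK⟩ := hφ.lipschitz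
  have hS : ∀ t ∈ Icc 0 T, γ t ∈ S := fun t ht => by
    rcases ht.1.eq_or_lt with rfl | h0
    · exact hx
    rcases ht.2.eq_or_lt with rfl | hT
    · exact hy
    exact hW (hW' t ⟨h0, hT⟩).1
  have e : ∀ t ∈ Icc 0 T, γ t = φ t (γ 0) := fun t ht =>
    hφ.flow.eq_of_hasDerivAt hK (fun s hs => (hGH _ (hS s hs)).symm ▸ hγ s hs) ht
  refine ⟨T, hT, (e T ⟨hT.le, le_rfl⟩).symm, fun t ht => ?_⟩
  rw [← e t (Ioo_subset_Icc_self ht)]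
  exact hW' t ht

/-- Sets in two sections have the same area if the flow carries one bijectively to the other,
through a set `Z` disjoint from both. -/
theorem IsSection.areaMeasure_eq_of_flow (h₁ : IsSection G E c₁) (h₂ : IsSection G E c₂)
    (hφ : IsHamiltonianFlow G φ) {A A' Z : Set R4} (hA : MeasurableSet A)
    (hA₁ : A ⊆ c₁ '' Metric.ball 0 1) (hA₂ : A' ⊆ c₂ '' Metric.ball 0 1)
    (hAZ : Disjoint A Z) (hZ : Disjoint (c₂ '' Metric.ball 0 1) Z)
    (h : ∀ x ∈ A, ∃ y ∈ A', ∃ T, 0 < T ∧ φ T x = y ∧ ∀ t ∈ Ioo 0 T, φ t x ∈ Z)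
    (h' : ∀ y ∈ A', ∃ x ∈ A, ∃ T, 0 < T ∧ φ T x = y ∧ ∀ t ∈ Ioo 0 T, φ t x ∈ Z) :
    areaMeasure c₁ A = areaMeasure c₂ A' := by
  choose! Ψ hΨ T hT hTΨ hTZ using h
  -- If two segments end at the same point, the longer one passes through the starting point of the
  -- shorter one. That point is in `A`, while the interior of the segment is in `Z`. Hence the two
  -- times agree, and injectivity follows.
  have hlt : ∀ {x x' s t}, x ∈ A → φ s x = φ t x' → (∀ r ∈ Ioo 0 t, φ r x' ∈ Z) → 0 < s →
      ¬ s < t := by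
    intro x x' s t hx e hZ hs hst
    have : φ (t - s) x' = x := by
      rw [← hφ.neg_apply_self s x, e, ← hφ.add]
      congr 1
      ring
    exact hAZ.le_bot ⟨hx, this ▸ hZ (t - s) ⟨sub_pos.2 hst, sub_lt_self t hs⟩⟩
  have hinj : InjOn Ψ A := by
    intro x hx x' hx' e
    rw [← hTΨ x hx, ← hTΨ x' hx'] at e
    have hTT : T x = T x' := le_antisymm
      (not_lt.1 (hlt hx' e.symm (hTZ x hx) (hT x' hx')))
      (not_lt.1 (hlt hx e (hTZ x' hx') (hT x hx)))
    rw [hTT] at e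
    rw [← hφ.neg_apply_self (T x') x, e, hφ.neg_apply_self]
  have himg : Ψ '' A = A' := by
    refine (image_subset_iff.2 hΨ).antisymm fun y hy => ?_
    obtain ⟨x, hx, t, ht, rfl, htZ⟩ := h' y hy
    refine ⟨x, hx, ?_⟩
    rw [← hTΨ x hx]
    congr 1
    refine le_antisymm (not_lt.1 fun hlt => ?_) (not_lt.1 fun hlt => ?_)
    · exact hZ.le_bot ⟨hA₂ hy, hTZ x hx t ⟨ht, hlt⟩⟩
    · refine hZ.le_bot ⟨hA₂ (hΨ x hx), ?_⟩
      rw [← hTΨ x hx]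
      exact htZ _ ⟨hT x hx, hlt⟩
  have hσ := h₂.isSigmaCompact_inter isOpen_univ
  rw [inter_univ] at hσ
  rw [← himg]
  exact h₁.areaMeasure_image_transition h₂ hφ hA hA₁ Subset.rfl hσ hinj fun x hx =>
    ⟨hA₂ (hΨ x hx), T x, hT x hx, hTΨ x hx, fun t ht hm => hZ.le_bot ⟨hm, hTZ x hx t ht⟩⟩

/-- A transition map preserves the area. -/
theorem IsTransitionMap.areaMeasure_image (hφ : IsHamiltonianFlow G φ)
    (hGH : ∀ x ∈ S, hamVF G x = hamVF H x) (hW : W ⊆ S) (h₁ : IsSection G E c₁)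
    (h₂ : IsSection G E c₂) {Ψ : R4 → R4} {D₁ D₂ U : Set R4} (hΨ : IsTransitionMap H W Ψ D₁ D₂)
    (hD₁ : D₁ ⊆ c₁ '' Metric.ball 0 1) (hU : IsOpen U) (hD₂ : D₂ = c₂ '' Metric.ball 0 1 ∩ U)
    (hS₁ : D₁ ⊆ S) (hS₂ : D₂ ⊆ S) {A : Set R4} (hA : MeasurableSet A) (hA₁ : A ⊆ D₁) :
    areaMeasure c₁ A = areaMeasure c₂ (Ψ '' A) := by
  have hmap : IsHomeoOn Ψ D₁ D₂ := hΨ.1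
  refine h₁.areaMeasure_image_transition h₂ hφ hA (hA₁.trans hD₁) (hD₂.trans_subset inter_subset_left)
    (hD₂ ▸ h₂.isSigmaCompact_inter hU) (hmap.injOn.mono hA₁) fun x hx => ⟨hmap.mapsTo (hA₁ hx), ?_⟩
  obtain ⟨T, hT, e, hT'⟩ := (hΨ.2 x (hA₁ hx)).exists_flow hφ hGH hW (hS₁ (hA₁ hx))
    (hS₂ (hmap.mapsTo (hA₁ hx)))
  exact ⟨T, hT, e, fun t ht => (hT' t ht).2⟩

end Transition

/-! ### Concatenation of trajectories -/

section Reach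

variable {G H : R4 → ℝ} {φ : ℝ → R4 → R4} {S W A P : Set R4} {x y z : R4}

/-- The flow carries `x` to `y` inside `W`. -/
def Reach (φ : ℝ → R4 → R4) (W : Set R4) (x y : R4) : Prop :=
  ∃ T, 0 ≤ T ∧ φ T x = y ∧ ∀ t ∈ Icc 0 T, φ t x ∈ W

theorem Reach.trans (hφ : IsHamiltonianFlow G φ) (h : Reach φ W x y) (h' : Reach φ W y z) :
    Reach φ W x z := by
  obtain ⟨T, hT, rfl, hW⟩ := h
  obtain ⟨T', hT', rfl, hW'⟩ := h'
  refine ⟨T' + T, by positivity, hφ.add _ _ _, fun t ht => ?_⟩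
  rcases le_total t T with h | h
  · exact hW t ⟨ht.1, h⟩
  · have := hW' (t - T) ⟨sub_nonneg.2 h, by linarith [ht.2]⟩
    rwa [← hφ.add, sub_add_cancel] at this

theorem FlowsTo.reach (hφ : IsHamiltonianFlow G φ) (hGH : ∀ x ∈ S, hamVF G x = hamVF H x)
    (hW : W ⊆ S) (hx : x ∈ W) (hy : y ∈ W) (h : FlowsTo H W A x y) : Reach φ W x y := by
  obtain ⟨T, hT, rfl, hT'⟩ := h.exists_flow hφ hGH hW (hW hx) (hW hy)
  refine ⟨T, hT.le, rfl, fun t ht => ?_⟩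
  rcases ht.1.eq_or_lt with rfl | h0
  · rwa [hφ.flow.zero]
  rcases ht.2.eq_or_lt with rfl | h1
  · exact hy
  exact (hT' t ⟨h0, h1⟩).1

/-- A backward asymptotic trajectory, a trajectory segment and a forward asymptotic trajectory fit
together to a homoclinic trajectory. -/
theorem Reach.exists_isHomoclinicIn (hφ : IsHamiltonianFlow G φ)
    (hGH : ∀ x ∈ S, hamVF G x = hamVF H x) (hW : W ⊆ S) (h : Reach φ W x y)
    (hb : ∃ γ : ℝ → R4, γ 0 = x ∧ (∀ t ≤ 0, HasDerivAt γ (hamVF H (γ t)) t ∧ γ t ∈ W) ∧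
      Tendsto (fun t => Metric.infDist (γ t) P) atBot (𝓝 0))
    (hf : ∃ γ : ℝ → R4, γ 0 = y ∧ (∀ t ≥ 0, HasDerivAt γ (hamVF H (γ t)) t ∧ γ t ∈ W) ∧
      Tendsto (fun t => Metric.infDist (γ t) P) atTop (𝓝 0)) :
    ∃ γ : ℝ → R4, IsHomoclinicIn H W P γ := by
  obtain ⟨T, hT, rfl, hTW⟩ := h
  obtain ⟨β, rfl, hβ, hβP⟩ := hb
  obtain ⟨δ, hδ0, hδ, hδP⟩ := hf
  obtain ⟨K, hK⟩ := hφ.lipschitz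
  -- Uniqueness is available on `[0, T]`, so it is applied to the reversed curve and the reversed
  -- flow.
  have eβ : ∀ t ≤ 0, φ t (β 0) = β t := by
    intro t ht
    have hd : ∀ s ∈ Icc 0 (-t), HasDerivAt (fun s => β (-s)) (-hamVF G (β (-s))) s := by
      intro s hs
      obtain ⟨h1, h2⟩ := hβ (-s) (by linarith [hs.1])
      rw [hGH _ (hW h2)]
      have := h1.scomp s (hasDerivAt_neg s)
      simpa [Function.comp_def] using this
    have := hφ.flow.neg.eq_of_hasDerivAt hK.neg (γ := fun s => β (-s)) hd
      (t := -t) ⟨by linarith, le_rfl⟩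
    simpa using this.symm
  have eδ : ∀ t ≥ T, φ t (β 0) = δ (t - T) := by
    intro t ht
    have hd : ∀ s ∈ Icc 0 (t - T), HasDerivAt δ (hamVF G (δ s)) s := fun s hs => by
      obtain ⟨h1, h2⟩ := hδ s hs.1
      rwa [hGH _ (hW h2)]
    rw [hφ.flow.eq_of_hasDerivAt hK hd ⟨sub_nonneg.2 ht, le_rfl⟩, hδ0, ← hφ.add, sub_add_cancel]
  have hmem : ∀ t, φ t (β 0) ∈ W := by
    intro t
    rcases le_total t 0 with h0 | h0
    · rw [eβ t h0]
      exact (hβ t h0).2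
    rcases le_total t T with h1 | h1
    · exact hTW t ⟨h0, h1⟩
    · rw [eδ t h1]
      exact (hδ _ (sub_nonneg.2 h1)).2
  refine ⟨fun t => φ t (β 0), fun t => ?_, hmem, ?_, ?_⟩
  · rw [← hGH _ (hW (hmem t))]
    exact hφ.flow.deriv t (β 0)
  · refine (hδP.comp (tendsto_atTop_add_const_right _ (-T) tendsto_id)).congr' ?_
    filter_upwards [eventually_ge_atTop T] with t ht
    rw [eδ t ht]
    rfl
  · refine hβP.congr' ?_
    filter_upwards [eventually_le_atBot 0] with t ht
    rw [eβ t ht]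

end Reach

/-! ### The theorem -/

theorem IsEmbeddedCircle.isCompact {C : Set R4} (h : IsEmbeddedCircle C) : IsCompact C := by
  obtain ⟨c, hc, -, rfl⟩ := h
  exact isCompact_range hc

theorem IsEmbeddedCircle.isPreconnected {C : Set R4} (h : IsEmbeddedCircle C) :
    IsPreconnected C := by
  obtain ⟨c, hc, -, rfl⟩ := h
  have : Circle.exp.toFun '' univ = univ := by
    rw [image_univ]
    exact Circle.exp_surjective.range_eq
  have h : IsPreconnected (univ : Set Circle) :=
    this ▸ isPreconnected_univ.image _ Circle.exp.continuous.continuousOn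
  rw [← image_univ]
  exact h.image _ hc.continuousOn

theorem mainTheorem3
    (H : R4 → ℝ) (hH : AnalyticOnNhd ℝ H univ)
    (M : MoserChart H) (E : ℝ) (hE : 0 < E)
    (S : Set R4) (hS : M.IsEnergyBall E S)
    (P3 V : Set R4) (D : ℝ → Set R4) (hF : IsTwoThreeFoliation M E S P3 V D)
    (ρ : ℝ) (hρ : 0 < ρ) (τ₀ τ₁ : ℝ) (h₀ : 0 < τ₀) (h₀₁ : τ₀ < τ₁) (h₁ : τ₁ < 1)
    (Cu Cs Bu Bs : Set R4)
    (hCu : Cu = M.Wu E ρ ∩ D τ₀) (hCs : Cs = M.Ws E ρ ∩ D τ₁)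
    (hBu : Bu = boundedDisk (D τ₀) Cu) (hBs : Bs = boundedDisk (D τ₁) Cs)
    (hu : IsEntranceCircle H (S \ M.sphere E) (M.U1 E) (D τ₀) Cu)
    (hs : IsExitCircle H (S \ M.sphere E) (M.U2 E) (D τ₁) Cs)
    (Ψg Ψl : R4 → R4)
    (hg : IsTransitionMap H (S \ M.sphere E) Ψg (D τ₀) (D τ₁))
    (hl : IsTransitionMap H (S \ M.sphere E) Ψl (D τ₁ \ Bs) (D τ₀ \ Bu)) :
    (∃ N : ℕ, 1 ≤ N ∧
      (∀ x ∈ Cu, ∀ j : ℕ, j < N - 1 → (Ψg ∘ Ψl)^[j] (Ψg x) ∈ D τ₁ \ Bs) ∧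
      (((Ψg ∘ Ψl)^[N - 1] ∘ Ψg) '' Cu ∩ Cs).Nonempty) ∧
    ∃ γ : ℝ → R4, IsHomoclinicIn H (S \ M.sphere E) (M.P2 E) γ := by
  have hHc : ContDiff ℝ ∞ H := contDiffOn_univ.1 (hH.contDiffOn uniqueDiffOn_univ)
  have hHd : Differentiable ℝ H := hHc.differentiable (by simp)
  obtain ⟨hScpt, hsphere⟩ : IsCompact S ∧ M.sphere E ⊆ S := by
    obtain ⟨b, hb, -, -, hbS, hbs⟩ := hS.ball
    rw [← hbS, ← hbs]
    exact ⟨(isCompact_closedBall _ _).image hb.continuous,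
      image_mono Metric.sphere_subset_closedBall⟩
  -- Agreement of `G` and `H` near each point of `S` makes their vector fields equal on `S`, while
  -- the flow of `G` is complete.
  obtain ⟨G, hG, hGc, hGH⟩ := exists_hasCompactSupport_eventuallyEq hHc hScpt
  obtain ⟨φ, hφ⟩ := exists_isHamiltonianFlow hG hGc
  have hX : ∀ x ∈ S, hamVF G x = hamVF H x := fun x hx => hamVF_congr (hGH x hx)
  have hGE : ∀ x ∈ S, G x = E := fun x hx => (hGH x hx).eq_of_nhds.trans (hS.energy x hx)
  set W := S \ M.sphere E
  have hWS : W ⊆ S := sdiff_subset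
  have hDW : ∀ τ ∈ Ioo (0 : ℝ) 1, D τ ⊆ W := fun τ hτ =>
    (subset_biUnion_of_mem (u := D) hτ).trans (hF.plane_union.trans_subset sdiff_subset)
  have hU1 : M.U1 E ⊆ M.sphere E := image_mono fun z hz => ⟨hz.1, hz.2.1, hz.2.2.1⟩
  have hU2 : M.U2 E ⊆ M.sphere E := image_mono fun z hz => ⟨hz.1, hz.2.1, hz.2.2.1⟩
  have hsec : ∀ {F B : Set R4}, F ⊆ S → IsTransverseLeaf H closedDisk F B →
      ∃ c, IsSection G E c ∧ c '' Metric.ball 0 1 = F := fun hFS h =>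
    h.exists_isSection (fun x hx => hGE x (hFS hx)) fun x hx => hX x (hFS hx)
  have hτ₀ : τ₀ ∈ Ioo (0 : ℝ) 1 := ⟨h₀, h₀₁.trans h₁⟩
  have hτ₁ : τ₁ ∈ Ioo (0 : ℝ) 1 := ⟨h₀.trans h₀₁, h₁⟩
  have hW₀ := hDW τ₀ hτ₀
  have hW₁ := hDW τ₁ hτ₁
  obtain ⟨c₀, hc₀, e₀⟩ := hsec (hW₀.trans hWS) (hF.plane τ₀ hτ₀)
  obtain ⟨c₁, hc₁, e₁⟩ := hsec (hW₁.trans hWS) (hF.plane τ₁ hτ₁)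
  obtain ⟨a₁, ha₁, ea₁⟩ := hsec (hU1.trans hsphere) hF.rigid_plane1
  obtain ⟨a₂, ha₂, ea₂⟩ := hsec (hU2.trans hsphere) hF.rigid_plane2
  have hBud : IsPlaneDisk c₀ Bu Cu := by
    rw [hBu, ← e₀]
    exact hc₀.isPlaneDisk_boundedDisk hu.circle.isCompact hu.circle.isPreconnected
      (by rw [e₀, hCu]; exact inter_subset_right)
  have hBsd : IsPlaneDisk c₁ Bs Cs := by
    rw [hBs, ← e₁]
    exact hc₁.isPlaneDisk_boundedDisk hs.circle.isCompact hs.circle.isPreconnected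
      (by rw [e₁, hCs]; exact inter_subset_right)
  have hm : ∀ {c : R2 → R4}, IsSection G E c → MeasurableSet (c '' Metric.ball 0 1) := fun h =>
    h.measurableSet_image measurableSet_ball Subset.rfl
  have hUW : ∀ {U Z : Set R4}, U ⊆ M.sphere E → Disjoint U (W \ Z) := fun hU =>
    disjoint_left.2 fun x hx hx' => hx'.1.2 (hU hx)
  have hZ : ∀ {F Z : Set R4}, F ⊆ Z → Disjoint F (W \ Z) := fun hF =>
    disjoint_left.2 fun x hx hx' => hx'.2 (hF hx)
  have hu₀ : boundedDisk (D τ₀) Cu \ Cu ⊆ D τ₀ := by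
    rw [← hBu, ← e₀]
    exact sdiff_subset.trans hBud.subset
  have hs₁ : boundedDisk (D τ₁) Cs \ Cs ⊆ D τ₁ := by
    rw [← hBs, ← e₁]
    exact sdiff_subset.trans hBsd.subset
  have hpos : areaMeasure a₁ (M.U1 E) ≠ 0 := by
    have := ha₁.areaMeasure_image_pos hφ Metric.isOpen_ball Subset.rfl ⟨0, by simp⟩
    rw [ea₁] at this
    exact this.ne'
  -- The flow carries the hemisphere to the disk through `Z = W \ D τ₀`. This set is disjoint from
  -- the hemisphere, which lies on the removed sphere, and from the plane itself.
  have hentrance : areaMeasure a₁ (M.U1 E) = areaMeasure c₀ (Bu \ Cu) := by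
    refine ha₁.areaMeasure_eq_of_flow hc₀ hφ (ea₁ ▸ hm ha₁) ea₁.superset
      (sdiff_subset.trans hBud.subset) (hUW hU1) (hZ e₀.subset) (fun x hx => ?_) fun y hy => ?_
    · obtain ⟨y, hy, h⟩ := hu.to_disk x hx
      exact ⟨y, hBu ▸ hy, h.exists_flow hφ hX hWS (hsphere (hU1 hx)) (hWS (hW₀ (hu₀ hy)))⟩
    · rw [hBu] at hy
      obtain ⟨x, hx, h⟩ := hu.from_entrance y hy
      exact ⟨x, hx, h.exists_flow hφ hX hWS (hsphere (hU1 hx)) (hWS (hW₀ (hu₀ hy)))⟩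
  have hexit : areaMeasure c₁ (Bs \ Cs) = areaMeasure a₂ (M.U2 E) := by
    obtain ⟨O, hO, hOe⟩ := hBsd.isOpen
    refine hc₁.areaMeasure_eq_of_flow ha₂ hφ (hOe ▸ (hm hc₁).inter hO.measurableSet)
      (sdiff_subset.trans hBsd.subset) ea₂.superset (hZ (hBs ▸ hs₁))
      (hUW (ea₂.trans_subset hU2)) (fun x hx => ?_) fun y hy => ?_
    · rw [hBs] at hx
      obtain ⟨y, hy, h⟩ := hs.to_exit x hx
      exact ⟨y, hy, h.exists_flow hφ hX hWS (hWS (hW₁ (hs₁ hx))) (hsphere (hU2 hy))⟩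
    · obtain ⟨x, hx, h⟩ := hs.from_disk y hy
      exact ⟨x, hBs ▸ hx, h.exists_flow hφ hX hWS (hWS (hW₁ (hs₁ hx))) (hsphere (hU2 hy))⟩
  have hhemi := M.areaMeasure_U1_eq_U2 ha₁ ha₂ ea₁ ea₂
  have hfirst := exists_iterate_inter_nonempty hφ hc₀ hc₁ hBud hBsd (Ψg := Ψg) (Ψl := Ψl)
    (by rw [e₀, e₁]; exact hg.1) (by rw [e₀, e₁]; exact hl.1)
    (fun A hA hA₁ => hg.areaMeasure_image hφ hX hWS hc₀ hc₁ e₀.superset isOpen_univ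
      (by rw [inter_univ, e₁]) (hW₀.trans hWS) (hW₁.trans hWS) hA (e₀ ▸ hA₁))
    (fun A hA hA₁ => hl.areaMeasure_image hφ hX hWS hc₁ hc₀ (sdiff_subset.trans e₁.superset)
      hBud.isCompact.isClosed.isOpen_compl (by rw [e₀, Set.sdiff_eq])
      (sdiff_subset.trans (hW₁.trans hWS)) (sdiff_subset.trans (hW₀.trans hWS)) hA (e₁ ▸ hA₁))
    (by rw [← hentrance, hhemi, hexit]) (by rw [← hentrance]; exact hpos)
  rw [e₁] at hfirst
  refine ⟨hfirst, ?_⟩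
  -- The point `x` lies on the unstable manifold and its iterate `z` on the stable one. The
  -- transition segments between them stay in the open ball, so it remains to concatenate.
  obtain ⟨N, -, hN, z, ⟨x, hx, hxz⟩, hz⟩ := hfirst
  have hx₀ : x ∈ M.Wu E ρ ∩ D τ₀ := hCu ▸ hx
  have hz₁ : z ∈ M.Ws E ρ ∩ D τ₁ := hCs ▸ hz
  have hgr : ∀ w ∈ D τ₀, Ψg w ∈ D τ₁ ∧ Reach φ W w (Ψg w) := fun w hw =>
    have h := IsHomeoOn.mapsTo hg.1 hw
    ⟨h, (hg.2 w hw).reach hφ hX hWS (hW₀ hw) (hW₁ h)⟩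
  have hlr : ∀ w ∈ D τ₁ \ Bs, Ψl w ∈ D τ₀ ∧ Reach φ W w (Ψl w) := fun w hw =>
    have h := IsHomeoOn.mapsTo hl.1 hw
    ⟨h.1, (hl.2 w hw).reach hφ hX hWS (hW₁ hw.1) (hW₀ h.1)⟩
  have hreach : ∀ j ≤ N - 1, Reach φ W x ((Ψg ∘ Ψl)^[j] (Ψg x)) := by
    intro j
    induction j with
    | zero => exact fun _ => (hgr x hx₀.2).2
    | succ j ih =>
      intro hj
      obtain ⟨h1, h2⟩ := hlr _ (hN x hx j hj)
      rw [Function.iterate_succ_apply']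
      exact ((ih (Nat.le_of_succ_le hj)).trans hφ h2).trans hφ (hgr _ h1).2
  have hxz' : Reach φ W x z := hxz ▸ hreach (N - 1) le_rfl
  exact hxz'.exists_isHomoclinicIn hφ hX hWS (M.exists_backward_trajectory hHd hS hx₀.1)
    (M.exists_forward_trajectory hHd hS hz₁.1)
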